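/- **Models.** A nested-parallel computation is built from unit-cost instructions (here: the semiring operations $z\leftarrow\min(x,y)$ and $z\leftarrow x+y$, the closure of a single entry, and copying), sequential composition, forking of two tasks that later join, and stack allocation of temporary arrays in constant time. Its *work* is the total number of operations, its *span* is the length of a longest path in its series-parallel DAG, and it is *race-free* if no two logically parallel parts access the same location with one of the accesses a write. For its sequential execution (temporary arrays lie on a stack whose space is reused) on an ideal cache of $M$ words with lines of $B$ words, initially empty, with optimal offline replacement and with all modified lines written back at the end, the *symmetric cache complexity* is the number of line transfers between cache and memory, and for $\omega\ge 1$ the *asymmetric cache complexity* is the number of read transfers plus $\omega$ times the number of write transfers. All operands of an instruction have to be in the cache when it is executed. **Algorithm.** For $\omega\ge1$, let $\mathrm{Kleene}_\omega$ be the following algorithm on an $n\times n$ matrix $A$ over the semiring $(\min,+)$, stored by rows. If $n=1$, $A\leftarrow\min(A,0)$. Otherwise $A$ is split into quadrants at $\lfloor n/2\rfloor$, and it performs in this order: $\mathrm{Kleene}_\omega(A_{00})$; in parallel $A_{01}\leftarrow A_{01}\oplus A_{00}A_{01}$ and $A_{10}\leftarrow A_{10}\oplus A_{10}A_{00}$;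 $A_{11}\leftarrow A_{11}\oplus A_{10}A_{01}$; $\mathrm{Kleene}_\omega(A_{11})$; in parallel $A_{01}\leftarrow A_{01}\oplus A_{01}A_{11}$ and $A_{10}\leftarrow A_{10}\oplus A_{11}A_{10}$; $A_{00}\leftarrow A_{00}\oplus A_{01}A_{10}$. Each product is computed, from a copy of its right factor stored by columns, into a temporary array, which is then added in parallel to the target. The product of an $n_1\times n_3$ by an $n_3\times n_2$ matrix is a 3-d grid computation $O_{ij}=\bigoplus_k X_{ik}Y_{kj}$, computed recursively: halve the range for which $n_1$, $n_2$, $\omega^{-2/3}n_3$ is largest (only $n_3$ if $n_1=n_2=1$) until one cell is left; if $n_1$ or $n_2$ is halved, the two halves run in parallel; if $n_3$ is halved, the two halves run in parallel with one temporary output array each, and the two arrays are then added in parallel to form the output. All parallel loops use binary forking that halves the longer range. The algorithm does not depend on $M$ and $B$. **Theorem.** 1. For all $\omega\ge1$ and $n$, $\mathrm{Kleene}_\omega$ solves the all-pair shortest-paths problem on directed graphs with $n$ vertices, real edge lengths and no negative cycles, and it is race-free. 2. Its work is $\Theta(n^3)$ and its span is $O(n)$, for $n\ge1$, with constants independent of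 $\omega\ge 1$. 3. Suppose that $B\ge1$, $M\ge 3B$, $M=\Omega(B^2)$ and $n=\Omega(\sqrt M)$. Then the symmetric cache complexity of $\mathrm{Kleene}_1$ is $\Theta\!\left(\dfrac{n^3}{B\sqrt M}\right)$. 4. Suppose that $\omega\ge1$, $B\ge1$, $M\ge3B$, $M=\Omega(B^2+\omega^{2/3})$ and $n=\Omega(\omega^{2/3}\sqrt M)$. Then the asymmetric cache complexity of $\mathrm{Kleene}_\omega$ is $\Theta\!\left(\dfrac{\omega^{1/3}n^3}{B\sqrt M}\right)$. In 3 and 4 the constants hidden in $\Theta$ depend only on those hidden in the hypotheses $\Omega$. -/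

import Mathlib

open scoped ENNReal

namespace KleeneAPSP

/-! ### Nested-parallel programs with stack-allocated arrays -/

/-- A memory location: a live array, named by its position on the stack of live arrays (array `0`
is the input/output matrix), and an offset in it. -/
structure Loc where
  frame : ℕ
  offset : ℕ

/-- Contents of a memory word: a path length, with `⊤` for "no path". -/
abbrev Val := WithTop ℝ

/-- A store: `σ f a` is the word at offset `a` of array `f`. -/
abbrev Store := ℕ → ℕ → Val

/-- The unit-cost instructions, over the closed semiring `(min, +)` on `Val`. -/
inductive Instr where
  /-- `x ← x*`; without negative cycles the closure of a single entry is `min x 0`. -/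
  | star (x : Loc)
  /-- `z ← x` -/
  | copy (z x : Loc)
  /-- `z ← min x y`, the semiring sum -/
  | add (z x y : Loc)
  /-- `z ← x + y`, the semiring product: the computation of one grid cell -/
  | mul (z x y : Loc)

/-- The locations that an instruction reads. -/
def Instr.srcs : Instr → List Loc
  | .star x => [x]
  | .copy _ x => [x]
  | .add _ x y => [x, y]
  | .mul _ x y => [x, y]

/-- The location that an instruction writes. -/
def Instr.dst : Instr → Loc
  | .star x => x
  | .copy z _ => z
  | .add z _ _ => z
  | .mul z _ _ => z

/-- The value that an instruction writes. -/
noncomputable def Instr.val (σ : Store) : Instr → Val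
  | .star x => min (σ x.frame x.offset) 0
  | .copy _ x => σ x.frame x.offset
  | .add _ x y => min (σ x.frame x.offset) (σ y.frame y.offset)
  | .mul _ x y => σ x.frame x.offset + σ y.frame y.offset

/-- Nested-parallel (fork-join) computations. `par P Q` forks the independent tasks `P` and `Q` and
joins them. `alloc m P` pushes a new uninitialized array of `m` words on the stack of live arrays,
runs `P`, and pops it. -/
inductive Prog where
  | skip
  | op (c : Instr)
  | seq (P Q : Prog)
  | par (P Q : Prog)
  | alloc (m : ℕ) (P : Prog)

/-- The effect of a computation on the store, in sequential order. A new array holds whatever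
its words held before. -/
noncomputable def Prog.run : Prog → Store → Store
  | .skip, σ => σ
  | .op c, σ => fun f a => if f = c.dst.frame ∧ a = c.dst.offset then c.val σ else σ f a
  | .seq P Q, σ => Q.run (P.run σ)
  | .par P Q, σ => Q.run (P.run σ)
  | .alloc _ P, σ => P.run σ

/-- Work: the number of operations; a fork and an allocation are operations of unit cost. -/
def Prog.work : Prog → ℕ
  | .skip => 0
  | .op _ => 1
  | .seq P Q => P.work + Q.work
  | .par P Q => P.work + Q.work + 1
  | .alloc _ P => P.work + 1

/-- Span: the length of a longest path in the series-parallel DAG. -/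
def Prog.span : Prog → ℕ
  | .skip => 0
  | .op _ => 1
  | .seq P Q => P.span + Q.span
  | .par P Q => max P.span Q.span + 1
  | .alloc _ P => P.span + 1

/-- `P` contains an instruction that writes `l`. -/
def Prog.Writes (l : Loc) : Prog → Prop
  | .skip => False
  | .op c => l = c.dst
  | .seq P Q => P.Writes l ∨ Q.Writes l
  | .par P Q => P.Writes l ∨ Q.Writes l
  | .alloc _ P => P.Writes l

/-- `P` contains an instruction that reads or writes `l`. -/
def Prog.Touches (l : Loc) : Prog → Prop
  | .skip => False
  | .op c => l ∈ c.srcs ∨ l = c.dst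
  | .seq P Q => P.Touches l ∨ Q.Touches l
  | .par P Q => P.Touches l ∨ Q.Touches l
  | .alloc _ P => P.Touches l

/-- `l` is a word of one of the live arrays, whose sizes are listed in `fs`. -/
def Loc.Live (fs : List ℕ) (l : Loc) : Prop :=
  ∃ m, fs[l.frame]? = some m ∧ l.offset < m

/-- Race freedom of a computation that starts while the arrays of sizes `fs` are live: only live
words are accessed, and no two logically parallel parts access the same location with one of the
accesses a write. Arrays that a task allocates after a fork are private to it, so only the arrays
that are live at the fork (positions below `fs.length`) can be shared. -/
def Prog.RaceFree : List ℕ → Prog → Prop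
  | _, .skip => True
  | fs, .op c => (∀ l ∈ c.srcs, l.Live fs) ∧ c.dst.Live fs
  | fs, .seq P Q => P.RaceFree fs ∧ Q.RaceFree fs
  | fs, .par P Q => P.RaceFree fs ∧ Q.RaceFree fs ∧
      ∀ l : Loc, l.frame < fs.length →
        ¬ (P.Writes l ∧ Q.Touches l) ∧ ¬ (P.Touches l ∧ Q.Writes l)
  | fs, .alloc m P => P.RaceFree (fs ++ [m])

/-! ### Ideal-cache model with asymmetric read and write costs -/

/-- The main-memory address of a location: the live arrays, of sizes `fs`, lie one after the other
on a stack that starts at address `0`. -/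
def Loc.addr (fs : List ℕ) (l : Loc) : ℕ := (fs.take l.frame).sum + l.offset

/-- The addresses that one executed instruction reads and the address that it writes. -/
structure Step where
  srcs : List ℕ
  dst : ℕ

/-- The memory accesses of the sequential (depth-first, left to right) execution that starts while
the arrays of sizes `fs` are live. Popped stack space is reused by later allocations. -/
def Prog.trace : List ℕ → Prog → List Step
  | _, .skip => []
  | fs, .op c => [⟨c.srcs.map (Loc.addr fs), c.dst.addr fs⟩]
  | fs, .seq P Q => P.trace fs ++ Q.trace fs
  | fs, .par P Q => P.trace fs ++ Q.trace fs
  | fs, .alloc m P => P.trace (fs ++ [m])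

/-- `Transfers M B C D t r w`: with a cache of `M` words and lines of `B` words (line `ℓ` holds the
addresses `a` with `a / B = ℓ`) that now holds the lines in `C`, those in `D` being modified, the
accesses `t` can be served with `r` transfers of lines into the cache and `w` transfers of lines
back to main memory, such that at the end no modified line is left in the cache. An instruction
can be executed when all its operands are in the cache. The replacement policy is arbitrary. -/
inductive Transfers (M B : ℕ) : Finset ℕ → Finset ℕ → List Step → ℕ → ℕ → Prop
  | done (C : Finset ℕ) : Transfers M B C ∅ [] 0 0
  | load (C D : Finset ℕ) (t : List Step) (r w ℓ : ℕ) (hℓ : ℓ ∉ C) (hM : (C.card + 1) * B ≤ M)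
      (h : Transfers M B (insert ℓ C) D t r w) : Transfers M B C D t (r + 1) w
  | evictClean (C D : Finset ℕ) (t : List Step) (r w ℓ : ℕ) (hℓ : ℓ ∈ C) (hD : ℓ ∉ D)
      (h : Transfers M B (C.erase ℓ) D t r w) : Transfers M B C D t r w
  | evictDirty (C D : Finset ℕ) (t : List Step) (r w ℓ : ℕ) (hℓ : ℓ ∈ C) (hD : ℓ ∈ D)
      (h : Transfers M B (C.erase ℓ) (D.erase ℓ) t r w) : Transfers M B C D t r (w + 1)
  | exec (C D : Finset ℕ) (s : Step) (t : List Step) (r w : ℕ)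
      (hsrc : ∀ a ∈ s.srcs, a / B ∈ C) (hdst : s.dst / B ∈ C)
      (h : Transfers M B C (insert (s.dst / B) D) t r w) : Transfers M B C D (s :: t) r w

/-- Asymmetric cache complexity of a sequence of accesses, from an empty cache and with optimal
offline replacement: read transfers plus `ω` times write transfers. For `ω = 1` this is the number
of transfers, the symmetric cache complexity. -/
noncomputable def cacheCost (ω : ℝ) (M B : ℕ) (t : List Step) : ℝ≥0∞ :=
  ⨅ (r : ℕ) (w : ℕ) (_ : Transfers M B ∅ ∅ t r w), ((r : ℝ≥0∞) + ENNReal.ofReal ω * (w : ℝ≥0∞))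

/-! ### The algorithms -/

/-- A two-dimensional array, or a rectangular part of one: entry `(i, j)` is at offset
`offset + i * rowStride + j * colStride` of the array `frame`. -/
structure View where
  frame : ℕ
  offset : ℕ
  rowStride : ℕ
  colStride : ℕ

/-- The location of entry `(i, j)`. -/
def View.at (X : View) (i j : ℕ) : Loc := ⟨X.frame, X.offset + i * X.rowStride + j * X.colStride⟩

/-- The part of an array whose upper left entry is entry `(i, j)`. -/
def View.sub (X : View) (i j : ℕ) : View :=
  ⟨X.frame, X.offset + i * X.rowStride + j * X.colStride, X.rowStride, X.colStride⟩

/-- Parallel loop `f i j` for `i₀ ≤ i < i₀ + m₁`, `j₀ ≤ j < j₀ + m₂` (nonempty ranges), by binary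
forking on the longer range. -/
def parFor (f : ℕ → ℕ → Instr) (i₀ j₀ m₁ m₂ : ℕ) : Prog :=
  if m₁ ≤ 1 ∧ m₂ ≤ 1 then .op (f i₀ j₀)
  else if m₂ ≤ m₁ then
    .par (parFor f i₀ j₀ (m₁ / 2) m₂) (parFor f (i₀ + m₁ / 2) j₀ (m₁ - m₁ / 2) m₂)
  else
    .par (parFor f i₀ j₀ m₁ (m₂ / 2)) (parFor f i₀ (j₀ + m₂ / 2) m₁ (m₂ - m₂ / 2))
termination_by m₁ + m₂
decreasing_by all_goals omega

/-- The parallel 3-d grid computation `Z i j ← ⨁ₖ X i k ⊗ Y k j` of size `n₁ × n₂ × n₃` (nonempty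
ranges), started while `fr` arrays are live. The range that maximizes `n₁`, `n₂`, `ω^(-2/3) n₃` is
halved (while it can be: once `n₁ = n₂ = 1` only the last one is left). Halving the first or second
range splits the output between two parallel tasks; halving the last one gives each of the two
parallel tasks its own temporary output array, and these are then added in parallel. -/
noncomputable def grid (ω : ℝ) (fr : ℕ) (X Y Z : View) (n₁ n₂ n₃ : ℕ) : Prog :=
  open scoped Classical in
  if n₁ ≤ 1 ∧ n₂ ≤ 1 ∧ n₃ ≤ 1 then .op (.mul (Z.at 0 0) (X.at 0 0) (Y.at 0 0))
  else if (n₁ ≤ 1 ∧ n₂ ≤ 1) ∨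
      (1 < n₃ ∧ ((max n₁ n₂ : ℕ) : ℝ) < ω ^ (-(2 / 3) : ℝ) * (n₃ : ℝ)) then
    .alloc (n₁ * n₂) (.alloc (n₁ * n₂) (.seq
      (.par
        (grid ω (fr + 2) X Y ⟨fr, 0, n₂, 1⟩ n₁ n₂ (n₃ / 2))
        (grid ω (fr + 2) (X.sub 0 (n₃ / 2)) (Y.sub (n₃ / 2) 0) ⟨fr + 1, 0, n₂, 1⟩
          n₁ n₂ (n₃ - n₃ / 2)))
      (parFor (fun i j => .add (Z.at i j) (View.at ⟨fr, 0, n₂, 1⟩ i j)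
        (View.at ⟨fr + 1, 0, n₂, 1⟩ i j)) 0 0 n₁ n₂)))
  else if n₂ ≤ n₁ then
    .par (grid ω fr X Y Z (n₁ / 2) n₂ n₃)
      (grid ω fr (X.sub (n₁ / 2) 0) Y (Z.sub (n₁ / 2) 0) (n₁ - n₁ / 2) n₂ n₃)
  else
    .par (grid ω fr X Y Z n₁ (n₂ / 2) n₃)
      (grid ω fr X (Y.sub 0 (n₂ / 2)) (Z.sub 0 (n₂ / 2)) n₁ (n₂ - n₂ / 2) n₃)
termination_by n₁ + n₂ + n₃
decreasing_by all_goals omega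

/-- `Z ← Z ⊕ X Y` with `X` of size `m₁ × m₃` and `Y` of size `m₃ × m₂`, started while `fr` arrays
are live. `Z` may be the same array as `X` or `Y`, so the grid computation has an output array of
its own (stored by rows), and it works on its own copy of `Y` (stored by columns, as the grid cells
run through the columns of `Y`). -/
noncomputable def mulAdd (ω : ℝ) (fr : ℕ) (Z X Y : View) (m₁ m₂ m₃ : ℕ) : Prog :=
  .alloc (m₃ * m₂) (.alloc (m₁ * m₂) (.seq
    (parFor (fun k j => .copy (View.at ⟨fr, 0, 1, m₃⟩ k j) (Y.at k j)) 0 0 m₃ m₂)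
    (.seq
      (grid ω (fr + 2) X ⟨fr, 0, 1, m₃⟩ ⟨fr + 1, 0, m₂, 1⟩ m₁ m₂ m₃)
      (parFor (fun i j => .add (Z.at i j) (Z.at i j) (View.at ⟨fr + 1, 0, m₂, 1⟩ i j))
        0 0 m₁ m₂))))

/-- Kleene's divide-and-conquer algorithm on the `n × n` array `A`, the only live array. -/
noncomputable def kleeneRec (ω : ℝ) (A : View) (n : ℕ) : Prog :=
  if n = 0 then .skip
  else if n = 1 then .op (.star (A.at 0 0))
  else
    .seq (kleeneRec ω A (n / 2)) <|
    .seq (.par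
      (mulAdd ω 1 (A.sub 0 (n / 2)) A (A.sub 0 (n / 2)) (n / 2) (n - n / 2) (n / 2))
      (mulAdd ω 1 (A.sub (n / 2) 0) (A.sub (n / 2) 0) A (n - n / 2) (n / 2) (n / 2))) <|
    .seq (mulAdd ω 1 (A.sub (n / 2) (n / 2)) (A.sub (n / 2) 0) (A.sub 0 (n / 2))
      (n - n / 2) (n - n / 2) (n / 2)) <|
    .seq (kleeneRec ω (A.sub (n / 2) (n / 2)) (n - n / 2)) <|
    .seq (.par
      (mulAdd ω 1 (A.sub 0 (n / 2)) (A.sub 0 (n / 2)) (A.sub (n / 2) (n / 2))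
        (n / 2) (n - n / 2) (n - n / 2))
      (mulAdd ω 1 (A.sub (n / 2) 0) (A.sub (n / 2) (n / 2)) (A.sub (n / 2) 0)
        (n - n / 2) (n / 2) (n - n / 2)))
    (mulAdd ω 1 A (A.sub 0 (n / 2)) (A.sub (n / 2) 0) (n / 2) (n / 2) (n - n / 2))
termination_by n
decreasing_by all_goals omega

/-- Kleene's algorithm for write/read cost ratio `ω` on an `n × n` matrix stored by rows. -/
noncomputable def kleene (ω : ℝ) (n : ℕ) : Prog := kleeneRec ω ⟨0, 0, n, 1⟩ n

/-! ### All-pair shortest paths -/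

/-- The length of the walk that starts at `i` and then visits the vertices in the list, for edge
lengths `w` (`w i j = ⊤` if there is no edge from `i` to `j`). -/
def walkLength {n : ℕ} (w : Fin n → Fin n → Val) : Fin n → List (Fin n) → Val
  | _, [] => 0
  | i, v :: l => w i v + walkLength w v l

/-- The lengths of the walks from `i` to `j`. -/
def walkLengths {n : ℕ} (w : Fin n → Fin n → Val) (i j : Fin n) : Set Val :=
  {x | ∃ l : List (Fin n), l.getLastD i = j ∧ walkLength w i l = x}

/-- No closed walk (equivalently, no cycle) has negative length. -/
def NoNegCycle {n : ℕ} (w : Fin n → Fin n → Val) : Prop :=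
  ∀ i : Fin n, ∀ x ∈ walkLengths w i i, 0 ≤ x

/-- The program `P` solves all-pair shortest paths on `n` vertices: started with the matrix of edge
lengths in array `0` (by rows), and anything elsewhere, it leaves the matrix of shortest-path
distances there. -/
def ComputesAPSP (n : ℕ) (P : Prog) : Prop :=
  ∀ w : Fin n → Fin n → Val, NoNegCycle w →
    ∀ σ : Store, (∀ i j : Fin n, σ 0 ((i : ℕ) * n + j) = w i j) →
      ∀ i j : Fin n, IsLeast (walkLengths w i j) (P.run σ 0 ((i : ℕ) * n + j))

end KleeneAPSP

namespace KleeneAPSP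

/-! ### Induction principles -/

/-! Correctness: the algorithm only takes minima and concatenates walks, so every value left in the
matrix is the length of a walk. Conversely the final matrix is entrywise at most the edge lengths,
is at most 0 on the diagonal and satisfies the triangle inequality; by induction along a walk its
entries are therefore at most all walk lengths. The triangle inequality passes through the block
recursion by `closed_of_blocks`, a case distinction over the blocks of the three indices. Race
freedom holds because forked tasks write disjoint rectangles or different temporaries, and whatever
lies above the live frames is private.

Work and span: the six products of one level make up the mixed terms of `(a + b) ^ 3`. A product has
span `O(log² n)` for every `ω`, and `T(n) = 2 T(n/2) + O(log² n)` is linear.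

Write `g = ω^(1/3)`, `q = g²`, `s = √M`. The lower bound counts write transfers only
(`grid_needsWrites`). A product is cut into subgrids whose third side is `O(q s)` while both output
sides stay at least `2 s`. Each subgrid writes at least `4 M` distinct words, of which at most `M`
can still be in the cache afterwards, so a constant fraction of its output lines is written back.
This is one write transfer for every `O(B q s)` cells, and multiplication by `ω` gives `g n³ / (B
s)`.

For the upper bound, halving the scaled maximum keeps `n₁` and `n₂` comparable and `n₃ = O(q n₁)`
(`GridShape`). As soon as the output fits into the cache, it is pinned there together with the stack
of temporaries, so that it is written back only once (`grid_cost_of_fit`). Under the pinned lines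
the recursion continues until the factors fit too; such a subgrid has `Ω(s³ / g)` cells and takes
`O(s² / B)` reads, which is `O(g / (B s))` per cell (`grid_pinned`). Above the pinned blocks, the
additions of temporaries occur only where the third side is long compared with the output, and a
negative term in the induction makes the volume pay for them (`grid_cost_of_heavy`). Kleene's
recursion then adds terms of order `g³ n² / B` and `g³ s² / B`, which the hypothesis `n = Ω(g² s)`
absorbs. For bounded `M` it suffices to charge every instruction separately. -/

theorem parFor_rec {f : ℕ → ℕ → Instr} {motive : ℕ → ℕ → ℕ → ℕ → Prog → Prop}
    (one : ∀ i j, motive i j 1 1 (.op (f i j)))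
    (row : ∀ i j a b m P Q, 0 < a → a ≤ b → b ≤ a + 1 → 0 < m → m ≤ a + b →
      P = parFor f i j a m → Q = parFor f (i + a) j b m →
      motive i j a m P → motive (i + a) j b m Q → motive i j (a + b) m (.par P Q))
    (col : ∀ i j m a b P Q, 0 < a → a ≤ b → b ≤ a + 1 → 0 < m → m ≤ a + b →
      P = parFor f i j m a → Q = parFor f i (j + a) m b →
      motive i j m a P → motive i (j + a) m b Q → motive i j m (a + b) (.par P Q))
    (i j m₁ m₂ : ℕ) (h₁ : 0 < m₁) (h₂ : 0 < m₂) : motive i j m₁ m₂ (parFor f i j m₁ m₂) := by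
  induction i, j, m₁, m₂ using parFor.induct with
  | case1 i j m₁ m₂ h =>
    obtain rfl : m₁ = 1 := by omega
    obtain rfl : m₂ = 1 := by omega
    rw [parFor, if_pos h]
    exact one i j
  | case2 i j m₁ m₂ h h' ih₁ ih₂ =>
    rw [parFor, if_neg h, if_pos h']
    have := row i j (m₁ / 2) (m₁ - m₁ / 2) m₂ _ _ (by omega) (by omega) (by omega) h₂ (by omega)
      rfl rfl (ih₁ (by omega) h₂) (ih₂ (by omega) h₂)
    rwa [show m₁ / 2 + (m₁ - m₁ / 2) = m₁ by omega] at this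
  | case3 i j m₁ m₂ h h' ih₁ ih₂ =>
    rw [parFor, if_neg h, if_neg h']
    have := col i j m₁ (m₂ / 2) (m₂ - m₂ / 2) _ _ (by omega) (by omega) (by omega) h₁ (by omega)
      rfl rfl (ih₁ h₁ (by omega)) (ih₂ h₁ (by omega))
    rwa [show m₂ / 2 + (m₂ - m₂ / 2) = m₂ by omega] at this

/-- The parallel addition of two temporary arrays in a grid computation. -/
def addTemps (fr : ℕ) (Z : View) (n₁ n₂ : ℕ) : Prog :=
  parFor (fun i j => .add (Z.at i j) (View.at ⟨fr, 0, n₂, 1⟩ i j)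
    (View.at ⟨fr + 1, 0, n₂, 1⟩ i j)) 0 0 n₁ n₂

theorem lt_rpow_neg_mul_iff {ω x y : ℝ} (hω : 1 ≤ ω) :
    x < ω ^ (-(2 / 3) : ℝ) * y ↔ ω ^ (2 / 3 : ℝ) * x < y := by
  have h : 0 < ω ^ (2 / 3 : ℝ) := by positivity
  rw [Real.rpow_neg (by linarith), inv_mul_eq_div, lt_div_iff₀ h, mul_comm]

/-- Prepared for the inductions below: the size test is freed of its negative exponent, the halves
appear as `a ≤ b ≤ a + 1`, and the equations for `P` and `Q` are kept because facts about the write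
set of a half are quoted for `grid` itself. -/
theorem grid_rec {ω : ℝ} (hω : 1 ≤ ω)
    {motive : ℕ → View → View → View → ℕ → ℕ → ℕ → Prog → Prop}
    (one : ∀ fr X Y Z, motive fr X Y Z 1 1 1 (.op (.mul (Z.at 0 0) (X.at 0 0) (Y.at 0 0))))
    (split₃ : ∀ fr X Y Z n₁ n₂ a b P Q, 0 < n₁ → 0 < n₂ → 0 < a → a ≤ b → b ≤ a + 1 →
      ((n₁ = 1 ∧ n₂ = 1) ∨ ω ^ (2 / 3 : ℝ) * (max n₁ n₂ : ℕ) < (a + b : ℕ)) →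
      P = grid ω (fr + 2) X Y ⟨fr, 0, n₂, 1⟩ n₁ n₂ a →
      Q = grid ω (fr + 2) (X.sub 0 a) (Y.sub a 0) ⟨fr + 1, 0, n₂, 1⟩ n₁ n₂ b →
      motive (fr + 2) X Y ⟨fr, 0, n₂, 1⟩ n₁ n₂ a P →
      motive (fr + 2) (X.sub 0 a) (Y.sub a 0) ⟨fr + 1, 0, n₂, 1⟩ n₁ n₂ b Q →
      motive fr X Y Z n₁ n₂ (a + b) (.alloc (n₁ * n₂) (.alloc (n₁ * n₂)
        (.seq (.par P Q) (addTemps fr Z n₁ n₂)))))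
    (split₁ : ∀ fr X Y Z a b n₂ (n₃ : ℕ) P Q, 0 < a → a ≤ b → b ≤ a + 1 → 0 < n₂ → 0 < n₃ →
      n₂ ≤ a + b → (n₃ : ℝ) ≤ ω ^ (2 / 3 : ℝ) * (a + b : ℕ) →
      P = grid ω fr X Y Z a n₂ n₃ → Q = grid ω fr (X.sub a 0) Y (Z.sub a 0) b n₂ n₃ →
      motive fr X Y Z a n₂ n₃ P →
      motive fr (X.sub a 0) Y (Z.sub a 0) b n₂ n₃ Q →
      motive fr X Y Z (a + b) n₂ n₃ (.par P Q))
    (split₂ : ∀ fr X Y Z n₁ a b (n₃ : ℕ) P Q, 0 < n₁ → 0 < a → a ≤ b → b ≤ a + 1 → 0 < n₃ →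
      n₁ ≤ a + b → (n₃ : ℝ) ≤ ω ^ (2 / 3 : ℝ) * (a + b : ℕ) →
      P = grid ω fr X Y Z n₁ a n₃ → Q = grid ω fr X (Y.sub 0 a) (Z.sub 0 a) n₁ b n₃ →
      motive fr X Y Z n₁ a n₃ P →
      motive fr X (Y.sub 0 a) (Z.sub 0 a) n₁ b n₃ Q →
      motive fr X Y Z n₁ (a + b) n₃ (.par P Q))
    (fr : ℕ) (X Y Z : View) (n₁ n₂ n₃ : ℕ) (h₁ : 0 < n₁) (h₂ : 0 < n₂) (h₃ : 0 < n₃) :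
    motive fr X Y Z n₁ n₂ n₃ (grid ω fr X Y Z n₁ n₂ n₃) := by
  have hq : 1 ≤ ω ^ (2 / 3 : ℝ) := Real.one_le_rpow hω (by norm_num)
  -- The test can also fail because `n₃ ≤ 1`; then the bound follows from `1 ≤ ω ^ (2 / 3)`.
  have aux : ∀ m n₃ : ℕ, 0 < m → ¬ (1 < n₃ ∧ ω ^ (2 / 3 : ℝ) * (m : ℕ) < n₃) →
      (n₃ : ℝ) ≤ ω ^ (2 / 3 : ℝ) * m := by
    intro m n₃ hm h
    by_cases h1 : 1 < n₃
    · simpa [h1] using h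
    · have : (n₃ : ℝ) ≤ 1 := by exact_mod_cast not_lt.mp h1
      have : (1 : ℝ) ≤ m := by exact_mod_cast hm
      nlinarith
  induction fr, X, Y, Z, n₁, n₂, n₃ using grid.induct ω with
  | case1 fr X Y Z n₁ n₂ n₃ h =>
    obtain rfl : n₁ = 1 := by omega
    obtain rfl : n₂ = 1 := by omega
    obtain rfl : n₃ = 1 := by omega
    rw [grid, if_pos h]
    exact one fr X Y Z
  | case2 fr X Y Z n₁ n₂ n₃ h h' ih₁ ih₂ =>
    rw [grid, if_neg h, if_pos h']
    rw [lt_rpow_neg_mul_iff hω] at h'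
    have h3 : 1 < n₃ := by
      rcases h' with h' | h'
      · omega
      · exact h'.1
    have := split₃ fr X Y Z n₁ n₂ (n₃ / 2) (n₃ - n₃ / 2) _ _ h₁ h₂ (by omega) (by omega) (by omega)
      (h'.imp (fun h => by omega) (fun h => by
        rw [show n₃ / 2 + (n₃ - n₃ / 2) = n₃ by omega]; exact h.2))
      rfl rfl (ih₁ h₁ h₂ (by omega)) (ih₂ h₁ h₂ (by omega))
    rwa [show n₃ / 2 + (n₃ - n₃ / 2) = n₃ by omega] at this
  | case3 fr X Y Z n₁ n₂ n₃ h h' h'' ih₁ ih₂ =>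
    rw [grid, if_neg h, if_neg h', if_pos h'']
    rw [lt_rpow_neg_mul_iff hω, not_or, max_eq_left h''] at h'
    have := split₁ fr X Y Z (n₁ / 2) (n₁ - n₁ / 2) n₂ n₃ _ _ (by omega) (by omega) (by omega) h₂ h₃
      (by omega) (by
        rw [show n₁ / 2 + (n₁ - n₁ / 2) = n₁ by omega]; exact aux n₁ n₃ h₁ h'.2)
      rfl rfl (ih₁ (by omega) h₂ h₃) (ih₂ (by omega) h₂ h₃)
    rwa [show n₁ / 2 + (n₁ - n₁ / 2) = n₁ by omega] at this
  | case4 fr X Y Z n₁ n₂ n₃ h h' h'' ih₁ ih₂ =>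
    rw [grid, if_neg h, if_neg h', if_neg h'']
    rw [lt_rpow_neg_mul_iff hω, not_or, max_eq_right (by omega)] at h'
    have := split₂ fr X Y Z n₁ (n₂ / 2) (n₂ - n₂ / 2) n₃ _ _ h₁ (by omega) (by omega) (by omega) h₃
      (by omega) (by
        rw [show n₂ / 2 + (n₂ - n₂ / 2) = n₂ by omega]; exact aux n₂ n₃ h₂ h'.2)
      rfl rfl (ih₁ h₁ (by omega) h₃) (ih₂ h₁ (by omega) h₃)
    rwa [show n₂ / 2 + (n₂ - n₂ / 2) = n₂ by omega] at this

/-! ### Accessed locations -/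

@[simp] theorem View.sub_at (X : View) (a b i j : ℕ) : (X.sub a b).at i j = X.at (a + i) (b + j) := by
  simp only [View.sub, View.at, Loc.mk.injEq, true_and]
  ring

@[simp] theorem View.sub_frame (X : View) (a b : ℕ) : (X.sub a b).frame = X.frame := rfl
@[simp] theorem View.at_frame (X : View) (i j : ℕ) : (X.at i j).frame = X.frame := rfl

/-- Distinct entries of an array stored by rows of length at least `n` have distinct locations. -/
theorem View.at_inj {Z : View} {n i j i' j' : ℕ} (hc : Z.colStride = 1) (hr : n ≤ Z.rowStride)
    (hj : j < n) (hj' : j' < n) (h : Z.at i j = Z.at i' j') : i = i' ∧ j = j' := by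
  simp only [View.at, Loc.mk.injEq, true_and, hc, mul_one] at h
  have h' : i * Z.rowStride + j = i' * Z.rowStride + j' := by omega
  have hi : i = i' := by
    rcases lt_trichotomy i i' with hlt | heq | hlt
    · have := Nat.mul_le_mul_right Z.rowStride (show i + 1 ≤ i' from hlt)
      rw [add_mul] at this
      omega
    · exact heq
    · have := Nat.mul_le_mul_right Z.rowStride (show i' + 1 ≤ i from hlt)
      rw [add_mul] at this
      omega
  subst hi
  exact ⟨rfl, by omega⟩

theorem exists_lt_add_iff {p : ℕ → Prop} (a b : ℕ) :
    (∃ i < a + b, p i) ↔ (∃ i < a, p i) ∨ ∃ i < b, p (a + i) := by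
  constructor
  · rintro ⟨i, hi, h⟩
    by_cases hia : i < a
    · exact .inl ⟨i, hia, h⟩
    · exact .inr ⟨i - a, by omega, by rwa [show a + (i - a) = i by omega]⟩
  · rintro (⟨i, hi, h⟩ | ⟨i, hi, h⟩)
    · exact ⟨i, by omega, h⟩
    · exact ⟨a + i, by omega, h⟩

theorem parFor_writes {f : ℕ → ℕ → Instr} {l : Loc} {i j m₁ m₂ : ℕ} (h₁ : 0 < m₁) (h₂ : 0 < m₂) :
    (parFor f i j m₁ m₂).Writes l ↔ ∃ a < m₁, ∃ b < m₂, l = (f (i + a) (j + b)).dst := by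
  refine parFor_rec (motive := fun i j m₁ m₂ P => P.Writes l ↔
    ∃ a < m₁, ∃ b < m₂, l = (f (i + a) (j + b)).dst) ?_ ?_ ?_ i j m₁ m₂ h₁ h₂
  · intro i j
    simp [Prog.Writes]
  · intro i j a b m P Q _ _ _ _ _ _ _ hP hQ
    simp only [Prog.Writes, hP, hQ, exists_lt_add_iff, add_assoc]
  · intro i j m a b P Q _ _ _ _ _ _ _ hP hQ
    simp only [Prog.Writes, hP, hQ, exists_lt_add_iff, add_assoc, and_or_left, exists_or]

theorem exists_exists_lt_add_iff {p : ℕ → ℕ → Prop} (m a b : ℕ) :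
    (∃ i < m, ∃ j < a + b, p i j) ↔
      (∃ i < m, ∃ j < a, p i j) ∨ ∃ i < m, ∃ j < b, p i (a + j) := by
  simp only [exists_lt_add_iff, and_or_left, exists_or]

theorem parFor_touches {f : ℕ → ℕ → Instr} {l : Loc} {i j m₁ m₂ : ℕ} (h₁ : 0 < m₁) (h₂ : 0 < m₂) :
    (parFor f i j m₁ m₂).Touches l ↔ ∃ a < m₁, ∃ b < m₂,
      l ∈ (f (i + a) (j + b)).srcs ∨ l = (f (i + a) (j + b)).dst := by
  refine parFor_rec (motive := fun i j m₁ m₂ P => P.Touches l ↔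
    ∃ a < m₁, ∃ b < m₂, l ∈ (f (i + a) (j + b)).srcs ∨ l = (f (i + a) (j + b)).dst)
    ?_ ?_ ?_ i j m₁ m₂ h₁ h₂
  · intro i j
    simp [Prog.Touches]
  · intro i j a b m P Q _ _ _ _ _ _ _ hP hQ
    simp only [Prog.Touches, hP, hQ, exists_lt_add_iff, add_assoc]
  · intro i j m a b P Q _ _ _ _ _ _ _ hP hQ
    simp only [Prog.Touches, hP, hQ, exists_exists_lt_add_iff m a b, add_assoc]

theorem addTemps_writes {fr : ℕ} {Z : View} {n₁ n₂ : ℕ} {l : Loc} (h₁ : 0 < n₁) (h₂ : 0 < n₂) :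
    (addTemps fr Z n₁ n₂).Writes l ↔ ∃ i < n₁, ∃ j < n₂, l = Z.at i j := by
  simp [addTemps, parFor_writes h₁ h₂, Instr.dst]

theorem addTemps_touches {fr : ℕ} {Z : View} {n₁ n₂ : ℕ} {l : Loc} (h₁ : 0 < n₁) (h₂ : 0 < n₂) :
    (addTemps fr Z n₁ n₂).Touches l →
      (∃ i < n₁, ∃ j < n₂, l = Z.at i j) ∨ fr ≤ l.frame := by
  rw [addTemps, parFor_touches h₁ h₂]
  simp only [Instr.dst, Instr.srcs, List.mem_cons, List.not_mem_nil, or_false, zero_add]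
  rintro ⟨i, hi, j, hj, (rfl | rfl) | rfl⟩
  · exact .inr (by simp)
  · exact .inr (by simp)
  · exact .inl ⟨i, hi, j, hj, rfl⟩

/-- A grid computation writes its whole output. -/
theorem grid_writes_output {ω : ℝ} (hω : 1 ≤ ω) {fr : ℕ} {X Y Z : View} {n₁ n₂ n₃ : ℕ}
    (h₁ : 0 < n₁) (h₂ : 0 < n₂) (h₃ : 0 < n₃) {i j : ℕ} (hi : i < n₁) (hj : j < n₂) :
    (grid ω fr X Y Z n₁ n₂ n₃).Writes (Z.at i j) := by
  revert i j
  refine grid_rec hω (motive := fun fr X Y Z n₁ n₂ n₃ P => ∀ {i j}, i < n₁ → j < n₂ →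
    P.Writes (Z.at i j)) ?_ ?_ ?_ ?_ fr X Y Z n₁ n₂ n₃ h₁ h₂ h₃
  · intro fr X Y Z i j hi hj
    obtain rfl : i = 0 := by omega
    obtain rfl : j = 0 := by omega
    simp [Prog.Writes, Instr.dst]
  · intro fr X Y Z n₁ n₂ a b P Q h₁ h₂ _ _ _ _ _ _ _ _ i j hi hj
    exact .inr ((addTemps_writes h₁ h₂).2 ⟨i, hi, j, hj, rfl⟩)
  · intro fr X Y Z a b n₂ n₃ P Q _ _ _ _ _ _ _ _ _ hP hQ i j hi hj
    by_cases h : i < a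
    · exact .inl (hP h hj)
    · have := @hQ (i - a) j (by omega) hj
      rw [View.sub_at, show a + (i - a) = i by omega, zero_add] at this
      exact .inr this
  · intro fr X Y Z n₁ a b n₃ P Q _ _ _ _ _ _ _ _ _ hP hQ i j hi hj
    by_cases h : j < a
    · exact .inl (hP hi h)
    · have := @hQ i (j - a) hi (by omega)
      rw [View.sub_at, show a + (j - a) = j by omega, zero_add] at this
      exact .inr this

/-- Frames from `fr` on are arrays that the computation allocates itself, so the second alternative
is private storage. -/
theorem grid_writes {ω : ℝ} (hω : 1 ≤ ω) {fr : ℕ} {X Y Z : View} {n₁ n₂ n₃ : ℕ}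
    (h₁ : 0 < n₁) (h₂ : 0 < n₂) (h₃ : 0 < n₃) {l : Loc}
    (h : (grid ω fr X Y Z n₁ n₂ n₃).Writes l) :
    (∃ i < n₁, ∃ j < n₂, l = Z.at i j) ∨ fr ≤ l.frame := by
  revert h
  refine grid_rec hω (motive := fun fr X Y Z n₁ n₂ n₃ P => P.Writes l →
    (∃ i < n₁, ∃ j < n₂, l = Z.at i j) ∨ fr ≤ l.frame) ?_ ?_ ?_ ?_ fr X Y Z n₁ n₂ n₃ h₁ h₂ h₃
  · intro fr X Y Z h
    exact .inl ⟨0, one_pos, 0, one_pos, h⟩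
  · rintro fr X Y Z n₁ n₂ a b P Q h₁ h₂ _ _ _ _ _ _ hP hQ ((h | h) | h)
    · rcases hP h with ⟨i, _, j, _, rfl⟩ | h
      · exact .inr (by simp)
      · exact .inr (by omega)
    · rcases hQ h with ⟨i, _, j, _, rfl⟩ | h
      · exact .inr (by simp)
      · exact .inr (by omega)
    · exact .inl ((addTemps_writes h₁ h₂).1 h)
  · rintro fr X Y Z a b n₂ n₃ P Q _ _ _ _ _ _ _ _ _ hP hQ (h | h)
    · exact (hP h).imp_left fun h => by rw [exists_lt_add_iff]; exact .inl h
    · refine (hQ h).imp_left fun h => ?_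
      simp only [View.sub_at, zero_add] at h
      rw [exists_lt_add_iff]; exact .inr h
  · rintro fr X Y Z n₁ a b n₃ P Q _ _ _ _ _ _ _ _ _ hP hQ (h | h)
    · refine (hP h).imp_left fun ⟨i, hi, j, hj, e⟩ => ⟨i, hi, j, by omega, e⟩
    · refine (hQ h).imp_left fun ⟨i, hi, j, hj, e⟩ => ⟨i, hi, a + j, by omega, ?_⟩
      rw [e, View.sub_at, zero_add]

theorem grid_touches {ω : ℝ} (hω : 1 ≤ ω) {fr : ℕ} {X Y Z : View} {n₁ n₂ n₃ : ℕ}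
    (h₁ : 0 < n₁) (h₂ : 0 < n₂) (h₃ : 0 < n₃) {l : Loc}
    (h : (grid ω fr X Y Z n₁ n₂ n₃).Touches l) :
    (∃ i < n₁, ∃ k < n₃, l = X.at i k) ∨ (∃ k < n₃, ∃ j < n₂, l = Y.at k j) ∨
      (∃ i < n₁, ∃ j < n₂, l = Z.at i j) ∨ fr ≤ l.frame := by
  revert h
  refine grid_rec hω (motive := fun fr X Y Z n₁ n₂ n₃ P => P.Touches l →
    (∃ i < n₁, ∃ k < n₃, l = X.at i k) ∨ (∃ k < n₃, ∃ j < n₂, l = Y.at k j) ∨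
      (∃ i < n₁, ∃ j < n₂, l = Z.at i j) ∨ fr ≤ l.frame)
    ?_ ?_ ?_ ?_ fr X Y Z n₁ n₂ n₃ h₁ h₂ h₃
  · intro fr X Y Z h
    simp only [Prog.Touches, Instr.srcs, Instr.dst, List.mem_cons, List.not_mem_nil, or_false] at h
    rcases h with (h | h) | h
    · exact .inl ⟨0, one_pos, 0, one_pos, h⟩
    · exact .inr (.inl ⟨0, one_pos, 0, one_pos, h⟩)
    · exact .inr (.inr (.inl ⟨0, one_pos, 0, one_pos, h⟩))
  · rintro fr X Y Z n₁ n₂ a b P Q h₁ h₂ _ _ _ _ _ _ hP hQ ((h | h) | h)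
    · rcases hP h with ⟨i, hi, k, hk, e⟩ | ⟨k, hk, j, hj, e⟩ | ⟨i, _, j, _, rfl⟩ | h
      · exact .inl ⟨i, hi, k, by omega, e⟩
      · exact .inr (.inl ⟨k, by omega, j, hj, e⟩)
      · exact .inr (.inr (.inr (by simp)))
      · exact .inr (.inr (.inr (by omega)))
    · rcases hQ h with ⟨i, hi, k, hk, e⟩ | ⟨k, hk, j, hj, e⟩ | ⟨i, _, j, _, rfl⟩ | h
      · exact .inl ⟨i, hi, a + k, by omega, by rw [e, View.sub_at, zero_add]⟩
      · exact .inr (.inl ⟨a + k, by omega, j, hj, by rw [e, View.sub_at, zero_add]⟩)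
      · exact .inr (.inr (.inr (by simp)))
      · exact .inr (.inr (.inr (by omega)))
    · exact .inr (.inr (addTemps_touches h₁ h₂ h))
  · rintro fr X Y Z a b n₂ n₃ P Q _ _ _ _ _ _ _ _ _ hP hQ (h | h)
    · rcases hP h with ⟨i, hi, k, hk, e⟩ | h | ⟨i, hi, j, hj, e⟩ | h
      · exact .inl ⟨i, by omega, k, hk, e⟩
      · exact .inr (.inl h)
      · exact .inr (.inr (.inl ⟨i, by omega, j, hj, e⟩))
      · exact .inr (.inr (.inr h))
    · rcases hQ h with ⟨i, hi, k, hk, e⟩ | h | ⟨i, hi, j, hj, e⟩ | h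
      · exact .inl ⟨a + i, by omega, k, hk, by rw [e, View.sub_at, zero_add]⟩
      · exact .inr (.inl h)
      · exact .inr (.inr (.inl ⟨a + i, by omega, j, hj, by rw [e, View.sub_at, zero_add]⟩))
      · exact .inr (.inr (.inr h))
  · rintro fr X Y Z n₁ a b n₃ P Q _ _ _ _ _ _ _ _ _ hP hQ (h | h)
    · rcases hP h with h | ⟨k, hk, j, hj, e⟩ | ⟨i, hi, j, hj, e⟩ | h
      · exact .inl h
      · exact .inr (.inl ⟨k, hk, j, by omega, e⟩)
      · exact .inr (.inr (.inl ⟨i, hi, j, by omega, e⟩))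
      · exact .inr (.inr (.inr h))
    · rcases hQ h with h | ⟨k, hk, j, hj, e⟩ | ⟨i, hi, j, hj, e⟩ | h
      · exact .inl h
      · exact .inr (.inl ⟨k, hk, a + j, by omega, by rw [e, View.sub_at, zero_add]⟩)
      · exact .inr (.inr (.inl ⟨i, hi, a + j, by omega, by rw [e, View.sub_at, zero_add]⟩))
      · exact .inr (.inr (.inr h))

/-! ### Semantics -/

/-- The word at a location. -/
def Store.get (σ : Store) (l : Loc) : Val := σ l.frame l.offset

theorem Prog.run_of_not_writes {P : Prog} {σ : Store} {l : Loc} (h : ¬ P.Writes l) :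
    (P.run σ).get l = σ.get l := by
  induction P generalizing σ with
  | skip => rfl
  | op c =>
    simp only [Prog.Writes] at h
    simp only [Store.get, Prog.run]
    rw [if_neg]
    rintro ⟨h₁, h₂⟩
    apply h
    cases l
    cases hc : c.dst
    simp_all
  | seq P Q hP hQ =>
    simp only [Prog.Writes, not_or] at h
    rw [Prog.run, hQ h.2, hP h.1]
  | par P Q hP hQ =>
    simp only [Prog.Writes, not_or] at h
    rw [Prog.run, hQ h.2, hP h.1]
  | alloc m P hP => exact hP h

theorem Prog.op_run_dst (c : Instr) (σ : Store) : ((Prog.op c).run σ).get c.dst = c.val σ := by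
  simp [Store.get, Prog.run]

theorem Instr.val_congr {c : Instr} {σ τ : Store} (h : ∀ l ∈ c.srcs, σ.get l = τ.get l) :
    c.val σ = c.val τ := by
  cases c <;> simp_all [Instr.val, Instr.srcs, Store.get]

/-- The iterations of a parallel loop are independent. -/
def Independent (f : ℕ → ℕ → Instr) (i j m₁ m₂ : ℕ) : Prop :=
  ∀ a < m₁, ∀ b < m₂, ∀ a' < m₁, ∀ b' < m₂, (a ≠ a' ∨ b ≠ b') →
    (f (i + a) (j + b)).dst ≠ (f (i + a') (j + b')).dst ∧
      (f (i + a) (j + b)).dst ∉ (f (i + a') (j + b')).srcs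

theorem Independent.row_left {f : ℕ → ℕ → Instr} {i j a b m : ℕ}
    (h : Independent f i j (a + b) m) : Independent f i j a m :=
  fun x hx y hy x' hx' y' hy' => h x (by omega) y hy x' (by omega) y' hy'

theorem Independent.row_right {f : ℕ → ℕ → Instr} {i j a b m : ℕ}
    (h : Independent f i j (a + b) m) : Independent f (i + a) j b m := by
  intro x hx y hy x' hx' y' hy' hne
  have := h (a + x) (by omega) y hy (a + x') (by omega) y' hy' (by omega)
  simpa only [add_assoc] using this

theorem Independent.col_left {f : ℕ → ℕ → Instr} {i j a b m : ℕ}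
    (h : Independent f i j m (a + b)) : Independent f i j m a :=
  fun x hx y hy x' hx' y' hy' => h x hx y (by omega) x' hx' y' (by omega)

theorem Independent.col_right {f : ℕ → ℕ → Instr} {i j a b m : ℕ}
    (h : Independent f i j m (a + b)) : Independent f i (j + a) m b := by
  intro x hx y hy x' hx' y' hy' hne
  have := h x hx (a + y) (by omega) x' hx' (a + y') (by omega) (by omega)
  simpa only [add_assoc] using this

/-- Independence works in both directions: the later half overwrites no result of the earlier one,
and it reads nothing that the earlier one wrote. -/
theorem parFor_run {f : ℕ → ℕ → Instr} {i j m₁ m₂ : ℕ} (h₁ : 0 < m₁) (h₂ : 0 < m₂)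
    (hf : Independent f i j m₁ m₂) {σ : Store} {a b : ℕ} (ha : a < m₁) (hb : b < m₂) :
    ((parFor f i j m₁ m₂).run σ).get (f (i + a) (j + b)).dst = (f (i + a) (j + b)).val σ := by
  revert hf σ a b
  refine parFor_rec (motive := fun i j m₁ m₂ P => Independent f i j m₁ m₂ →
    ∀ {σ : Store} {a b : ℕ}, a < m₁ → b < m₂ →
      (P.run σ).get (f (i + a) (j + b)).dst = (f (i + a) (j + b)).val σ) ?_ ?_ ?_ i j m₁ m₂ h₁ h₂
  · intro i j _ σ a b ha hb
    obtain rfl : a = 0 := by omega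
    obtain rfl : b = 0 := by omega
    exact Prog.op_run_dst _ _
  · rintro i j x y m P Q hx hxy _ hm _ hPe hQe hP hQ hf σ a b ha hb
    rw [Prog.run]
    by_cases hax : a < x
    · rw [Prog.run_of_not_writes, hP hf.row_left hax hb]
      rw [hQe, parFor_writes (by omega) hm]
      rintro ⟨c, hc, d, hd, e⟩
      rw [add_assoc] at e
      exact (hf a ha b hb (x + c) (by omega) d hd (by omega)).1 e
    · obtain ⟨a, rfl⟩ : ∃ a', a = x + a' := ⟨a - x, by omega⟩
      rw [← add_assoc, hQ hf.row_right (by omega) hb]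
      refine Instr.val_congr fun l hl => Prog.run_of_not_writes ?_
      rw [hPe, parFor_writes hx hm]
      rintro ⟨c, hc, d, hd, rfl⟩
      rw [add_assoc] at hl
      exact (hf c (by omega) d hd (x + a) ha b hb (by omega)).2 hl
  · rintro i j m x y P Q hx hxy _ hm _ hPe hQe hP hQ hf σ a b ha hb
    rw [Prog.run]
    by_cases hbx : b < x
    · rw [Prog.run_of_not_writes, hP hf.col_left ha hbx]
      rw [hQe, parFor_writes hm (by omega)]
      rintro ⟨c, hc, d, hd, e⟩
      rw [add_assoc j] at e
      exact (hf a ha b hb c hc (x + d) (by omega) (by omega)).1 e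
    · obtain ⟨b, rfl⟩ : ∃ b', b = x + b' := ⟨b - x, by omega⟩
      rw [← add_assoc j, hQ hf.col_right ha (by omega)]
      refine Instr.val_congr fun l hl => Prog.run_of_not_writes ?_
      rw [hPe, parFor_writes hm hx]
      rintro ⟨c, hc, d, hd, rfl⟩
      rw [add_assoc j] at hl
      exact (hf c hc d (by omega) a ha (x + b) hb (by omega)).2 hl

/-- Distinct entries of the upper left `n₁ × n₂` part have distinct locations. -/
def View.Inj (Z : View) (n₁ n₂ : ℕ) : Prop :=
  ∀ i < n₁, ∀ j < n₂, ∀ i' < n₁, ∀ j' < n₂, Z.at i j = Z.at i' j' → i = i' ∧ j = j'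

theorem View.inj_of_rows {Z : View} {n₁ n₂ : ℕ} (hc : Z.colStride = 1) (hr : n₂ ≤ Z.rowStride) :
    Z.Inj n₁ n₂ :=
  fun _ _ _ hj _ _ _ hj' h => View.at_inj hc hr hj hj' h

theorem View.inj_of_cols {Z : View} {n₁ n₂ : ℕ} (hr : Z.rowStride = 1) (hc : n₁ ≤ Z.colStride) :
    Z.Inj n₁ n₂ := by
  intro i hi j _ i' hi' j' _ h
  have := View.at_inj (Z := ⟨Z.frame, Z.offset, Z.colStride, Z.rowStride⟩) (i := j) (i' := j')
    hr hc hi hi' (by simp only [View.at, Loc.mk.injEq, true_and] at h ⊢; omega)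
  exact this.symm

theorem View.Inj.mono {Z : View} {n₁ n₂ m₁ m₂ : ℕ} (h : Z.Inj n₁ n₂) (h₁ : m₁ ≤ n₁)
    (h₂ : m₂ ≤ n₂) : Z.Inj m₁ m₂ :=
  fun i hi j hj i' hi' j' hj' => h i (by omega) j (by omega) i' (by omega) j' (by omega)

theorem View.Inj.sub {Z : View} {n₁ n₂ m₁ m₂ a b : ℕ} (h : Z.Inj n₁ n₂) (h₁ : a + m₁ ≤ n₁)
    (h₂ : b + m₂ ≤ n₂) : (Z.sub a b).Inj m₁ m₂ := by
  intro i hi j hj i' hi' j' hj' e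
  rw [View.sub_at, View.sub_at] at e
  have := h _ (by omega) _ (by omega) _ (by omega) _ (by omega) e
  omega

theorem addTemps_independent {fr : ℕ} {Z : View} {n₁ n₂ : ℕ} (hZ : Z.Inj n₁ n₂)
    (hZf : Z.frame < fr) : Independent (fun i j => .add (Z.at i j) (View.at ⟨fr, 0, n₂, 1⟩ i j)
      (View.at ⟨fr + 1, 0, n₂, 1⟩ i j)) 0 0 n₁ n₂ := by
  intro a ha b hb a' ha' b' hb' hne
  simp only [zero_add, Instr.dst, Instr.srcs]
  refine ⟨fun e => ?_, fun e => ?_⟩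
  · have := hZ a ha b hb a' ha' b' hb' e
    omega
  · simp only [View.at, List.mem_cons, Loc.mk.injEq, List.not_mem_nil, or_false] at e
    omega

theorem addTemps_run {fr : ℕ} {Z : View} {n₁ n₂ : ℕ} (hZ : Z.Inj n₁ n₂) (hZf : Z.frame < fr)
    {σ : Store} {i j : ℕ} (hi : i < n₁) (hj : j < n₂) :
    ((addTemps fr Z n₁ n₂).run σ).get (Z.at i j) =
      min (σ.get (View.at ⟨fr, 0, n₂, 1⟩ i j)) (σ.get (View.at ⟨fr + 1, 0, n₂, 1⟩ i j)) := by
  have := parFor_run (i := 0) (j := 0) (by omega) (by omega) (addTemps_independent hZ hZf) (σ := σ)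
    hi hj
  simp only [zero_add] at this
  exact this

theorem inf_range_add (g : ℕ → Val) (a b : ℕ) : (Finset.range (a + b)).inf g =
    min ((Finset.range a).inf g) ((Finset.range b).inf fun k => g (a + k)) := by
  induction b with
  | zero => simp
  | succ b ih =>
    rw [← add_assoc, Finset.range_add_one, Finset.inf_insert, ih, Finset.range_add_one,
      Finset.inf_insert]
    exact inf_left_comm _ _ _

/-- Splitting the third range splits the infimum. The factors lie in frames other than that of the
output, so the half that runs first leaves the inputs of the other intact; the second half cannot
spoil the results of the first, since it writes another part of `Z` or another temporary. -/
theorem grid_run {ω : ℝ} (hω : 1 ≤ ω) {fr : ℕ} {X Y Z : View} {n₁ n₂ n₃ : ℕ}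
    (h₁ : 0 < n₁) (h₂ : 0 < n₂) (h₃ : 0 < n₃) (hX : X.frame < fr) (hY : Y.frame < fr)
    (hZ : Z.frame < fr) (hXZ : X.frame ≠ Z.frame) (hYZ : Y.frame ≠ Z.frame) (hZi : Z.Inj n₁ n₂)
    {σ : Store} {i j : ℕ} (hi : i < n₁) (hj : j < n₂) :
    ((grid ω fr X Y Z n₁ n₂ n₃).run σ).get (Z.at i j) =
      (Finset.range n₃).inf fun k => σ.get (X.at i k) + σ.get (Y.at k j) := by
  revert hX hY hZ hXZ hYZ hZi σ i j
  refine grid_rec hω (motive := fun fr X Y Z n₁ n₂ n₃ P => X.frame < fr → Y.frame < fr →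
    Z.frame < fr → X.frame ≠ Z.frame → Y.frame ≠ Z.frame → Z.Inj n₁ n₂ →
    ∀ {σ : Store} {i j : ℕ}, i < n₁ → j < n₂ → (P.run σ).get (Z.at i j) =
      (Finset.range n₃).inf fun k => σ.get (X.at i k) + σ.get (Y.at k j))
    ?_ ?_ ?_ ?_ fr X Y Z n₁ n₂ n₃ h₁ h₂ h₃
  · intro fr X Y Z hX hY hZ hXZ hYZ hZi σ i j hi hj
    obtain rfl : i = 0 := by omega
    obtain rfl : j = 0 := by omega
    simp only [Finset.range_one, Finset.inf_singleton]
    exact Prog.op_run_dst (.mul (Z.at 0 0) (X.at 0 0) (Y.at 0 0)) σ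
  · intro fr X Y Z n₁ n₂ a b P Q h₁ h₂ ha hab hba _ hPe hQe hP hQ hX hY hZ hXZ hYZ hZi σ i j hi hj
    have hPw : ∀ l, l.frame ≠ fr → l.frame < fr + 2 → ¬ P.Writes l := by
      rintro l hl hl' hw
      rw [hPe] at hw
      rcases grid_writes hω h₁ h₂ ha hw with ⟨i, _, j, _, rfl⟩ | h
      · exact hl rfl
      · omega
    have hQw : ∀ l, l.frame ≠ fr + 1 → l.frame < fr + 2 → ¬ Q.Writes l := by
      rintro l hl hl' hw
      rw [hQe] at hw
      rcases grid_writes hω h₁ h₂ (by omega) hw with ⟨i, _, j, _, rfl⟩ | h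
      · exact hl rfl
      · omega
    simp only [Prog.run]
    rw [addTemps_run hZi hZ hi hj, Prog.run_of_not_writes (hQw _ (by simp) (by simp)),
      hP (by omega) (by omega) (by simp) (by simp; omega) (by simp; omega)
        (View.inj_of_rows rfl le_rfl) hi hj,
      hQ (by simp; omega) (by simp; omega) (by simp) (by simp; omega) (by simp; omega)
        (View.inj_of_rows rfl le_rfl) hi hj, inf_range_add]
    simp only [View.sub_at, zero_add]
    congr 2
    funext k
    rw [Prog.run_of_not_writes (hPw _ (by simp; omega) (by simp; omega)),
      Prog.run_of_not_writes (hPw _ (by simp; omega) (by simp; omega))]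
  · intro fr X Y Z a b n₂ n₃ P Q ha hab hba h₂ h₃ _ _ hPe hQe hP hQ hX hY hZ hXZ hYZ hZi σ i j hi hj
    simp only [Prog.run]
    by_cases hia : i < a
    · rw [Prog.run_of_not_writes, hP hX hY hZ hXZ hYZ (hZi.mono (by omega) le_rfl) hia hj]
      intro hw
      rw [hQe] at hw
      rcases grid_writes hω (by omega) h₂ h₃ hw with ⟨i', hi', j', hj', e⟩ | h
      · rw [View.sub_at, zero_add] at e
        have := hZi _ (by omega) _ hj _ (by omega) _ hj' e
        omega
      · simp at h; omega
    · obtain ⟨i, rfl⟩ : ∃ i', i = a + i' := ⟨i - a, by omega⟩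
      have := @hQ hX hY hZ hXZ hYZ (hZi.sub le_rfl (by omega)) (P.run σ) i j (by omega) hj
      simp only [View.sub_at, zero_add] at this
      rw [this]
      have hPw : ∀ l, l.frame ≠ Z.frame → l.frame < fr → ¬ P.Writes l := by
        rintro l hl hl' hw
        rw [hPe] at hw
        rcases grid_writes hω ha h₂ h₃ hw with ⟨i, _, j, _, rfl⟩ | h
        · exact hl rfl
        · omega
      congr 1
      funext k
      rw [Prog.run_of_not_writes (hPw _ hXZ hX), Prog.run_of_not_writes (hPw _ hYZ hY)]
  · intro fr X Y Z n₁ a b n₃ P Q h₁ ha hab hba h₃ _ _ hPe hQe hP hQ hX hY hZ hXZ hYZ hZi σ i j hi hj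
    simp only [Prog.run]
    by_cases hja : j < a
    · rw [Prog.run_of_not_writes, hP hX hY hZ hXZ hYZ (hZi.mono le_rfl (by omega)) hi hja]
      intro hw
      rw [hQe] at hw
      rcases grid_writes hω h₁ (by omega) h₃ hw with ⟨i', hi', j', hj', e⟩ | h
      · rw [View.sub_at, zero_add] at e
        have := hZi _ hi _ hj _ (by omega) _ (by omega) e
        omega
      · simp at h; omega
    · obtain ⟨j, rfl⟩ : ∃ j', j = a + j' := ⟨j - a, by omega⟩
      have := @hQ hX hY hZ hXZ hYZ (hZi.sub (by omega) le_rfl) (P.run σ) i j hi (by omega)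
      simp only [View.sub_at, zero_add] at this
      rw [this]
      have hPw : ∀ l, l.frame ≠ Z.frame → l.frame < fr → ¬ P.Writes l := by
        rintro l hl hl' hw
        rw [hPe] at hw
        rcases grid_writes hω h₁ ha h₃ hw with ⟨i, _, j, _, rfl⟩ | h
        · exact hl rfl
        · omega
      congr 1
      funext k
      rw [Prog.run_of_not_writes (hPw _ hXZ hX), Prog.run_of_not_writes (hPw _ hYZ hY)]

/-! ### Race freedom of parallel loops and grid computations -/

theorem Loc.Live.append {fs : List ℕ} {l : Loc} (h : l.Live fs) (m : ℕ) : l.Live (fs ++ [m]) := by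
  obtain ⟨k, hk, hl⟩ := h
  refine ⟨k, ?_, hl⟩
  rw [List.getElem?_append_left]
  · exact hk
  · by_contra hc
    rw [List.getElem?_eq_none (by omega)] at hk
    simp at hk

theorem Loc.Live.frame_lt {fs : List ℕ} {l : Loc} (h : l.Live fs) : l.frame < fs.length := by
  obtain ⟨k, hk, hl⟩ := h
  by_contra hc
  rw [List.getElem?_eq_none (by omega)] at hk
  simp at hk

theorem parFor_raceFree {f : ℕ → ℕ → Instr} {i j m₁ m₂ : ℕ} {fs : List ℕ}
    (h₁ : 0 < m₁) (h₂ : 0 < m₂) (hf : Independent f i j m₁ m₂)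
    (hl : ∀ a < m₁, ∀ b < m₂, (∀ l ∈ (f (i + a) (j + b)).srcs, l.Live fs) ∧
      (f (i + a) (j + b)).dst.Live fs) :
    (parFor f i j m₁ m₂).RaceFree fs := by
  revert hf hl
  refine parFor_rec (motive := fun i j m₁ m₂ P => Independent f i j m₁ m₂ →
    (∀ a < m₁, ∀ b < m₂, (∀ l ∈ (f (i + a) (j + b)).srcs, l.Live fs) ∧
      (f (i + a) (j + b)).dst.Live fs) → P.RaceFree fs) ?_ ?_ ?_ i j m₁ m₂ h₁ h₂
  · intro i j _ h
    exact h 0 one_pos 0 one_pos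
  · rintro i j x y m P Q hx hxy _ hm _ hPe hQe hP hQ hf hl
    refine ⟨hP hf.row_left fun a ha b hb => hl a (by omega) b hb,
      hQ hf.row_right fun a ha b hb => ?_, fun l _ => ⟨?_, ?_⟩⟩
    · simpa only [add_assoc] using hl (x + a) (by omega) b hb
    · rw [hPe, hQe, parFor_writes hx hm, parFor_touches (by omega) hm]
      rintro ⟨⟨a, ha, b, hb, rfl⟩, c, hc, d, hd, h⟩
      have := hf a (by omega) b hb (x + c) (by omega) d hd (by omega)
      rw [← add_assoc] at this
      tauto
    · rw [hPe, hQe, parFor_touches hx hm, parFor_writes (by omega) hm]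
      rintro ⟨⟨a, ha, b, hb, h⟩, c, hc, d, hd, rfl⟩
      have := hf (x + c) (by omega) d hd a (by omega) b hb (by omega)
      rw [← add_assoc] at this
      tauto
  · rintro i j m x y P Q hx hxy _ hm _ hPe hQe hP hQ hf hl
    refine ⟨hP hf.col_left fun a ha b hb => hl a ha b (by omega),
      hQ hf.col_right fun a ha b hb => ?_, fun l _ => ⟨?_, ?_⟩⟩
    · simpa only [add_assoc] using hl a ha (x + b) (by omega)
    · rw [hPe, hQe, parFor_writes hm hx, parFor_touches hm (by omega)]
      rintro ⟨⟨a, ha, b, hb, rfl⟩, c, hc, d, hd, h⟩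
      have := hf a ha b (by omega) c hc (x + d) (by omega) (by omega)
      rw [← add_assoc] at this
      tauto
    · rw [hPe, hQe, parFor_touches hm hx, parFor_writes hm (by omega)]
      rintro ⟨⟨a, ha, b, hb, h⟩, c, hc, d, hd, rfl⟩
      have := hf c hc (x + d) (by omega) a ha b (by omega) (by omega)
      rw [← add_assoc] at this
      tauto

/-- The upper left `n₁ × n₂` part is live. -/
def View.LiveIn (X : View) (fs : List ℕ) (n₁ n₂ : ℕ) : Prop :=
  ∀ i < n₁, ∀ j < n₂, (X.at i j).Live fs

theorem View.LiveIn.append {X : View} {fs : List ℕ} {n₁ n₂ : ℕ} (h : X.LiveIn fs n₁ n₂) (m : ℕ) :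
    X.LiveIn (fs ++ [m]) n₁ n₂ := fun i hi j hj => (h i hi j hj).append m

theorem View.LiveIn.mono {X : View} {fs : List ℕ} {n₁ n₂ m₁ m₂ : ℕ} (h : X.LiveIn fs n₁ n₂)
    (h₁ : m₁ ≤ n₁) (h₂ : m₂ ≤ n₂) : X.LiveIn fs m₁ m₂ :=
  fun i hi j hj => h i (by omega) j (by omega)

theorem View.LiveIn.sub {X : View} {fs : List ℕ} {n₁ n₂ m₁ m₂ a b : ℕ} (h : X.LiveIn fs n₁ n₂)
    (h₁ : a + m₁ ≤ n₁) (h₂ : b + m₂ ≤ n₂) : (X.sub a b).LiveIn fs m₁ m₂ := by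
  intro i hi j hj
  rw [View.sub_at]
  exact h _ (by omega) _ (by omega)

theorem View.LiveIn.frame_lt {X : View} {fs : List ℕ} {n₁ n₂ : ℕ} (h : X.LiveIn fs n₁ n₂)
    (h₁ : 0 < n₁) (h₂ : 0 < n₂) : X.frame < fs.length :=
  (h 0 h₁ 0 h₂).frame_lt

theorem rowIndex_lt {i j n₁ n₂ : ℕ} (hi : i < n₁) (hj : j < n₂) : i * n₂ + j < n₁ * n₂ := by
  have := Nat.mul_le_mul_right n₂ (show i + 1 ≤ n₁ from hi)
  rw [add_mul] at this
  omega

theorem liveIn_rows {fs : List ℕ} {f n₁ n₂ : ℕ} (h : fs[f]? = some (n₁ * n₂)) :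
    View.LiveIn ⟨f, 0, n₂, 1⟩ fs n₁ n₂ := by
  intro i hi j hj
  refine ⟨_, h, ?_⟩
  simpa [View.at] using rowIndex_lt hi hj

theorem liveIn_cols {fs : List ℕ} {f n₁ n₂ : ℕ} (h : fs[f]? = some (n₁ * n₂)) :
    View.LiveIn ⟨f, 0, 1, n₁⟩ fs n₁ n₂ := by
  intro i hi j hj
  refine ⟨_, h, ?_⟩
  have := rowIndex_lt hj hi
  simp only [View.at]
  rw [mul_comm n₁]
  omega

theorem addTemps_raceFree {Z : View} {n₁ n₂ : ℕ} {fs : List ℕ} (h₁ : 0 < n₁) (h₂ : 0 < n₂)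
    (hZ : Z.Inj n₁ n₂) (hZl : Z.LiveIn fs n₁ n₂) :
    (addTemps fs.length Z n₁ n₂).RaceFree (fs ++ [n₁ * n₂] ++ [n₁ * n₂]) := by
  refine parFor_raceFree h₁ h₂ (addTemps_independent hZ (hZl.frame_lt h₁ h₂)) fun a ha b hb => ?_
  simp only [zero_add, Instr.srcs, Instr.dst, List.mem_cons, List.not_mem_nil, or_false,
    forall_eq_or_imp, forall_eq]
  exact ⟨⟨liveIn_rows (by simp) a ha b hb,
    liveIn_rows (by simp) a ha b hb⟩, ((hZl.append _).append _) a ha b hb⟩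

/-- Halves of an output range write different entries of `Z` by injectivity; halves of the third
range write the different frames `fr` and `fr + 1`. Everything else that is shared is a factor,
which neither half writes. -/
theorem grid_raceFree {ω : ℝ} (hω : 1 ≤ ω) {X Y Z : View} {n₁ n₂ n₃ : ℕ} {fs : List ℕ}
    (h₁ : 0 < n₁) (h₂ : 0 < n₂) (h₃ : 0 < n₃) (hX : X.LiveIn fs n₁ n₃) (hY : Y.LiveIn fs n₃ n₂)
    (hZ : Z.LiveIn fs n₁ n₂) (hXZ : X.frame ≠ Z.frame) (hYZ : Y.frame ≠ Z.frame)
    (hZi : Z.Inj n₁ n₂) : (grid ω fs.length X Y Z n₁ n₂ n₃).RaceFree fs := by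
  -- The frame number becomes a variable, so that it can grow with the stack in the induction.
  suffices ∀ fr, fr = fs.length → (grid ω fr X Y Z n₁ n₂ n₃).RaceFree fs from this _ rfl
  intro fr
  revert hX hY hZ hXZ hYZ hZi
  revert fs
  refine grid_rec hω (motive := fun fr X Y Z n₁ n₂ n₃ P => ∀ {fs : List ℕ}, X.LiveIn fs n₁ n₃ →
    Y.LiveIn fs n₃ n₂ → Z.LiveIn fs n₁ n₂ → X.frame ≠ Z.frame → Y.frame ≠ Z.frame → Z.Inj n₁ n₂ →
    fr = fs.length → P.RaceFree fs) ?_ ?_ ?_ ?_ fr X Y Z n₁ n₂ n₃ h₁ h₂ h₃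
  · intro fr X Y Z fs hX hY hZ _ _ _ _
    simp only [Prog.RaceFree, Instr.srcs, Instr.dst, List.mem_cons, List.not_mem_nil, or_false,
      forall_eq_or_imp, forall_eq]
    exact ⟨⟨hX 0 one_pos 0 one_pos, hY 0 one_pos 0 one_pos⟩, hZ 0 one_pos 0 one_pos⟩
  · rintro fr X Y Z n₁ n₂ a b P Q h₁ h₂ ha hab hba _ hPe hQe hP hQ fs hX hY hZ hXZ hYZ hZi rfl
    have hXf := hX.frame_lt h₁ (by omega)
    have hYf := hY.frame_lt (by omega) h₂
    have hZf := hZ.frame_lt h₁ h₂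
    have hX' := (hX.append (n₁ * n₂)).append (n₁ * n₂)
    have hY' := (hY.append (n₁ * n₂)).append (n₁ * n₂)
    refine ⟨⟨hP (hX'.mono le_rfl (by omega)) (hY'.mono (by omega) le_rfl) (liveIn_rows (by simp))
        (by simp; omega) (by simp; omega) (View.inj_of_rows rfl le_rfl) (by simp),
      hQ (hX'.sub (by omega) le_rfl) (hY'.sub le_rfl (by omega))
        (liveIn_rows (by simp)) (by simp; omega) (by simp; omega)
        (View.inj_of_rows rfl le_rfl) (by simp), ?_⟩, addTemps_raceFree h₁ h₂ hZi hZ⟩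
    intro l hl
    simp only [List.length_append, List.length_cons, List.length_nil] at hl
    rw [hPe, hQe]
    constructor
    · rintro ⟨hw, ht⟩
      rcases grid_writes hω h₁ h₂ ha hw with ⟨i, _, j, _, rfl⟩ | h
      · rcases grid_touches hω h₁ h₂ (by omega) ht with
          ⟨_, _, _, _, e⟩ | ⟨_, _, _, _, e⟩ | ⟨_, _, _, _, e⟩ | h <;>
        [skip; skip; skip; (simp at h)] <;>
        · have := congrArg Loc.frame e
          simp at this
          try omega
      · omega
    · rintro ⟨ht, hw⟩
      rcases grid_writes hω h₁ h₂ (by omega) hw with ⟨i, _, j, _, rfl⟩ | h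
      · rcases grid_touches hω h₁ h₂ ha ht with
          ⟨_, _, _, _, e⟩ | ⟨_, _, _, _, e⟩ | ⟨_, _, _, _, e⟩ | h <;>
        [skip; skip; skip; (simp at h)] <;>
        · have := congrArg Loc.frame e
          simp at this
          try omega
      · omega
  · rintro fr X Y Z a b n₂ n₃ P Q ha hab hba h₂ h₃ _ _ hPe hQe hP hQ fs hX hY hZ hXZ hYZ hZi rfl
    refine ⟨hP (hX.mono (by omega) le_rfl) hY (hZ.mono (by omega) le_rfl) hXZ hYZ
        (hZi.mono (by omega) le_rfl) rfl,
      hQ (hX.sub le_rfl (by omega)) hY (hZ.sub le_rfl (by omega)) hXZ hYZ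
        (hZi.sub le_rfl (by omega)) rfl, fun l hl => ?_⟩
    rw [hPe, hQe]
    constructor
    · rintro ⟨hw, ht⟩
      rcases grid_writes hω ha h₂ h₃ hw with ⟨i, hi, j, hj, rfl⟩ | h
      · rcases grid_touches hω (by omega) h₂ h₃ ht with
          ⟨_, _, _, _, e⟩ | ⟨_, _, _, _, e⟩ | ⟨i', hi', j', hj', e⟩ | h
        · exact hXZ (congrArg Loc.frame e).symm
        · exact hYZ (congrArg Loc.frame e).symm
        · rw [View.sub_at, zero_add] at e
          have := hZi _ (by omega) _ hj _ (by omega) _ hj' e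
          omega
        · omega
      · omega
    · rintro ⟨ht, hw⟩
      rcases grid_writes hω (by omega) h₂ h₃ hw with ⟨i, hi, j, hj, rfl⟩ | h
      · rcases grid_touches hω ha h₂ h₃ ht with
          ⟨_, _, _, _, e⟩ | ⟨_, _, _, _, e⟩ | ⟨i', hi', j', hj', e⟩ | h
        · exact hXZ (congrArg Loc.frame e).symm
        · exact hYZ (congrArg Loc.frame e).symm
        · rw [View.sub_at, zero_add] at e
          have := hZi _ (by omega) _ hj _ (by omega) _ hj' e
          omega
        · omega
      · omega
  · rintro fr X Y Z n₁ a b n₃ P Q h₁ ha hab hba h₃ _ _ hPe hQe hP hQ fs hX hY hZ hXZ hYZ hZi rfl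
    refine ⟨hP hX (hY.mono le_rfl (by omega)) (hZ.mono le_rfl (by omega)) hXZ hYZ
        (hZi.mono le_rfl (by omega)) rfl,
      hQ hX (hY.sub (by omega) le_rfl) (hZ.sub (by omega) le_rfl) hXZ hYZ
        (hZi.sub (by omega) le_rfl) rfl, fun l hl => ?_⟩
    rw [hPe, hQe]
    constructor
    · rintro ⟨hw, ht⟩
      rcases grid_writes hω h₁ ha h₃ hw with ⟨i, hi, j, hj, rfl⟩ | h
      · rcases grid_touches hω h₁ (by omega) h₃ ht with
          ⟨_, _, _, _, e⟩ | ⟨_, _, _, _, e⟩ | ⟨i', hi', j', hj', e⟩ | h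
        · exact hXZ (congrArg Loc.frame e).symm
        · exact hYZ (congrArg Loc.frame e).symm
        · rw [View.sub_at, zero_add] at e
          have := hZi _ hi _ (by omega) _ hi' _ (by omega) e
          omega
        · omega
      · omega
    · rintro ⟨ht, hw⟩
      rcases grid_writes hω h₁ (by omega) h₃ hw with ⟨i, hi, j, hj, rfl⟩ | h
      · rcases grid_touches hω h₁ ha h₃ ht with
          ⟨_, _, _, _, e⟩ | ⟨_, _, _, _, e⟩ | ⟨i', hi', j', hj', e⟩ | h
        · exact hXZ (congrArg Loc.frame e).symm
        · exact hYZ (congrArg Loc.frame e).symm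
        · rw [View.sub_at, zero_add] at e
          have := hZi _ hi _ (by omega) _ hi' _ (by omega) e
          omega
        · omega
      · omega

/-! ### Multiply-add -/

/-- The copying of the right factor in `mulAdd`. -/
def copyCols (fr : ℕ) (Y : View) (m₃ m₂ : ℕ) : Prog :=
  parFor (fun k j => .copy (View.at ⟨fr, 0, 1, m₃⟩ k j) (Y.at k j)) 0 0 m₃ m₂

/-- The addition of the product to the target in `mulAdd`. -/
def addTo (fr : ℕ) (Z : View) (m₁ m₂ : ℕ) : Prog :=
  parFor (fun i j => .add (Z.at i j) (Z.at i j) (View.at ⟨fr, 0, m₂, 1⟩ i j)) 0 0 m₁ m₂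

theorem mulAdd_eq (ω : ℝ) (fr : ℕ) (Z X Y : View) (m₁ m₂ m₃ : ℕ) :
    mulAdd ω fr Z X Y m₁ m₂ m₃ = .alloc (m₃ * m₂) (.alloc (m₁ * m₂) (.seq (copyCols fr Y m₃ m₂)
      (.seq (grid ω (fr + 2) X ⟨fr, 0, 1, m₃⟩ ⟨fr + 1, 0, m₂, 1⟩ m₁ m₂ m₃)
        (addTo (fr + 1) Z m₁ m₂)))) := rfl

theorem copyCols_writes {fr : ℕ} {Y : View} {m₂ m₃ : ℕ} {l : Loc} (h₂ : 0 < m₂) (h₃ : 0 < m₃)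
    (h : (copyCols fr Y m₃ m₂).Writes l) : l.frame = fr := by
  rw [copyCols, parFor_writes h₃ h₂] at h
  obtain ⟨a, _, b, _, rfl⟩ := h
  rfl

theorem copyCols_touches {fr : ℕ} {Y : View} {m₂ m₃ : ℕ} {l : Loc} (h₂ : 0 < m₂) (h₃ : 0 < m₃)
    (h : (copyCols fr Y m₃ m₂).Touches l) : (∃ k < m₃, ∃ j < m₂, l = Y.at k j) ∨ l.frame = fr := by
  rw [copyCols, parFor_touches h₃ h₂] at h
  simp only [Instr.dst, Instr.srcs, List.mem_cons, List.not_mem_nil, or_false, zero_add] at h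
  obtain ⟨a, ha, b, hb, rfl | rfl⟩ := h
  · exact .inl ⟨a, ha, b, hb, rfl⟩
  · exact .inr rfl

theorem addTo_writes {fr : ℕ} {Z : View} {m₁ m₂ : ℕ} {l : Loc} (h₁ : 0 < m₁) (h₂ : 0 < m₂) :
    (addTo fr Z m₁ m₂).Writes l ↔ ∃ i < m₁, ∃ j < m₂, l = Z.at i j := by
  simp [addTo, parFor_writes h₁ h₂, Instr.dst]

theorem addTo_touches {fr : ℕ} {Z : View} {m₁ m₂ : ℕ} {l : Loc} (h₁ : 0 < m₁) (h₂ : 0 < m₂)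
    (h : (addTo fr Z m₁ m₂).Touches l) : (∃ i < m₁, ∃ j < m₂, l = Z.at i j) ∨ l.frame = fr := by
  rw [addTo, parFor_touches h₁ h₂] at h
  simp only [Instr.dst, Instr.srcs, List.mem_cons, List.not_mem_nil, or_false, zero_add] at h
  obtain ⟨a, ha, b, hb, (rfl | rfl) | rfl⟩ := h
  · exact .inl ⟨a, ha, b, hb, rfl⟩
  · exact .inr rfl
  · exact .inl ⟨a, ha, b, hb, rfl⟩

theorem mulAdd_writes_output {ω : ℝ} {fr : ℕ} {Z X Y : View} {m₁ m₂ m₃ : ℕ}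
    {i j : ℕ} (hi : i < m₁) (hj : j < m₂) : (mulAdd ω fr Z X Y m₁ m₂ m₃).Writes (Z.at i j) :=
  .inr (.inr ((addTo_writes (by omega) (by omega)).2 ⟨i, hi, j, hj, rfl⟩))

theorem mulAdd_writes {ω : ℝ} (hω : 1 ≤ ω) {fr : ℕ} {Z X Y : View} {m₁ m₂ m₃ : ℕ}
    (h₁ : 0 < m₁) (h₂ : 0 < m₂) (h₃ : 0 < m₃) {l : Loc}
    (h : (mulAdd ω fr Z X Y m₁ m₂ m₃).Writes l) :
    (∃ i < m₁, ∃ j < m₂, l = Z.at i j) ∨ fr ≤ l.frame := by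
  rcases h with h | h | h
  · exact .inr (copyCols_writes h₂ h₃ h).ge
  · rcases grid_writes hω h₁ h₂ h₃ h with ⟨i, _, j, _, rfl⟩ | h
    · exact .inr (by simp)
    · exact .inr (by omega)
  · exact .inl ((addTo_writes h₁ h₂).1 h)

theorem mulAdd_touches {ω : ℝ} (hω : 1 ≤ ω) {fr : ℕ} {Z X Y : View} {m₁ m₂ m₃ : ℕ}
    (h₁ : 0 < m₁) (h₂ : 0 < m₂) (h₃ : 0 < m₃) {l : Loc}
    (h : (mulAdd ω fr Z X Y m₁ m₂ m₃).Touches l) :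
    (∃ i < m₁, ∃ k < m₃, l = X.at i k) ∨ (∃ k < m₃, ∃ j < m₂, l = Y.at k j) ∨
      (∃ i < m₁, ∃ j < m₂, l = Z.at i j) ∨ fr ≤ l.frame := by
  rcases h with h | h | h
  · rcases copyCols_touches h₂ h₃ h with h | h
    · exact .inr (.inl h)
    · exact .inr (.inr (.inr h.ge))
  · rcases grid_touches hω h₁ h₂ h₃ h with h | ⟨_, _, _, _, rfl⟩ | ⟨_, _, _, _, rfl⟩ | h
    · exact .inl h
    · exact .inr (.inr (.inr (by simp)))
    · exact .inr (.inr (.inr (by simp)))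
    · exact .inr (.inr (.inr (by omega)))
  · rcases addTo_touches h₁ h₂ h with h | h
    · exact .inr (.inr (.inl h))
    · exact .inr (.inr (.inr (by omega)))

theorem copyCols_independent {fr : ℕ} {Y : View} {m₂ m₃ : ℕ} (hY : Y.frame ≠ fr) :
    Independent (fun k j => .copy (View.at ⟨fr, 0, 1, m₃⟩ k j) (Y.at k j)) 0 0 m₃ m₂ := by
  intro a ha b hb a' ha' b' hb' hne
  simp only [zero_add, Instr.dst, Instr.srcs, List.mem_cons, List.not_mem_nil, or_false]
  refine ⟨fun e => ?_, fun e => hY (congrArg Loc.frame e).symm⟩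
  have := View.inj_of_cols (Z := ⟨fr, 0, 1, m₃⟩) rfl le_rfl a ha b hb a' ha' b' hb' e
  omega

theorem addTo_independent {fr : ℕ} {Z : View} {m₁ m₂ : ℕ} (hZ : Z.Inj m₁ m₂)
    (hZf : Z.frame ≠ fr) : Independent (fun i j => .add (Z.at i j) (Z.at i j)
      (View.at ⟨fr, 0, m₂, 1⟩ i j)) 0 0 m₁ m₂ := by
  intro a ha b hb a' ha' b' hb' hne
  simp only [zero_add, Instr.dst, Instr.srcs, List.mem_cons, List.not_mem_nil, or_false, not_or]
  have h : Z.at a b ≠ Z.at a' b' := fun e => by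
    have := hZ a ha b hb a' ha' b' hb' e
    omega
  exact ⟨h, h, fun e => hZf (congrArg Loc.frame e)⟩

/-- Aliasing of `Z` with a factor is harmless: before the final loop only the two fresh arrays and
those above them are written, so both factors are read with their original values. -/
theorem mulAdd_run {ω : ℝ} (hω : 1 ≤ ω) {fr : ℕ} {Z X Y : View} {m₁ m₂ m₃ : ℕ}
    (h₃ : 0 < m₃) (hX : X.frame < fr) (hY : Y.frame < fr)
    (hZ : Z.frame < fr) (hZi : Z.Inj m₁ m₂) {σ : Store} {i j : ℕ} (hi : i < m₁) (hj : j < m₂) :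
    ((mulAdd ω fr Z X Y m₁ m₂ m₃).run σ).get (Z.at i j) = min (σ.get (Z.at i j))
      ((Finset.range m₃).inf fun k => σ.get (X.at i k) + σ.get (Y.at k j)) := by
  have h₁ : 0 < m₁ := by omega
  have h₂ : 0 < m₂ := by omega
  have hc : ∀ l : Loc, l.frame < fr → ¬ (copyCols fr Y m₃ m₂).Writes l := fun l hl hw => by
    have := copyCols_writes h₂ h₃ hw
    omega
  have hg : ∀ l : Loc, l.frame < fr →
      ¬ (grid ω (fr + 2) X ⟨fr, 0, 1, m₃⟩ ⟨fr + 1, 0, m₂, 1⟩ m₁ m₂ m₃).Writes l := fun l hl hw => by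
    rcases grid_writes hω h₁ h₂ h₃ hw with ⟨i, _, j, _, rfl⟩ | h
    · simp at hl
    · omega
  rw [mulAdd_eq]
  simp only [Prog.run]
  have ha := fun τ => parFor_run (i := 0) (j := 0) h₁ h₂
    (addTo_independent (fr := fr + 1) hZi (by omega)) (σ := τ) hi hj
  simp only [zero_add] at ha
  refine (ha _).trans ?_
  change min (Store.get _ (Z.at i j)) (Store.get _ (View.at ⟨fr + 1, 0, m₂, 1⟩ i j)) = _
  rw [Prog.run_of_not_writes (hg _ hZ), Prog.run_of_not_writes (hc _ hZ),
    grid_run hω h₁ h₂ h₃ (by omega) (by simp) (by simp) (by simp; omega) (by simp)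
      (View.inj_of_rows rfl le_rfl) hi hj]
  congr 1
  refine Finset.inf_congr rfl fun k hk => ?_
  have hk : k < m₃ := by simpa using hk
  rw [Prog.run_of_not_writes (hc _ hX)]
  congr 1
  have := parFor_run (i := 0) (j := 0) h₃ h₂
    (copyCols_independent (fr := fr) (m₂ := m₂) (m₃ := m₃) hY.ne) (σ := σ) hk hj
  simp only [zero_add] at this
  exact this

theorem mulAdd_raceFree {ω : ℝ} (hω : 1 ≤ ω) {Z X Y : View} {m₁ m₂ m₃ : ℕ} {fs : List ℕ}
    (h₁ : 0 < m₁) (h₂ : 0 < m₂) (h₃ : 0 < m₃) (hX : X.LiveIn fs m₁ m₃) (hY : Y.LiveIn fs m₃ m₂)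
    (hZ : Z.LiveIn fs m₁ m₂) (hZi : Z.Inj m₁ m₂) :
    (mulAdd ω fs.length Z X Y m₁ m₂ m₃).RaceFree fs := by
  have hXf := hX.frame_lt h₁ h₃
  have hYf := hY.frame_lt h₃ h₂
  have hZf := hZ.frame_lt h₁ h₂
  have hX' := (hX.append (m₃ * m₂)).append (m₁ * m₂)
  have hY' := (hY.append (m₃ * m₂)).append (m₁ * m₂)
  have hZ' := (hZ.append (m₃ * m₂)).append (m₁ * m₂)
  have hcol : View.LiveIn ⟨fs.length, 0, 1, m₃⟩ (fs ++ [m₃ * m₂] ++ [m₁ * m₂]) m₃ m₂ :=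
    liveIn_cols (by simp)
  have hrow : View.LiveIn ⟨fs.length + 1, 0, m₂, 1⟩ (fs ++ [m₃ * m₂] ++ [m₁ * m₂]) m₁ m₂ :=
    liveIn_rows (by simp)
  rw [mulAdd_eq]
  refine ⟨parFor_raceFree h₃ h₂ (copyCols_independent hYf.ne) fun a ha b hb => ?_, ?_,
    parFor_raceFree h₁ h₂ (addTo_independent hZi (by omega)) fun a ha b hb => ?_⟩
  · simp only [zero_add, Instr.srcs, Instr.dst, List.mem_cons, List.not_mem_nil, or_false, forall_eq]
    exact ⟨hY' a ha b hb, hcol a ha b hb⟩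
  · have := grid_raceFree hω h₁ h₂ h₃ hX' hcol hrow (by simp; omega) (by simp)
      (View.inj_of_rows rfl le_rfl)
    simpa using this
  · simp only [zero_add, Instr.srcs, Instr.dst, List.mem_cons, List.not_mem_nil, or_false, forall_eq,
      forall_eq_or_imp]
    exact ⟨⟨hZ' a ha b hb, hrow a ha b hb⟩, hZ' a ha b hb⟩

/-! ### Structure of Kleene's algorithm -/

theorem View.sub_zero (X : View) : X.sub 0 0 = X := by simp [View.sub]

/-- Kleene's algorithm on an array that is split into quadrants at `a`, given the recursive calls
`P` and `Q`. -/
noncomputable def kleeneStep (ω : ℝ) (A : View) (a b : ℕ) (P Q : Prog) : Prog :=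
  .seq P <|
  .seq (.par
    (mulAdd ω 1 (A.sub 0 a) (A.sub 0 0) (A.sub 0 a) a b a)
    (mulAdd ω 1 (A.sub a 0) (A.sub a 0) (A.sub 0 0) b a a)) <|
  .seq (mulAdd ω 1 (A.sub a a) (A.sub a 0) (A.sub 0 a) b b a) <|
  .seq Q <|
  .seq (.par
    (mulAdd ω 1 (A.sub 0 a) (A.sub 0 a) (A.sub a a) a b b)
    (mulAdd ω 1 (A.sub a 0) (A.sub a a) (A.sub a 0) b a b))
  (mulAdd ω 1 (A.sub 0 0) (A.sub 0 a) (A.sub a 0) a a b)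

theorem kleeneRec_rec {ω : ℝ} {motive : View → ℕ → Prog → Prop}
    (one : ∀ A, motive A 1 (.op (.star (A.at 0 0))))
    (step : ∀ A a b P Q, 0 < a → a ≤ b → b ≤ a + 1 → P = kleeneRec ω A a →
      Q = kleeneRec ω (A.sub a a) b → motive A a P → motive (A.sub a a) b Q →
      motive A (a + b) (kleeneStep ω A a b P Q))
    (A : View) (n : ℕ) (hn : 0 < n) : motive A n (kleeneRec ω A n) := by
  induction A, n using kleeneRec.induct with
  | case1 => omega
  | case2 A h =>
    rw [kleeneRec, if_neg h, if_pos rfl]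
    exact one A
  | case3 A n h h' ih₁ ih₂ =>
    rw [kleeneRec, if_neg h, if_neg h']
    have := step A (n / 2) (n - n / 2) _ _ (by omega) (by omega) (by omega) rfl rfl
      (ih₁ (by omega)) (ih₂ (by omega))
    rwa [show n / 2 + (n - n / 2) = n by omega, kleeneStep, View.sub_zero] at this

theorem kleeneRec_writes {ω : ℝ} (hω : 1 ≤ ω) {A : View} {n : ℕ} (hn : 0 < n) {l : Loc}
    (h : (kleeneRec ω A n).Writes l) : (∃ i < n, ∃ j < n, l = A.at i j) ∨ 1 ≤ l.frame := by
  revert h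
  refine kleeneRec_rec (motive := fun A n P => P.Writes l →
    (∃ i < n, ∃ j < n, l = A.at i j) ∨ 1 ≤ l.frame) ?_ ?_ A n hn
  · intro A h
    exact .inl ⟨0, one_pos, 0, one_pos, h⟩
  · intro A a b P Q ha hab hba _ _ hP hQ h
    have key : ∀ {p q m₁ m₂ m₃ X Y}, 0 < m₁ → 0 < m₂ → 0 < m₃ → p + m₁ ≤ a + b → q + m₂ ≤ a + b →
        (mulAdd ω 1 (A.sub p q) X Y m₁ m₂ m₃).Writes l →
          (∃ i < a + b, ∃ j < a + b, l = A.at i j) ∨ 1 ≤ l.frame := by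
      intro p q m₁ m₂ m₃ X Y h₁ h₂ h₃ hp hq h
      refine (mulAdd_writes hω h₁ h₂ h₃ h).imp_left fun ⟨i, hi, j, hj, e⟩ =>
        ⟨p + i, by omega, q + j, by omega, by rw [e, View.sub_at]⟩
    rcases h with h | (h | h) | h | h | (h | h) | h
    · exact (hP h).imp_left fun ⟨i, hi, j, hj, e⟩ => ⟨i, by omega, j, by omega, e⟩
    · exact key (by omega) (by omega) (by omega) (by omega) (by omega) h
    · exact key (by omega) (by omega) (by omega) (by omega) (by omega) h
    · exact key (by omega) (by omega) (by omega) (by omega) (by omega) h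
    · exact (hQ h).imp_left fun ⟨i, hi, j, hj, e⟩ =>
        ⟨a + i, by omega, a + j, by omega, by rw [e, View.sub_at]⟩
    · exact key (by omega) (by omega) (by omega) (by omega) (by omega) h
    · exact key (by omega) (by omega) (by omega) (by omega) (by omega) h
    · exact key (by omega) (by omega) (by omega) (by omega) (by omega) h

/-- Kleene's algorithm writes the whole array. -/
theorem kleeneRec_writes_output {ω : ℝ} {A : View} {n : ℕ} {i j : ℕ}
    (hi : i < n) (hj : j < n) : (kleeneRec ω A n).Writes (A.at i j) := by
  have hn : 0 < n := by omega
  revert i j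
  refine kleeneRec_rec (motive := fun A n P => ∀ {i j}, i < n → j < n →
    P.Writes (A.at i j)) ?_ ?_ A n hn
  · intro A i j hi hj
    obtain rfl : i = 0 := by omega
    obtain rfl : j = 0 := by omega
    rfl
  · intro A a b P Q ha hab hba _ _ hP hQ i j hi hj
    by_cases hi' : i < a <;> by_cases hj' : j < a
    · exact .inl (hP hi' hj')
    · have := mulAdd_writes_output (ω := ω) (fr := 1) (Z := A.sub 0 a) (X := A.sub 0 0)
        (Y := A.sub 0 a) (m₃ := a) hi' (show j - a < b by omega)
      rw [View.sub_at, zero_add, show a + (j - a) = j by omega] at this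
      exact .inr (.inl (.inl this))
    · have := mulAdd_writes_output (ω := ω) (fr := 1) (Z := A.sub a 0) (X := A.sub a 0)
        (Y := A.sub 0 0) (m₃ := a) (show i - a < b by omega) hj'
      rw [View.sub_at, zero_add, show a + (i - a) = i by omega] at this
      exact .inr (.inl (.inr this))
    · have := @hQ (i - a) (j - a) (by omega) (by omega)
      rw [View.sub_at, show a + (i - a) = i by omega, show a + (j - a) = j by omega] at this
      exact .inr (.inr (.inr (.inl this)))

theorem kleeneRec_raceFree {ω : ℝ} (hω : 1 ≤ ω) {A : View} {n m : ℕ} (hn : 0 < n)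
    (hA : A.LiveIn [m] n n) (hAi : A.Inj n n) : (kleeneRec ω A n).RaceFree [m] := by
  revert hA hAi
  refine kleeneRec_rec (motive := fun A n P => A.LiveIn [m] n n → A.Inj n n → P.RaceFree [m])
    ?_ ?_ A n hn
  · intro A hA _
    have := hA 0 one_pos 0 one_pos
    simp only [Prog.RaceFree, Instr.srcs, Instr.dst, List.mem_cons, List.not_mem_nil, or_false,
      forall_eq]
    exact ⟨this, this⟩
  · intro A a b P Q ha hab hba _ _ hP hQ hA hAi
    have hm : ∀ {p q p' q' p'' q'' m₁ m₂ m₃}, 0 < m₁ → 0 < m₂ → 0 < m₃ →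
        p + m₁ ≤ a + b → q + m₂ ≤ a + b → p' + m₁ ≤ a + b → q' + m₃ ≤ a + b →
        p'' + m₃ ≤ a + b → q'' + m₂ ≤ a + b →
        (mulAdd ω 1 (A.sub p q) (A.sub p' q') (A.sub p'' q'') m₁ m₂ m₃).RaceFree [m] :=
      fun h₁ h₂ h₃ h h' h'' h''' h4 h5 => mulAdd_raceFree (fs := [m]) hω h₁ h₂ h₃
        (hA.sub h'' h''') (hA.sub h4 h5) (hA.sub h h') (hAi.sub h h')
    -- The target rectangle of one task avoids the three rectangles of the other; each disjunction
    -- names the side on which two rectangles are separated.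
    have hd : ∀ {p q p' q' p'' q'' m₁ m₂ m₃ r s r' s' r'' s'' k₁ k₂ k₃} {l : Loc}, l.frame < 1 →
        0 < m₁ → 0 < m₂ → 0 < m₃ → 0 < k₁ → 0 < k₂ → 0 < k₃ →
        p + m₁ ≤ a + b → q + m₂ ≤ a + b → r + k₁ ≤ a + b → s + k₂ ≤ a + b →
        r' + k₁ ≤ a + b → s' + k₃ ≤ a + b → r'' + k₃ ≤ a + b → s'' + k₂ ≤ a + b →
        (p + m₁ ≤ r ∨ r + k₁ ≤ p ∨ q + m₂ ≤ s ∨ s + k₂ ≤ q) →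
        (p + m₁ ≤ r' ∨ r' + k₁ ≤ p ∨ q + m₂ ≤ s' ∨ s' + k₃ ≤ q) →
        (p + m₁ ≤ r'' ∨ r'' + k₃ ≤ p ∨ q + m₂ ≤ s'' ∨ s'' + k₂ ≤ q) →
        (mulAdd ω 1 (A.sub p q) (A.sub p' q') (A.sub p'' q'') m₁ m₂ m₃).Writes l →
        (mulAdd ω 1 (A.sub r s) (A.sub r' s') (A.sub r'' s'') k₁ k₂ k₃).Touches l → False := by
      intro p q p' q' p'' q'' m₁ m₂ m₃ r s r' s' r'' s'' k₁ k₂ k₃ l hl h₁ h₂ h₃ k₁ k₂ k₃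
        b1 b2 b3 b4 b5 b6 b7 b8 d1 d2 d3 hw ht
      rcases mulAdd_writes hω h₁ h₂ h₃ hw with ⟨i, hi, j, hj, rfl⟩ | hw
      · rcases mulAdd_touches hω k₁ k₂ k₃ ht with
          ⟨i', hi', j', hj', e⟩ | ⟨i', hi', j', hj', e⟩ | ⟨i', hi', j', hj', e⟩ | h
        · simp only [View.sub_at] at e
          have := hAi _ (by omega) _ (by omega) _ (by omega) _ (by omega) e
          omega
        · simp only [View.sub_at] at e
          have := hAi _ (by omega) _ (by omega) _ (by omega) _ (by omega) e
          omega
        · simp only [View.sub_at] at e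
          have := hAi _ (by omega) _ (by omega) _ (by omega) _ (by omega) e
          omega
        · omega
      · omega
    have hb : 0 < b := by omega
    refine ⟨hP (hA.mono (by omega) (by omega)) (hAi.mono (by omega) (by omega)),
      ⟨hm ?_ ?_ ?_ ?_ ?_ ?_ ?_ ?_ ?_, hm ?_ ?_ ?_ ?_ ?_ ?_ ?_ ?_ ?_,
        fun l hl => ⟨fun ⟨hw, ht⟩ => ?_, fun ⟨ht, hw⟩ => ?_⟩⟩,
      hm ?_ ?_ ?_ ?_ ?_ ?_ ?_ ?_ ?_, hQ (hA.sub le_rfl le_rfl) (hAi.sub le_rfl le_rfl),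
      ⟨hm ?_ ?_ ?_ ?_ ?_ ?_ ?_ ?_ ?_, hm ?_ ?_ ?_ ?_ ?_ ?_ ?_ ?_ ?_,
        fun l hl => ⟨fun ⟨hw, ht⟩ => ?_, fun ⟨ht, hw⟩ => ?_⟩⟩,
      hm ?_ ?_ ?_ ?_ ?_ ?_ ?_ ?_ ?_⟩
    all_goals first
      | omega
      | exact hd hl (by omega) (by omega) (by omega) (by omega) (by omega) (by omega) (by omega)
          (by omega) (by omega) (by omega) (by omega) (by omega) (by omega) (by omega) (by omega)
          (by omega) (by omega) hw ht

/-! ### Min-plus algebra of the block recursion -/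

/-- `R ← T ⊕ X Y`, over an inner range of length `m`, for rows satisfying `p` and columns
satisfying `q`. -/
structure IsMulAdd (R T X Y : ℕ → ℕ → Val) (m₁ m₂ m₃ : ℕ) : Prop where
  le_left : ∀ i < m₁, ∀ j < m₂, R i j ≤ T i j
  le_mul : ∀ i < m₁, ∀ j < m₂, ∀ k < m₃, R i j ≤ X i k + Y k j
  eq_or : ∀ i < m₁, ∀ j < m₂, R i j = T i j ∨ ∃ k < m₃, R i j = X i k + Y k j

theorem isMulAdd_of_eq {R T X Y : ℕ → ℕ → Val} {m₁ m₂ m₃ : ℕ} (h₃ : 0 < m₃)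
    (h : ∀ i < m₁, ∀ j < m₂, R i j = min (T i j) ((Finset.range m₃).inf fun k => X i k + Y k j)) :
    IsMulAdd R T X Y m₁ m₂ m₃ where
  le_left i hi j hj := by rw [h i hi j hj]; exact min_le_left _ _
  le_mul i hi j hj k hk := by
    rw [h i hi j hj]
    exact (min_le_right _ _).trans (Finset.inf_le (Finset.mem_range.2 hk))
  eq_or i hi j hj := by
    rw [h i hi j hj]
    obtain ⟨k, hk, e⟩ := Finset.exists_mem_eq_inf (Finset.range m₃) ⟨0, Finset.mem_range.2 h₃⟩
      fun k => X i k + Y k j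
    rcases min_choice (T i j) ((Finset.range m₃).inf fun k => X i k + Y k j) with h | h
    · exact .inl h
    · exact .inr ⟨k, Finset.mem_range.1 hk, h.trans e⟩

/-- The triangle inequality for all indices below `m`. -/
def Closed (C : ℕ → ℕ → Val) (m : ℕ) : Prop :=
  ∀ i < m, ∀ k < m, ∀ j < m, C i j ≤ C i k + C k j

/-- An entry of `R` comes from `T` or from `C T`. A further factor `C` on the left merges with the
one already there by the triangle inequality, so it gains nothing. -/
theorem IsMulAdd.absorb_left {C T R : ℕ → ℕ → Val} {m₁ m₂ : ℕ} (h : IsMulAdd R T C T m₁ m₂ m₁)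
    (hC : Closed C m₁) {i k j : ℕ} (hi : i < m₁) (hk : k < m₁) (hj : j < m₂) :
    R i j ≤ C i k + R k j := by
  rcases h.eq_or k hk j hj with e | ⟨l, hl, e⟩
  · rw [e]
    exact h.le_mul i hi j hj k hk
  · rw [e, ← add_assoc]
    exact (h.le_mul i hi j hj l hl).trans (by gcongr; exact hC i hi k hk l hl)

theorem IsMulAdd.absorb_right {C T R : ℕ → ℕ → Val} {m₁ m₂ : ℕ} (h : IsMulAdd R T T C m₁ m₂ m₂)
    (hC : Closed C m₂) {i k j : ℕ} (hi : i < m₁) (hk : k < m₂) (hj : j < m₂) :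
    R i j ≤ R i k + C k j := by
  rcases h.eq_or i hi k hk with e | ⟨l, hl, e⟩
  · rw [e]
    exact h.le_mul i hi j hj k hk
  · rw [e, add_assoc]
    exact (h.le_mul i hi j hj l hl).trans (by gcongr; exact hC l hl k hk j hj)

/-- The triangle inequality for the result of one step of Kleene's algorithm. -/
theorem closed_of_blocks {F C₀₀ T₀₁ T₁₀ T₁₁ B₀₁ B₁₀ B₁₁ : ℕ → ℕ → Val} {a b : ℕ}
    (h01 : IsMulAdd B₀₁ T₀₁ C₀₀ T₀₁ a b a) (h10 : IsMulAdd B₁₀ T₁₀ T₁₀ C₀₀ b a a)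
    (h11 : IsMulAdd B₁₁ T₁₁ B₁₀ B₀₁ b b a) (hC₀ : Closed C₀₀ a)
    (hC₁ : Closed (fun i j => F (a + i) (a + j)) b)
    (hle : ∀ i < b, ∀ j < b, F (a + i) (a + j) ≤ B₁₁ i j)
    (k01 : IsMulAdd (fun i j => F i (a + j)) B₀₁ B₀₁ (fun i j => F (a + i) (a + j)) a b b)
    (k10 : IsMulAdd (fun i j => F (a + i) j) B₁₀ (fun i j => F (a + i) (a + j)) B₁₀ b a b)
    (k00 : IsMulAdd F C₀₀ (fun i j => F i (a + j)) (fun i j => F (a + i) j) a a b) :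
    Closed F (a + b) := by
  -- The three digits in these names are the blocks of `i`, `k` and `j`, with 0 for indices below
  -- `a`.
  have t011 : ∀ i < a, ∀ k < b, ∀ j < b, F i (a + j) ≤ F i (a + k) + F (a + k) (a + j) :=
    fun i hi k hk j hj => k01.absorb_right hC₁ hi hk hj
  have t110 : ∀ i < b, ∀ k < b, ∀ j < a, F (a + i) j ≤ F (a + i) (a + k) + F (a + k) j :=
    fun i hi k hk j hj => k10.absorb_left hC₁ hi hk hj
  -- The upper left block of `F` is completed last, so the inequalities are first shown with `C₀₀`
  -- in its place.
  have c01 : ∀ i < a, ∀ k < a, ∀ j < b, F i (a + j) ≤ C₀₀ i k + F k (a + j) := by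
    intro i hi k hk j hj
    rcases k01.eq_or k hk j hj with e | ⟨l, hl, e⟩
    · rw [e]
      exact (k01.le_left i hi j hj).trans (h01.absorb_left hC₀ hi hk hj)
    · rw [e, ← add_assoc]
      exact (k01.le_mul i hi j hj l hl).trans (by gcongr; exact h01.absorb_left hC₀ hi hk hl)
  have c10 : ∀ i < b, ∀ k < a, ∀ j < a, F (a + i) j ≤ F (a + i) k + C₀₀ k j := by
    intro i hi k hk j hj
    rcases k10.eq_or i hi k hk with e | ⟨l, hl, e⟩
    · rw [e]
      exact (k10.le_left i hi j hj).trans (h10.absorb_right hC₀ hi hk hj)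
    · rw [e, add_assoc]
      exact (k10.le_mul i hi j hj l hl).trans (by gcongr; exact h10.absorb_right hC₀ hl hk hj)
  -- The central case. Entries of the off-diagonal blocks are those of `B₁₀`, `B₀₁`, possibly
  -- extended through the lower right block. The core `B₁₀ B₀₁` was added into that block before it
  -- was closed, and the extensions are absorbed by its closedness.
  have t101 : ∀ i < b, ∀ k < a, ∀ j < b, F (a + i) (a + j) ≤ F (a + i) k + F k (a + j) := by
    have aux : ∀ i < b, ∀ k < a, ∀ j < b, F (a + i) (a + j) ≤ B₁₀ i k + F k (a + j) := by
      intro i hi k hk j hj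
      have hB : ∀ l < b, F (a + i) (a + l) ≤ B₁₀ i k + B₀₁ k l := fun l hl =>
        (hle i hi l hl).trans (h11.le_mul i hi l hl k hk)
      rcases k01.eq_or k hk j hj with e | ⟨l, hl, e⟩
      · rw [e]
        exact hB j hj
      · rw [e, ← add_assoc]
        exact (hC₁ i hi l hl j hj).trans (by gcongr; exact hB l hl)
    intro i hi k hk j hj
    rcases k10.eq_or i hi k hk with e | ⟨l, hl, e⟩
    · rw [e]
      exact aux i hi k hk j hj
    · rw [e, add_assoc]
      exact (hC₁ i hi l hl j hj).trans (by gcongr; exact aux l hl k hk j hj)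
  -- An entry of the final upper left block is an old one or a detour through the second block; the
  -- detour reduces to the cases already shown.
  have t001 : ∀ i < a, ∀ k < a, ∀ j < b, F i (a + j) ≤ F i k + F k (a + j) := by
    intro i hi k hk j hj
    rcases k00.eq_or i hi k hk with e | ⟨l, hl, e⟩
    · rw [e]
      exact c01 i hi k hk j hj
    · rw [e, add_assoc]
      exact (t011 i hi l hl j hj).trans (by gcongr; exact t101 l hl k hk j hj)
  have t100 : ∀ i < b, ∀ k < a, ∀ j < a, F (a + i) j ≤ F (a + i) k + F k j := by
    intro i hi k hk j hj
    rcases k00.eq_or k hk j hj with e | ⟨l, hl, e⟩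
    · rw [e]
      exact c10 i hi k hk j hj
    · rw [e, ← add_assoc]
      exact (t110 i hi l hl j hj).trans (by gcongr; exact t101 i hi k hk l hl)
  have t010 : ∀ i < a, ∀ k < b, ∀ j < a, F i j ≤ F i (a + k) + F (a + k) j :=
    fun i hi k hk j hj => k00.le_mul i hi j hj k hk
  have t000 : ∀ i < a, ∀ k < a, ∀ j < a, F i j ≤ F i k + F k j := by
    intro i hi k hk j hj
    rcases k00.eq_or i hi k hk with e | ⟨l, hl, e⟩
    · rcases k00.eq_or k hk j hj with e' | ⟨l, hl, e'⟩
      · rw [e, e']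
        exact (k00.le_left i hi j hj).trans (hC₀ i hi k hk j hj)
      · rw [e, e', ← add_assoc]
        exact (t010 i hi l hl j hj).trans (by gcongr; exact c01 i hi k hk l hl)
    · rw [e, add_assoc]
      exact (t010 i hi l hl j hj).trans (by gcongr; exact t100 l hl k hk j hj)
  have split : ∀ i < a + b, i < a ∨ ∃ i' < b, i = a + i' := fun i hi =>
    or_iff_not_imp_left.2 fun h => ⟨i - a, by omega, by omega⟩
  intro i hi k hk j hj
  rcases split i hi with hi' | ⟨i, hi', rfl⟩ <;> rcases split k hk with hk' | ⟨k, hk', rfl⟩ <;>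
    rcases split j hj with hj' | ⟨j, hj', rfl⟩
  · exact t000 i hi' k hk' j hj'
  · exact t001 i hi' k hk' j hj'
  · exact t010 i hi' k hk' j hj'
  · exact t011 i hi' k hk' j hj'
  · exact t100 i hi' k hk' j hj'
  · exact t101 i hi' k hk' j hj'
  · exact t110 i hi' k hk' j hj'
  · exact hC₁ i hi' k hk' j hj'

/-! ### Correctness -/

/-- The effect of a multiply-add on blocks of an array `A`. -/
theorem mulAdd_blocks {ω : ℝ} (hω : 1 ≤ ω) {A : View} {n z z' x x' y y' m₁ m₂ m₃ : ℕ}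
    (h₁ : 0 < m₁) (h₂ : 0 < m₂) (h₃ : 0 < m₃) (hA : A.frame = 0) (hAi : A.Inj n n)
    (hz : z + m₁ ≤ n) (hz' : z' + m₂ ≤ n) (σ : Store) :
    IsMulAdd (fun i j => ((mulAdd ω 1 (A.sub z z') (A.sub x x') (A.sub y y') m₁ m₂ m₃).run σ).get
        (A.at (z + i) (z' + j)))
      (fun i j => σ.get (A.at (z + i) (z' + j))) (fun i j => σ.get (A.at (x + i) (x' + j)))
      (fun i j => σ.get (A.at (y + i) (y' + j))) m₁ m₂ m₃ ∧
    ∀ i < n, ∀ j < n, ¬ (z ≤ i ∧ i < z + m₁ ∧ z' ≤ j ∧ j < z' + m₂) →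
      ((mulAdd ω 1 (A.sub z z') (A.sub x x') (A.sub y y') m₁ m₂ m₃).run σ).get (A.at i j) =
        σ.get (A.at i j) := by
  refine ⟨isMulAdd_of_eq h₃ fun i hi j hj => ?_, fun i hi j hj hij => ?_⟩
  · have := mulAdd_run (X := A.sub x x') (Y := A.sub y y') hω (fr := 1) h₃ (by simp [hA])
      (by simp [hA]) (by simp [hA]) (hAi.sub hz hz') (σ := σ) hi hj
    simpa only [View.sub_at] using this
  · refine Prog.run_of_not_writes fun hw => ?_
    rcases mulAdd_writes hω h₁ h₂ h₃ hw with ⟨p, hp, q, hq, e⟩ | h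
    · rw [View.sub_at] at e
      have := hAi _ hi _ hj _ (by omega) _ (by omega) e
      omega
    · simp [hA] at h

theorem IsMulAdd.congr {R T X Y R' T' X' Y' : ℕ → ℕ → Val} {m₁ m₂ m₃ : ℕ}
    (h : IsMulAdd R T X Y m₁ m₂ m₃) (hR : ∀ i < m₁, ∀ j < m₂, R' i j = R i j)
    (hT : ∀ i < m₁, ∀ j < m₂, T' i j = T i j) (hX : ∀ i < m₁, ∀ k < m₃, X' i k = X i k)
    (hY : ∀ k < m₃, ∀ j < m₂, Y' k j = Y k j) : IsMulAdd R' T' X' Y' m₁ m₂ m₃ where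
  le_left i hi j hj := by
    rw [hR i hi j hj, hT i hi j hj]
    exact h.le_left i hi j hj
  le_mul i hi j hj k hk := by
    rw [hR i hi j hj, hX i hi k hk, hY k hk j hj]
    exact h.le_mul i hi j hj k hk
  eq_or i hi j hj := by
    rw [hR i hi j hj, hT i hi j hj]
    refine (h.eq_or i hi j hj).imp_right fun ⟨k, hk, e⟩ => ⟨k, hk, ?_⟩
    rw [e, hX i hi k hk, hY k hk j hj]

/-- A multiply-add on blocks decreases the entries, and keeps them in an additively closed family
of sets. -/
theorem IsMulAdd.mem_and_le {g g' : ℕ → ℕ → Val} {n z z' y m₁ m₂ m₃ : ℕ} {S : ℕ → ℕ → Set Val}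
    (h : IsMulAdd (fun i j => g' (z + i) (z' + j)) (fun i j => g (z + i) (z' + j))
      (fun i k => g (z + i) (y + k)) (fun k j => g (y + k) (z' + j)) m₁ m₂ m₃)
    (h' : ∀ i < n, ∀ j < n, ¬ (z ≤ i ∧ i < z + m₁ ∧ z' ≤ j ∧ j < z' + m₂) → g' i j = g i j)
    (hy : y + m₃ ≤ n) (hSa : ∀ i j k, ∀ x ∈ S i k, ∀ y ∈ S k j, x + y ∈ S i j)
    (hg : ∀ i < n, ∀ j < n, g i j ∈ S i j) :
    (∀ i < n, ∀ j < n, g' i j ∈ S i j) ∧ ∀ i < n, ∀ j < n, g' i j ≤ g i j := by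
  have key : ∀ i < n, ∀ j < n, g' i j ∈ S i j ∧ g' i j ≤ g i j := by
    intro i hi j hj
    by_cases hij : z ≤ i ∧ i < z + m₁ ∧ z' ≤ j ∧ j < z' + m₂
    · obtain ⟨i, rfl⟩ : ∃ i', i = z + i' := ⟨i - z, by omega⟩
      obtain ⟨j, rfl⟩ : ∃ j', j = z' + j' := ⟨j - z', by omega⟩
      have hi' : i < m₁ := by omega
      have hj' : j < m₂ := by omega
      refine ⟨?_, h.le_left i hi' j hj'⟩
      rcases h.eq_or i hi' j hj' with e | ⟨k, hk, e⟩
      · rw [e]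
        exact hg _ hi _ hj
      · rw [e]
        exact hSa _ _ (y + k) _ (hg _ hi _ (by omega)) _ (hg _ (by omega) _ hj)
    · rw [h' i hi j hj hij]
      exact ⟨hg i hi j hj, le_rfl⟩
  exact ⟨fun i hi j hj => (key i hi j hj).1, fun i hi j hj => (key i hi j hj).2⟩

/-- The family `S` stands for the sets of walk lengths: all that matters is that they contain 0 on
the diagonal, are closed under concatenation, and have no negative element on the diagonal. The
abstract form allows the recursive call on the lower right quadrant to use a shifted family. -/
theorem kleeneRec_correct {ω : ℝ} (hω : 1 ≤ ω) {A : View} {n : ℕ} (hn : 0 < n)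
    (hA : A.frame = 0) (hAi : A.Inj n n) {S : ℕ → ℕ → Set Val}
    (hS0 : ∀ i < n, 0 ∈ S i i) (hSn : ∀ i, ∀ x ∈ S i i, 0 ≤ x)
    (hSa : ∀ i j k, ∀ x ∈ S i k, ∀ y ∈ S k j, x + y ∈ S i j)
    {σ : Store} (hσ : ∀ i < n, ∀ j < n, σ.get (A.at i j) ∈ S i j) :
    (∀ i < n, ∀ j < n, ((kleeneRec ω A n).run σ).get (A.at i j) ∈ S i j) ∧
    (∀ i < n, ∀ j < n, ((kleeneRec ω A n).run σ).get (A.at i j) ≤ σ.get (A.at i j)) ∧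
    (∀ i < n, ((kleeneRec ω A n).run σ).get (A.at i i) ≤ 0) ∧
    Closed (fun i j => ((kleeneRec ω A n).run σ).get (A.at i j)) n := by
  revert hA hAi S σ
  refine kleeneRec_rec (motive := fun A n P => A.frame = 0 → A.Inj n n → ∀ {S : ℕ → ℕ → Set Val},
    (∀ i < n, 0 ∈ S i i) → (∀ i, ∀ x ∈ S i i, 0 ≤ x) →
    (∀ i j k, ∀ x ∈ S i k, ∀ y ∈ S k j, x + y ∈ S i j) →
    ∀ {σ : Store}, (∀ i < n, ∀ j < n, σ.get (A.at i j) ∈ S i j) →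
    (∀ i < n, ∀ j < n, (P.run σ).get (A.at i j) ∈ S i j) ∧
    (∀ i < n, ∀ j < n, (P.run σ).get (A.at i j) ≤ σ.get (A.at i j)) ∧
    (∀ i < n, (P.run σ).get (A.at i i) ≤ 0) ∧
    Closed (fun i j => (P.run σ).get (A.at i j)) n) ?_ ?_ A n hn
  · intro A hA hAi S hS0 hSn hSa σ hσ
    have h : ((Prog.op (.star (A.at 0 0))).run σ).get (A.at 0 0) = min (σ.get (A.at 0 0)) 0 :=
      Prog.op_run_dst (.star (A.at 0 0)) σ
    -- Without negative closed walks the closure of a single entry is exactly 0.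
    have h0 : 0 ≤ σ.get (A.at 0 0) := hSn 0 _ (hσ 0 one_pos 0 one_pos)
    rw [min_eq_right h0] at h
    refine ⟨fun i hi j hj => ?_, fun i hi j hj => ?_, fun i hi => ?_, fun i hi k hk j hj => ?_⟩
    · obtain rfl : i = 0 := by omega
      obtain rfl : j = 0 := by omega
      rw [h]
      exact hS0 0 one_pos
    · obtain rfl : i = 0 := by omega
      obtain rfl : j = 0 := by omega
      rwa [h]
    · obtain rfl : i = 0 := by omega
      rw [h]
    · obtain rfl : i = 0 := by omega
      obtain rfl : j = 0 := by omega
      obtain rfl : k = 0 := by omega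
      simp only [h, add_zero, le_refl]
  · intro A a b P Q ha hab hba hPe hQe hP hQ hA hAi S hS0 hSn hSa σ₀ hσ
    have hb : 0 < b := by omega
    have split : ∀ i < a + b, i < a ∨ ∃ i' < b, i = a + i' := fun i hi =>
      or_iff_not_imp_left.2 fun h => ⟨i - a, by omega, by omega⟩
    obtain ⟨p1, p2, p3, p4⟩ := hP hA (hAi.mono (by omega) (by omega)) (S := S)
      (fun i hi => hS0 i (by omega)) hSn hSa (σ := σ₀) fun i hi j hj => hσ i (by omega) j (by omega)
    have p5 : ∀ i < a + b, ∀ j < a + b, ¬ (i < a ∧ j < a) →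
        (P.run σ₀).get (A.at i j) = σ₀.get (A.at i j) := by
      intro i hi j hj hij
      refine Prog.run_of_not_writes fun hw => ?_
      rw [hPe] at hw
      rcases kleeneRec_writes hω ha hw with ⟨p, hp, q, hq, e⟩ | h
      · have := hAi _ hi _ hj _ (by omega) _ (by omega) e
        omega
      · simp [hA] at h
    simp only [kleeneStep, Prog.run]
    set σ₁ := P.run σ₀
    have s1 : ∀ i < a + b, ∀ j < a + b, σ₁.get (A.at i j) ∈ S i j := by
      intro i hi j hj
      by_cases hij : i < a ∧ j < a
      · exact p1 i hij.1 j hij.2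
      · rw [p5 i hi j hj hij]
        exact hσ i hi j hj
    have d1 : ∀ i < a + b, ∀ j < a + b, σ₁.get (A.at i j) ≤ σ₀.get (A.at i j) := by
      intro i hi j hj
      by_cases hij : i < a ∧ j < a
      · exact p2 i hij.1 j hij.2
      · rw [p5 i hi j hj hij]
    obtain ⟨m2, n2⟩ := mulAdd_blocks hω (x := 0) (x' := 0) (y := 0) (y' := a) ha hb ha hA hAi
      (show 0 + a ≤ a + b by omega) (show a + b ≤ a + b by omega) σ₁
    set σ₂ := (mulAdd ω 1 (A.sub 0 a) (A.sub 0 0) (A.sub 0 a) a b a).run σ₁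
    obtain ⟨s2, d2⟩ := m2.mem_and_le (g' := fun i j => σ₂.get (A.at i j)) n2 (by omega) hSa s1
    obtain ⟨m3, n3⟩ := mulAdd_blocks hω (x := a) (x' := 0) (y := 0) (y' := 0) hb ha ha hA hAi
      (show a + b ≤ a + b by omega) (show 0 + a ≤ a + b by omega) σ₂
    set σ₃ := (mulAdd ω 1 (A.sub a 0) (A.sub a 0) (A.sub 0 0) b a a).run σ₂
    obtain ⟨s3, d3⟩ := m3.mem_and_le (g' := fun i j => σ₃.get (A.at i j)) n3 (by omega) hSa s2
    obtain ⟨m4, n4⟩ := mulAdd_blocks hω (x := a) (x' := 0) (y := 0) (y' := a) hb hb ha hA hAi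
      (show a + b ≤ a + b by omega) (show a + b ≤ a + b by omega) σ₃
    set σ₄ := (mulAdd ω 1 (A.sub a a) (A.sub a 0) (A.sub 0 a) b b a).run σ₃
    obtain ⟨s4, d4⟩ := m4.mem_and_le (g' := fun i j => σ₄.get (A.at i j)) n4 (by omega) hSa s3
    have q5 : ∀ i < a + b, ∀ j < a + b, ¬ (a ≤ i ∧ a ≤ j) →
        (Q.run σ₄).get (A.at i j) = σ₄.get (A.at i j) := by
      intro i hi j hj hij
      refine Prog.run_of_not_writes fun hw => ?_
      rw [hQe] at hw
      rcases kleeneRec_writes hω hb hw with ⟨p, hp, q, hq, e⟩ | h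
      · rw [View.sub_at] at e
        have := hAi _ hi _ hj _ (by omega) _ (by omega) e
        omega
      · simp [hA] at h
    -- The second recursive call sees the family with both indices shifted by `a`.
    have hQ' := @hQ hA (hAi.sub (by omega) (by omega)) (fun i j => S (a + i) (a + j))
      (fun i hi => hS0 (a + i) (by omega)) (fun i => hSn (a + i))
      (fun i j k => hSa (a + i) (a + j) (a + k)) σ₄
    simp only [View.sub_at] at hQ'
    obtain ⟨q1, q2, q3, q4⟩ := hQ' fun i hi j hj => s4 (a + i) (by omega) (a + j) (by omega)
    set σ₅ := Q.run σ₄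
    have s5 : ∀ i < a + b, ∀ j < a + b, σ₅.get (A.at i j) ∈ S i j := by
      intro i hi j hj
      by_cases hij : a ≤ i ∧ a ≤ j
      · have := q1 (i - a) (by omega) (j - a) (by omega)
        rwa [show a + (i - a) = i by omega, show a + (j - a) = j by omega] at this
      · rw [q5 i hi j hj hij]
        exact s4 i hi j hj
    have d5 : ∀ i < a + b, ∀ j < a + b, σ₅.get (A.at i j) ≤ σ₄.get (A.at i j) := by
      intro i hi j hj
      by_cases hij : a ≤ i ∧ a ≤ j
      · have := q2 (i - a) (by omega) (j - a) (by omega)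
        rwa [show a + (i - a) = i by omega, show a + (j - a) = j by omega] at this
      · rw [q5 i hi j hj hij]
    obtain ⟨m6, n6⟩ := mulAdd_blocks hω (x := 0) (x' := a) (y := a) (y' := a) ha hb hb hA hAi
      (show 0 + a ≤ a + b by omega) (show a + b ≤ a + b by omega) σ₅
    set σ₆ := (mulAdd ω 1 (A.sub 0 a) (A.sub 0 a) (A.sub a a) a b b).run σ₅
    obtain ⟨s6, d6⟩ := m6.mem_and_le (g' := fun i j => σ₆.get (A.at i j)) n6 (by omega) hSa s5
    obtain ⟨m7, n7⟩ := mulAdd_blocks hω (x := a) (x' := a) (y := a) (y' := 0) hb ha hb hA hAi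
      (show a + b ≤ a + b by omega) (show 0 + a ≤ a + b by omega) σ₆
    set σ₇ := (mulAdd ω 1 (A.sub a 0) (A.sub a a) (A.sub a 0) b a b).run σ₆
    obtain ⟨s7, d7⟩ := m7.mem_and_le (g' := fun i j => σ₇.get (A.at i j)) n7 (by omega) hSa s6
    obtain ⟨m8, n8⟩ := mulAdd_blocks hω (x := 0) (x' := a) (y := a) (y' := 0) ha ha hb hA hAi
      (show 0 + a ≤ a + b by omega) (show 0 + a ≤ a + b by omega) σ₇
    set σ₈ := (mulAdd ω 1 (A.sub 0 0) (A.sub 0 a) (A.sub a 0) a a b).run σ₇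
    obtain ⟨s8, d8⟩ := m8.mem_and_le (g' := fun i j => σ₈.get (A.at i j)) n8 (by omega) hSa s7
    simp only [zero_add] at m2 m3 m4 m6 m7 m8 n2 n3 n4 n6 n7 n8
    simp only [zero_le, true_and] at n2 n3 n6 n7 n8
    -- Each quadrant keeps its contents between the operations that target it. With these equalities
    -- the multiply-adds, each recorded between two consecutive stores, are restated in terms of the
    -- blocks that `closed_of_blocks` expects.
    have e00 : ∀ i < a, ∀ j < a, σ₇.get (A.at i j) = σ₁.get (A.at i j) := fun i hi j hj => by
      rw [n7, n6, q5, n4, n3, n2] <;> omega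
    have e01 : ∀ i < a, ∀ j < b, σ₅.get (A.at i (a + j)) = σ₂.get (A.at i (a + j)) :=
      fun i hi j hj => by rw [q5, n4, n3] <;> omega
    have e01' : ∀ i < a, ∀ j < b, σ₇.get (A.at i (a + j)) = σ₆.get (A.at i (a + j)) :=
      fun i hi j hj => by rw [n7] <;> omega
    have e10 : ∀ i < b, ∀ j < a, σ₆.get (A.at (a + i) j) = σ₃.get (A.at (a + i) j) :=
      fun i hi j hj => by rw [n6, q5, n4] <;> omega
    have e11 : ∀ i < b, ∀ j < b, σ₇.get (A.at (a + i) (a + j)) = σ₅.get (A.at (a + i) (a + j)) :=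
      fun i hi j hj => by rw [n7, n6] <;> omega
    have e8 : ∀ i < a + b, ∀ j < a + b, ¬ (i < a ∧ j < a) →
        σ₈.get (A.at i j) = σ₇.get (A.at i j) := fun i hi j hj hij => by rw [n8] <;> omega
    refine ⟨s8, fun i hi j hj => ?_, fun i hi => ?_, ?_⟩
    · exact (d8 i hi j hj).trans <| (d7 i hi j hj).trans <| (d6 i hi j hj).trans <|
        (d5 i hi j hj).trans <| (d4 i hi j hj).trans <| (d3 i hi j hj).trans <|
        (d2 i hi j hj).trans (d1 i hi j hj)
    · rcases split i hi with hi' | ⟨i, hi', rfl⟩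
      · refine (d8 i hi i hi).trans ?_
        rw [e00 i hi' i hi']
        exact p3 i hi'
      · exact (d8 _ hi _ hi).trans <| (d7 _ hi _ hi).trans <| (d6 _ hi _ hi).trans (q3 i hi')
    · refine closed_of_blocks m2 (m3.congr (fun _ _ _ _ => rfl) (fun _ _ _ _ => rfl)
        (fun _ _ _ _ => rfl) (Y' := fun i j => σ₁.get (A.at i j)) fun i hi j hj => ?_)
        (m4.congr (fun _ _ _ _ => rfl) (fun _ _ _ _ => rfl) (fun _ _ _ _ => rfl)
        (Y' := fun i j => σ₂.get (A.at i (a + j))) fun i hi j hj => ?_) p4 ?_ ?_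
        (m6.congr (fun i hi j hj => ?_) (fun i hi j hj => ?_) (fun i hi j hj => ?_)
          (fun i hi j hj => ?_))
        (m7.congr (fun i hi j hj => ?_) (fun i hi j hj => ?_) (fun i hi j hj => ?_)
          (fun i hi j hj => ?_))
        (m8.congr (fun i hi j hj => ?_) (fun i hi j hj => ?_) (fun i hi j hj => ?_)
          (fun i hi j hj => ?_))
      · exact (n2 i (by omega) j (by omega) (by omega)).symm
      · exact (n3 i (by omega) (a + j) (by omega) (by omega)).symm
      · intro i hi k hk j hj
        dsimp only
        rw [e8 _ (by omega) _ (by omega) (by omega), e8 _ (by omega) _ (by omega) (by omega),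
          e8 _ (by omega) _ (by omega) (by omega), e11 i hi j hj, e11 i hi k hk, e11 k hk j hj]
        exact q4 i hi k hk j hj
      · intro i hi j hj
        rw [e8 _ (by omega) _ (by omega) (by omega), e11 i hi j hj]
        exact q2 i hi j hj
      · rw [e8 _ (by omega) _ (by omega) (by omega), e01' i hi j hj]
      · exact (e01 i hi j hj).symm
      · exact (e01 i hi j hj).symm
      · rw [e8 _ (by omega) _ (by omega) (by omega), e11 i hi j hj]
      · exact e8 _ (by omega) _ (by omega) (by omega)
      · exact (e10 i hi j hj).symm
      · rw [e8 _ (by omega) _ (by omega) (by omega), n7] <;> omega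
      · exact (e10 i hi j hj).symm
      · rfl
      · exact (e00 i hi j hj).symm
      · exact e8 _ (by omega) _ (by omega) (by omega)
      · exact e8 _ (by omega) _ (by omega) (by omega)

/-! ### Walk lengths and shortest paths -/

theorem walkLength_append {n : ℕ} (w : Fin n → Fin n → Val) (i : Fin n) (l l' : List (Fin n)) :
    walkLength w i (l ++ l') = walkLength w i l + walkLength w (l.getLastD i) l' := by
  induction l generalizing i with
  | nil => simp [walkLength]
  | cons v l ih =>
    rw [List.cons_append, walkLength, walkLength, ih, add_assoc, List.getLastD_cons]

theorem add_mem_walkLengths {n : ℕ} {w : Fin n → Fin n → Val} {i k j : Fin n} {x y : Val}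
    (hx : x ∈ walkLengths w i k) (hy : y ∈ walkLengths w k j) : x + y ∈ walkLengths w i j := by
  obtain ⟨l, rfl, rfl⟩ := hx
  obtain ⟨l', rfl, rfl⟩ := hy
  refine ⟨l ++ l', ?_, walkLength_append w i l l'⟩
  induction l generalizing i with
  | nil => rfl
  | cons v l ih => simpa only [List.cons_append, List.getLastD_cons] using ih

theorem kleene_computesAPSP {ω : ℝ} (hω : 1 ≤ ω) (n : ℕ) : ComputesAPSP n (kleene ω n) := by
  intro w hw σ hσ i j
  have hn : 0 < n := i.pos
  have hat : ∀ i j, View.at ⟨0, 0, n, 1⟩ i j = ⟨0, i * n + j⟩ := fun i j => by simp [View.at]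
  obtain ⟨h1, h2, h3, h4⟩ := kleeneRec_correct hω (A := ⟨0, 0, n, 1⟩) hn rfl
    (View.inj_of_rows rfl le_rfl)
    -- Indices from `n` on get the empty set, so that the closure conditions hold for all natural
    -- numbers.
    (S := fun i j => {x | ∃ (hi : i < n) (hj : j < n), x ∈ walkLengths w ⟨i, hi⟩ ⟨j, hj⟩})
    (fun i hi => ⟨hi, hi, [], rfl, rfl⟩) (fun i x ⟨hi, _, hx⟩ => hw ⟨i, hi⟩ x hx)
    (fun i j k x ⟨hi, _, hx⟩ y ⟨_, hj, hy⟩ => ⟨hi, hj, add_mem_walkLengths hx hy⟩)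
    (σ := σ) (fun i hi j hj => ⟨hi, hj, [⟨j, hj⟩], rfl, by
      rw [hat]; simpa [walkLength, Store.get] using (hσ ⟨i, hi⟩ ⟨j, hj⟩).symm⟩)
  set τ := (kleeneRec ω ⟨0, 0, n, 1⟩ n).run σ with hτ
  have hF : ∀ i j : Fin n, (kleene ω n).run σ 0 ((i : ℕ) * n + j) =
      τ.get (View.at ⟨0, 0, n, 1⟩ i j) := fun i j => by rw [hat]; rfl
  rw [hF]
  refine ⟨(h1 i i.2 j j.2).2.2, ?_⟩
  rintro x ⟨l, rfl, rfl⟩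
  -- The first edge is split off: the triangle inequality at its endpoint and the entrywise bound by
  -- edge lengths serve the step, the diagonal bound serves the empty walk.
  induction l generalizing i with
  | nil => exact h3 i i.2
  | cons v l ih =>
    rw [List.getLastD_cons, walkLength]
    refine (h4 i i.2 v v.2 _ (Fin.is_lt _)).trans (add_le_add ?_ (ih v))
    have := h2 i i.2 v v.2
    rw [hat] at this
    dsimp only
    rw [hat]
    exact this.trans (hσ i v).le

theorem kleene_raceFree {ω : ℝ} (hω : 1 ≤ ω) (n : ℕ) : (kleene ω n).RaceFree [n * n] := by
  rcases Nat.eq_zero_or_pos n with rfl | hn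
  · rw [kleene, kleeneRec, if_pos rfl]
    trivial
  · exact kleeneRec_raceFree hω hn (liveIn_rows rfl) (View.inj_of_rows rfl le_rfl)

/-! ### Work -/

/-- A binary fork tree has one fork fewer than it has leaves. -/
theorem parFor_work (f : ℕ → ℕ → Instr) {i j m₁ m₂ : ℕ} (h₁ : 0 < m₁) (h₂ : 0 < m₂) :
    (parFor f i j m₁ m₂).work + 1 = 2 * (m₁ * m₂) := by
  refine parFor_rec (f := f) (motive := fun i j m₁ m₂ P => P.work + 1 = 2 * (m₁ * m₂))
    ?_ ?_ ?_ i j m₁ m₂ h₁ h₂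
  · intro i j
    rfl
  · intro i j a b m P Q _ _ _ _ _ _ _ hP hQ
    rw [Prog.work, add_mul]
    omega
  · intro i j m a b P Q _ _ _ _ _ _ _ hP hQ
    rw [Prog.work, mul_add]
    omega

/-- The upper bound is strengthened by `3 * (n₁ * n₂) + 1` to make the induction close. Splitting
the third range gains one such term, which pays for the addition loop, the fork and the two
allocations; splitting the output gains the `+ 1` for its fork. -/
theorem grid_work {ω : ℝ} (hω : 1 ≤ ω) (fr : ℕ) (X Y Z : View) {n₁ n₂ n₃ : ℕ}
    (h₁ : 0 < n₁) (h₂ : 0 < n₂) (h₃ : 0 < n₃) :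
    n₁ * n₂ * n₃ ≤ (grid ω fr X Y Z n₁ n₂ n₃).work ∧
      (grid ω fr X Y Z n₁ n₂ n₃).work + 3 * (n₁ * n₂) + 1 ≤ 5 * (n₁ * n₂ * n₃) := by
  refine grid_rec hω (motive := fun fr X Y Z n₁ n₂ n₃ P => n₁ * n₂ * n₃ ≤ P.work ∧
    P.work + 3 * (n₁ * n₂) + 1 ≤ 5 * (n₁ * n₂ * n₃)) ?_ ?_ ?_ ?_ fr X Y Z n₁ n₂ n₃ h₁ h₂ h₃
  · intro fr X Y Z
    simp [Prog.work]
  · intro fr X Y Z n₁ n₂ a b P Q h₁ h₂ _ _ _ _ _ _ hP hQ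
    have h : (addTemps fr Z n₁ n₂).work + 1 = 2 * (n₁ * n₂) := parFor_work _ h₁ h₂
    have : 0 < n₁ * n₂ := Nat.mul_pos h₁ h₂
    simp only [Prog.work, mul_add]
    omega
  · intro fr X Y Z a b n₂ n₃ P Q _ _ _ _ _ _ _ _ _ hP hQ
    simp only [Prog.work, add_mul, mul_add]
    omega
  · intro fr X Y Z n₁ a b n₃ P Q _ _ _ _ _ _ _ _ _ hP hQ
    simp only [Prog.work, add_mul, mul_add]
    omega

theorem mulAdd_work {ω : ℝ} (hω : 1 ≤ ω) (fr : ℕ) (Z X Y : View) {m₁ m₂ m₃ : ℕ}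
    (h₁ : 0 < m₁) (h₂ : 0 < m₂) (h₃ : 0 < m₃) :
    m₁ * m₂ * m₃ ≤ (mulAdd ω fr Z X Y m₁ m₂ m₃).work ∧
      (mulAdd ω fr Z X Y m₁ m₂ m₃).work ≤ 7 * (m₁ * m₂ * m₃) := by
  obtain ⟨g1, g2⟩ := grid_work hω (fr + 2) X ⟨fr, 0, 1, m₃⟩ ⟨fr + 1, 0, m₂, 1⟩ h₁ h₂ h₃
  have hc : (copyCols fr Y m₃ m₂).work + 1 = 2 * (m₃ * m₂) := parFor_work _ h₃ h₂
  have ha : (addTo (fr + 1) Z m₁ m₂).work + 1 = 2 * (m₁ * m₂) := parFor_work _ h₁ h₂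
  have : m₃ * m₂ ≤ m₁ * m₂ * m₃ := by
    rw [mul_assoc, mul_comm m₃]
    exact Nat.le_mul_of_pos_left _ h₁
  rw [mulAdd_eq]
  simp only [Prog.work]
  omega

/-- The volumes of the six products are exactly the mixed terms of `(a + b) ^ 3`; the step from 7 to
8 pays for the two forks. -/
theorem kleeneRec_work {ω : ℝ} (hω : 1 ≤ ω) (A : View) {n : ℕ} (hn : 0 < n) :
    n ^ 3 ≤ (kleeneRec ω A n).work ∧ (kleeneRec ω A n).work ≤ 8 * n ^ 3 := by
  refine kleeneRec_rec (motive := fun A n P => n ^ 3 ≤ P.work ∧ P.work ≤ 8 * n ^ 3) ?_ ?_ A n hn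
  · intro A
    simp [Prog.work]
  · intro A a b P Q ha hab hba _ _ hP hQ
    have hb : 0 < b := by omega
    have h1 := mulAdd_work hω 1 (A.sub 0 a) (A.sub 0 0) (A.sub 0 a) ha hb ha
    have h2 := mulAdd_work hω 1 (A.sub a 0) (A.sub a 0) (A.sub 0 0) hb ha ha
    have h3 := mulAdd_work hω 1 (A.sub a a) (A.sub a 0) (A.sub 0 a) hb hb ha
    have h4 := mulAdd_work hω 1 (A.sub 0 a) (A.sub 0 a) (A.sub a a) ha hb hb
    have h5 := mulAdd_work hω 1 (A.sub a 0) (A.sub a a) (A.sub a 0) hb ha hb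
    have h6 := mulAdd_work hω 1 (A.sub 0 0) (A.sub 0 a) (A.sub a 0) ha ha hb
    have e1 : b * a * a = a * a * b := by ring
    have e2 : a * b * a = a * a * b := by ring
    have e3 : b * b * a = a * b * b := by ring
    have e4 : b * a * b = a * b * b := by ring
    have e5 : (a + b) ^ 3 = a ^ 3 + b ^ 3 + 3 * (a * a * b) + 3 * (a * b * b) := by ring
    have p1 : 0 < a * a * b := by positivity
    rw [e1] at h2
    rw [e2] at h1
    rw [e3] at h3
    rw [e4] at h5
    simp only [kleeneStep, Prog.work]
    omega

/-! ### Span -/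

/-- The larger half governs the recursion depth, so `Nat.clog 2` counts the halvings of a range
exactly. -/
theorem clog_halves {a b : ℕ} (ha : 0 < a) (hab : a ≤ b) (hba : b ≤ a + 1) :
    Nat.clog 2 (a + b) = Nat.clog 2 b + 1 := by
  rw [Nat.clog_of_two_le one_lt_two (by omega), show (a + b + 2 - 1) / 2 = b by omega]

theorem parFor_span (f : ℕ → ℕ → Instr) {i j m₁ m₂ : ℕ} (h₁ : 0 < m₁) (h₂ : 0 < m₂) :
    (parFor f i j m₁ m₂).span ≤ Nat.clog 2 m₁ + Nat.clog 2 m₂ + 1 := by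
  refine parFor_rec (f := f) (motive := fun i j m₁ m₂ P =>
    P.span ≤ Nat.clog 2 m₁ + Nat.clog 2 m₂ + 1) ?_ ?_ ?_ i j m₁ m₂ h₁ h₂
  · intro i j
    simp [Prog.span]
  · intro i j a b m P Q ha hab hba _ _ _ _ hP hQ
    have := Nat.clog_mono_right 2 hab
    rw [Prog.span, clog_halves ha hab hba]
    omega
  · intro i j m a b P Q ha hab hba _ _ _ _ hP hQ
    have := Nat.clog_mono_right 2 hab
    rw [Prog.span, clog_halves ha hab hba]
    omega

/-- The number of levels is at most the sum of the three logarithms whatever the order of the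
halvings, hence independently of `ω`; a level costs at most an addition loop and a constant. -/
theorem grid_span {ω : ℝ} (hω : 1 ≤ ω) (fr : ℕ) (X Y Z : View) {n₁ n₂ n₃ : ℕ}
    (h₁ : 0 < n₁) (h₂ : 0 < n₂) (h₃ : 0 < n₃) :
    (grid ω fr X Y Z n₁ n₂ n₃).span ≤ (Nat.clog 2 n₁ + Nat.clog 2 n₂ + Nat.clog 2 n₃) *
      (Nat.clog 2 n₁ + Nat.clog 2 n₂ + 5) + 1 := by
  refine grid_rec hω (motive := fun fr X Y Z n₁ n₂ n₃ P =>
    P.span ≤ (Nat.clog 2 n₁ + Nat.clog 2 n₂ + Nat.clog 2 n₃) *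
      (Nat.clog 2 n₁ + Nat.clog 2 n₂ + 5) + 1) ?_ ?_ ?_ ?_ fr X Y Z n₁ n₂ n₃ h₁ h₂ h₃
  · intro fr X Y Z
    simp [Prog.span]
  · intro fr X Y Z n₁ n₂ a b P Q h₁ h₂ ha hab hba _ _ _ hP hQ
    have h : (addTemps fr Z n₁ n₂).span ≤ _ := parFor_span _ h₁ h₂
    have hm := Nat.clog_mono_right 2 hab
    simp only [Prog.span, clog_halves ha hab hba]
    set L := Nat.clog 2 n₁ + Nat.clog 2 n₂
    have := Nat.mul_le_mul_right (L + 5) (show L + Nat.clog 2 a ≤ L + Nat.clog 2 b by omega)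
    have e : (L + (Nat.clog 2 b + 1)) * (L + 5) = (L + Nat.clog 2 b) * (L + 5) + (L + 5) := by ring
    omega
  · intro fr X Y Z a b n₂ n₃ P Q ha hab hba h₂ h₃ _ _ _ _ hP hQ
    have hm := Nat.clog_mono_right 2 hab
    simp only [Prog.span, clog_halves ha hab hba]
    generalize Nat.clog 2 a = x at *
    generalize Nat.clog 2 b = y at *
    generalize Nat.clog 2 n₂ = u at *
    generalize Nat.clog 2 n₃ = v at *
    have := Nat.mul_le_mul (show x + u + v ≤ y + u + v by omega) (show x + u + 5 ≤ y + u + 5 by omega)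
    have e : (y + 1 + u + v) * (y + 1 + u + 5) =
      (y + u + v) * (y + u + 5) + (y + u + v) + (y + u + 5) + 1 := by ring
    omega
  · intro fr X Y Z n₁ a b n₃ P Q h₁ ha hab hba h₃ _ _ _ _ hP hQ
    have hm := Nat.clog_mono_right 2 hab
    simp only [Prog.span, clog_halves ha hab hba]
    generalize Nat.clog 2 a = x at *
    generalize Nat.clog 2 b = y at *
    generalize Nat.clog 2 n₁ = u at *
    generalize Nat.clog 2 n₃ = v at *
    have := Nat.mul_le_mul (show u + x + v ≤ u + y + v by omega) (show u + x + 5 ≤ u + y + 5 by omega)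
    have e : (u + (y + 1) + v) * (u + (y + 1) + 5) =
      (u + y + v) * (u + y + 5) + (u + y + v) + (u + y + 5) + 1 := by ring
    omega

theorem mulAdd_span {ω : ℝ} (hω : 1 ≤ ω) (fr : ℕ) (Z X Y : View) {m₁ m₂ m₃ k : ℕ}
    (h₁ : 0 < m₁) (h₂ : 0 < m₂) (h₃ : 0 < m₃) (hm₁ : Nat.clog 2 m₁ ≤ k) (hm₂ : Nat.clog 2 m₂ ≤ k)
    (hm₃ : Nat.clog 2 m₃ ≤ k) :
    (mulAdd ω fr Z X Y m₁ m₂ m₃).span ≤ 6 * k ^ 2 + 19 * k + 5 := by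
  have hg := grid_span hω (fr + 2) X ⟨fr, 0, 1, m₃⟩ ⟨fr + 1, 0, m₂, 1⟩ h₁ h₂ h₃
  have hc : (copyCols fr Y m₃ m₂).span ≤ _ := parFor_span _ h₃ h₂
  have ha : (addTo (fr + 1) Z m₁ m₂).span ≤ _ := parFor_span _ h₁ h₂
  have := Nat.mul_le_mul (show Nat.clog 2 m₁ + Nat.clog 2 m₂ + Nat.clog 2 m₃ ≤ 3 * k by omega)
    (show Nat.clog 2 m₁ + Nat.clog 2 m₂ + 5 ≤ 2 * k + 5 by omega)
  have e : 3 * k * (2 * k + 5) = 6 * k ^ 2 + 15 * k := by ring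
  rw [mulAdd_eq]
  simp only [Prog.span]
  omega

theorem kleeneRec_span {ω : ℝ} (hω : 1 ≤ ω) (A : View) {n : ℕ} (hn : 0 < n) :
    (kleeneRec ω A n).span ≤ 367 * n := by
  -- The potential is quadratic in the logarithm. Two halves contribute two copies of it: one
  -- remains, the other pays for the four successive products of a level. The constants make the
  -- step exact when `clog b = clog a + 1`, and the base case exact at `n = 1`.
  suffices (kleeneRec ω A n).span + (24 * Nat.clog 2 n ^ 2 + 172 * Nat.clog 2 n + 366) ≤ 367 * n by
    omega
  refine kleeneRec_rec (motive := fun A n P =>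
    P.span + (24 * Nat.clog 2 n ^ 2 + 172 * Nat.clog 2 n + 366) ≤ 367 * n) ?_ ?_ A n hn
  · intro A
    simp [Prog.span]
  · intro A a b P Q ha hab hba _ _ hP hQ
    have hb : 0 < b := by omega
    have hm := Nat.clog_mono_right 2 hab
    have hm' : Nat.clog 2 b ≤ Nat.clog 2 a + 1 := by
      refine Nat.clog_le_of_le_pow ?_
      have := Nat.le_pow_clog one_lt_two a
      rw [pow_succ]
      omega
    have h1 := mulAdd_span hω 1 (A.sub 0 a) (A.sub 0 0) (A.sub 0 a) ha hb ha hm le_rfl hm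
    have h2 := mulAdd_span hω 1 (A.sub a 0) (A.sub a 0) (A.sub 0 0) hb ha ha le_rfl hm hm
    have h3 := mulAdd_span hω 1 (A.sub a a) (A.sub a 0) (A.sub 0 a) hb hb ha le_rfl le_rfl hm
    have h4 := mulAdd_span hω 1 (A.sub 0 a) (A.sub 0 a) (A.sub a a) ha hb hb hm le_rfl le_rfl
    have h5 := mulAdd_span hω 1 (A.sub a 0) (A.sub a a) (A.sub a 0) hb ha hb le_rfl hm le_rfl
    have h6 := mulAdd_span hω 1 (A.sub 0 0) (A.sub 0 a) (A.sub a 0) ha ha hb hm hm le_rfl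
    have m1 := max_le h1 h2
    have m2 := max_le h4 h5
    simp only [kleeneStep, Prog.span, clog_halves ha hab hba]
    generalize Nat.clog 2 a = x at *
    generalize Nat.clog 2 b = y at *
    have e : (y + 1) ^ 2 = y ^ 2 + 2 * y + 1 := by ring
    have e' : (x + 1) ^ 2 = x ^ 2 + 2 * x + 1 := by ring
    have hy := Nat.pow_le_pow_left hm' 2
    linarith

/-! ### Addresses -/

/-- The stack space that a computation allocates. -/
def Prog.depth : Prog → ℕ
  | .skip => 0
  | .op _ => 0
  | .seq P Q => max P.depth Q.depth
  | .par P Q => max P.depth Q.depth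
  | .alloc m P => m + P.depth

theorem Loc.addr_append {fs : List ℕ} {l : Loc} (h : l.frame ≤ fs.length) (m : ℕ) :
    l.addr (fs ++ [m]) = l.addr fs := by
  rw [Loc.addr, Loc.addr, List.take_append_of_le_length h]

/-- A race-free computation accesses only the locations it touches and the stack above. -/
theorem Prog.trace_touches {fs : List ℕ} {P : Prog} (hP : P.RaceFree fs) {s : Step}
    (hs : s ∈ P.trace fs) : ∀ a, a ∈ s.srcs ∨ a = s.dst →
      (∃ l : Loc, P.Touches l ∧ l.Live fs ∧ a = l.addr fs) ∨
        (fs.sum ≤ a ∧ a < fs.sum + P.depth) := by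
  intro x hx
  induction P generalizing fs with
  | skip => simp [Prog.trace] at hs
  | op c =>
    simp only [Prog.trace, List.mem_singleton] at hs
    subst hs
    left
    rcases hx with hx | rfl
    · obtain ⟨l, hl, rfl⟩ := List.mem_map.1 hx
      exact ⟨l, .inl hl, hP.1 l hl, rfl⟩
    · exact ⟨c.dst, .inr rfl, hP.2, rfl⟩
  | seq P Q ihP ihQ =>
    rcases List.mem_append.1 hs with hs | hs
    · refine (ihP hP.1 hs).imp (fun ⟨l, h, h'⟩ => ⟨l, .inl h, h'⟩) fun h => ?_
      exact ⟨h.1, h.2.trans_le (Nat.add_le_add_left (le_max_left _ _) _)⟩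
    · refine (ihQ hP.2 hs).imp (fun ⟨l, h, h'⟩ => ⟨l, .inr h, h'⟩) fun h => ?_
      exact ⟨h.1, h.2.trans_le (Nat.add_le_add_left (le_max_right _ _) _)⟩
  | par P Q ihP ihQ =>
    rcases List.mem_append.1 hs with hs | hs
    · refine (ihP hP.1 hs).imp (fun ⟨l, h, h'⟩ => ⟨l, .inl h, h'⟩) fun h => ?_
      exact ⟨h.1, h.2.trans_le (Nat.add_le_add_left (le_max_left _ _) _)⟩
    · refine (ihQ hP.2.1 hs).imp (fun ⟨l, h, h'⟩ => ⟨l, .inr h, h'⟩) fun h => ?_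
      exact ⟨h.1, h.2.trans_le (Nat.add_le_add_left (le_max_right _ _) _)⟩
  | alloc m P ih =>
    rcases ih hP hs with ⟨l, hl, hl', rfl⟩ | h
    · have hlt := hl'.frame_lt
      simp only [List.length_append, List.length_cons, List.length_nil] at hlt
      rcases Nat.lt_or_ge l.frame fs.length with hlf | hlf
      · refine .inl ⟨l, hl, ?_, Loc.addr_append hlf.le m⟩
        obtain ⟨k, hk, hk'⟩ := hl'
        exact ⟨k, by rwa [List.getElem?_append_left hlf] at hk, hk'⟩
      · have e : l.frame = fs.length := by omega
        obtain ⟨k, hk, hk'⟩ := hl'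
        rw [e] at hk
        simp only [List.getElem?_concat_length, Option.some.injEq] at hk
        rw [Loc.addr_append (by omega), Loc.addr, e, List.take_length, Prog.depth]
        right
        omega
    · rw [List.sum_append] at h
      simp only [List.sum_singleton] at h
      rw [Prog.depth]
      right
      omega

/-- Writes are treated apart from the other accesses because, in the cost analysis, a written line
has to be pinned while a line that is only read may be evicted for free. -/
theorem Prog.trace_writes {fs : List ℕ} {P : Prog} (hP : P.RaceFree fs) {s : Step}
    (hs : s ∈ P.trace fs) : (∃ l : Loc, P.Writes l ∧ l.Live fs ∧ s.dst = l.addr fs) ∨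
        (fs.sum ≤ s.dst ∧ s.dst < fs.sum + P.depth) := by
  induction P generalizing fs with
  | skip => simp [Prog.trace] at hs
  | op c =>
    simp only [Prog.trace, List.mem_singleton] at hs
    subst hs
    exact .inl ⟨c.dst, rfl, hP.2, rfl⟩
  | seq P Q ihP ihQ =>
    rcases List.mem_append.1 hs with hs | hs
    · refine (ihP hP.1 hs).imp (fun ⟨l, h, h'⟩ => ⟨l, .inl h, h'⟩) fun h => ?_
      exact ⟨h.1, h.2.trans_le (Nat.add_le_add_left (le_max_left _ _) _)⟩
    · refine (ihQ hP.2 hs).imp (fun ⟨l, h, h'⟩ => ⟨l, .inr h, h'⟩) fun h => ?_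
      exact ⟨h.1, h.2.trans_le (Nat.add_le_add_left (le_max_right _ _) _)⟩
  | par P Q ihP ihQ =>
    rcases List.mem_append.1 hs with hs | hs
    · refine (ihP hP.1 hs).imp (fun ⟨l, h, h'⟩ => ⟨l, .inl h, h'⟩) fun h => ?_
      exact ⟨h.1, h.2.trans_le (Nat.add_le_add_left (le_max_left _ _) _)⟩
    · refine (ihQ hP.2.1 hs).imp (fun ⟨l, h, h'⟩ => ⟨l, .inr h, h'⟩) fun h => ?_
      exact ⟨h.1, h.2.trans_le (Nat.add_le_add_left (le_max_right _ _) _)⟩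
  | alloc m P ih =>
    rcases ih hP hs with ⟨l, hl, hl', e'⟩ | h
    · have hlt := hl'.frame_lt
      simp only [List.length_append, List.length_cons, List.length_nil] at hlt
      rcases Nat.lt_or_ge l.frame fs.length with hlf | hlf
      · refine .inl ⟨l, hl, ?_, e'.trans (Loc.addr_append hlf.le m)⟩
        obtain ⟨k, hk, hk'⟩ := hl'
        exact ⟨k, by rwa [List.getElem?_append_left hlf] at hk, hk'⟩
      · have e : l.frame = fs.length := by omega
        obtain ⟨k, hk, hk'⟩ := hl'
        rw [e] at hk
        simp only [List.getElem?_concat_length, Option.some.injEq] at hk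
        rw [e', Loc.addr_append (by omega), Loc.addr, e, List.take_length, Prog.depth]
        right
        omega
    · rw [List.sum_append] at h
      simp only [List.sum_singleton] at h
      rw [Prog.depth]
      right
      omega

theorem Prog.exists_step_of_writes {fs : List ℕ} {P : Prog} {l : Loc} (hl : P.Writes l)
    (hlf : l.frame < fs.length) : ∃ s ∈ P.trace fs, s.dst = l.addr fs := by
  induction P generalizing fs with
  | skip => exact hl.elim
  | op c =>
    simp only [Prog.Writes] at hl
    subst hl
    exact ⟨_, List.mem_singleton_self _, rfl⟩
  | seq P Q ihP ihQ =>
    rcases hl with hl | hl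
    · obtain ⟨s, hs, e⟩ := ihP hl hlf
      exact ⟨s, List.mem_append_left _ hs, e⟩
    · obtain ⟨s, hs, e⟩ := ihQ hl hlf
      exact ⟨s, List.mem_append_right _ hs, e⟩
  | par P Q ihP ihQ =>
    rcases hl with hl | hl
    · obtain ⟨s, hs, e⟩ := ihP hl hlf
      exact ⟨s, List.mem_append_left _ hs, e⟩
    · obtain ⟨s, hs, e⟩ := ihQ hl hlf
      exact ⟨s, List.mem_append_right _ hs, e⟩
  | alloc m P ih =>
    obtain ⟨s, hs, e⟩ := ih (fs := fs ++ [m]) hl (by simp; omega)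
    exact ⟨s, hs, e.trans (Loc.addr_append hlf.le m)⟩

/-! ### Counting write transfers -/

/-- The lines that a sequence of accesses writes. -/
def dstLines (B : ℕ) (t : List Step) : Finset ℕ := (t.map fun s => s.dst / B).toFinset

theorem mem_dstLines {B : ℕ} {t : List Step} {s : Step} (h : s ∈ t) : s.dst / B ∈ dstLines B t :=
  List.mem_toFinset.2 (List.mem_map.2 ⟨s, h, rfl⟩)

/-- After a part of the accesses, the lines written in it are still modified in the cache unless
they have been written back. -/
theorem Transfers.split {M B : ℕ} {C D : Finset ℕ} {t t' : List Step} {r w : ℕ}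
    (h : Transfers M B C D (t ++ t') r w) (hC : C.card * B ≤ M) (hD : D ⊆ C) :
    ∃ C' D' r' w', C'.card * B ≤ M ∧ D' ⊆ C' ∧ Transfers M B C' D' t' r' w' ∧
      w' ≤ w ∧ (dstLines B t ∪ D).card + w' ≤ w + D'.card := by
  generalize ht : t ++ t' = u at h
  -- Once the part `t` is used up, the current state of the cache is the one sought.
  have nil : ∀ {C D : Finset ℕ} {t : List Step} {r w}, t ++ t' = u → t = [] → C.card * B ≤ M →
      D ⊆ C → Transfers M B C D u r w → ∃ C' D' r' w', C'.card * B ≤ M ∧ D' ⊆ C' ∧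
        Transfers M B C' D' t' r' w' ∧ w' ≤ w ∧
          (dstLines B t ∪ D).card + w' ≤ w + D'.card := by
    rintro C D t r w rfl rfl hC hD h
    exact ⟨C, D, r, w, hC, hD, h, le_rfl, by simp [dstLines, add_comm]⟩
  induction h generalizing t with
  | done C => exact nil ht (List.append_eq_nil_iff.1 ht).1 hC hD (.done C)
  | load C D u r w ℓ hℓ hM h ih =>
    obtain ⟨C', D', r', w', h1, h2, h3, h5, h4⟩ := ih (by rwa [Finset.card_insert_of_notMem hℓ])
      (hD.trans (Finset.subset_insert _ _)) ht nil
    exact ⟨C', D', r', w', h1, h2, h3, h5, h4⟩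
  | evictClean C D u r w ℓ hℓ hℓD h ih =>
    refine ih ((Nat.mul_le_mul_right B (Finset.card_le_card (Finset.erase_subset _ _))).trans hC)
      (fun x hx => Finset.mem_erase.2 ⟨fun e => hℓD (e ▸ hx), hD hx⟩) ht nil
  | evictDirty C D u r w ℓ hℓ hℓD h ih =>
    obtain ⟨C', D', r', w', h1, h2, h3, h5, h4⟩ := ih
      ((Nat.mul_le_mul_right B (Finset.card_le_card (Finset.erase_subset _ _))).trans hC)
      (Finset.erase_subset_erase _ hD) ht nil
    refine ⟨C', D', r', w', h1, h2, h3, by omega, ?_⟩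
    -- A write-back removes at most one line from the union and is paid for by one write transfer.
    have : dstLines B t ∪ D ⊆ insert ℓ (dstLines B t ∪ D.erase ℓ) := by
      intro x hx
      simp only [Finset.mem_union, Finset.mem_insert, Finset.mem_erase] at hx ⊢
      tauto
    have := (Finset.card_le_card this).trans (Finset.card_insert_le _ _)
    omega
  | exec C D s u r w hsrc hdst h ih =>
    rcases t with _ | ⟨s', t⟩
    · exact nil ht rfl hC hD (.exec C D s u r w hsrc hdst h)
    · simp only [List.cons_append, List.cons.injEq] at ht
      obtain ⟨rfl, ht⟩ := ht
      obtain ⟨C', D', r', w', h1, h2, h3, h5, h4⟩ := ih hC (Finset.insert_subset hdst hD) ht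
        (by rintro C D t r w rfl rfl hC hD h
            exact ⟨C, D, r, w, hC, hD, h, le_rfl, by simp [dstLines, add_comm]⟩)
      refine ⟨C', D', r', w', h1, h2, h3, by omega, ?_⟩
      have : dstLines B (s' :: t) ∪ D = dstLines B t ∪ insert (s'.dst / B) D := by
        simp only [dstLines, List.map_cons, List.toFinset_cons]
        rw [Finset.insert_union, Finset.union_insert]
      rwa [this]

theorem Transfers.card_le {M B : ℕ} {C D : Finset ℕ} {r w : ℕ} (h : Transfers M B C D [] r w) :
    D.card ≤ w := by
  generalize ht : ([] : List Step) = u at h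
  induction h with
  | done C => simp
  | load C D u r w ℓ hℓ hM h ih => exact ih ht
  | evictClean C D u r w ℓ hℓ hℓD h ih => exact ih ht
  | evictDirty C D u r w ℓ hℓ hℓD h ih =>
    have := ih ht
    rw [Finset.card_erase_of_mem hℓD] at this
    omega
  | exec => cases ht

theorem Transfers.card_dstLines_le {M B : ℕ} {t : List Step} {r w : ℕ}
    (h : Transfers M B ∅ ∅ t r w) : (dstLines B t).card ≤ w := by
  rw [← List.append_nil t] at h
  obtain ⟨C', D', r', w', -, -, h3, -, h4⟩ := h.split (by simp) (Finset.Subset.refl _)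
  have := h3.card_le
  rw [Finset.union_empty] at h4
  omega

/-- In any execution, serving the part `t` of the accesses takes at least `k` write transfers. -/
def NeedsWrites (M B : ℕ) (t : List Step) (k : ℕ) : Prop :=
  ∀ (C D : Finset ℕ) (t' : List Step) (r w : ℕ), C.card * B ≤ M → D ⊆ C →
    Transfers M B C D (t ++ t') r w → ∃ C' D' r' w', C'.card * B ≤ M ∧ D' ⊆ C' ∧
      Transfers M B C' D' t' r' w' ∧ w' + k ≤ w

/-- The requirement is stated for every admissible initial cache and every continuation, so that the
requirements of consecutive parts add up. -/
theorem NeedsWrites.append {M B : ℕ} {t₁ t₂ : List Step} {k₁ k₂ : ℕ}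
    (h₁ : NeedsWrites M B t₁ k₁) (h₂ : NeedsWrites M B t₂ k₂) :
    NeedsWrites M B (t₁ ++ t₂) (k₁ + k₂) := by
  intro C D t' r w hC hD h
  rw [List.append_assoc] at h
  obtain ⟨C', D', r', w', hC', hD', h', hw⟩ := h₁ C D _ r w hC hD h
  obtain ⟨C'', D'', r'', w'', hC'', hD'', h'', hw'⟩ := h₂ C' D' _ r' w' hC' hD' h'
  exact ⟨C'', D'', r'', w'', hC'', hD'', h'', by omega⟩

/-- Of the lines written, at most `M / B` can still be in the cache at the end; the others have been
written back. -/
theorem needsWrites_dstLines {M B : ℕ} (hB : 0 < B) (t : List Step) :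
    NeedsWrites M B t ((dstLines B t).card - M / B) := by
  intro C D t' r w hC hD h
  obtain ⟨C', D', r', w', h1, h2, h3, h5, h4⟩ := h.split hC hD
  refine ⟨C', D', r', w', h1, h2, h3, ?_⟩
  have hD' : D'.card ≤ M / B :=
    (Nat.le_div_iff_mul_le hB).2 ((Nat.mul_le_mul_right B (Finset.card_le_card h2)).trans h1)
  have := Finset.card_le_card (Finset.subset_union_left (s₁ := dstLines B t) (s₂ := D))
  omega

theorem needsWrites_zero {M B : ℕ} (t : List Step) : NeedsWrites M B t 0 := by
  intro C D t' r w hC hD h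
  obtain ⟨C', D', r', w', h1, h2, h3, h5, -⟩ := h.split hC hD
  exact ⟨C', D', r', w', h1, h2, h3, h5⟩

theorem NeedsWrites.le {M B : ℕ} {t : List Step} {k r w : ℕ} (h : NeedsWrites M B t k)
    (ht : Transfers M B ∅ ∅ t r w) : k ≤ w := by
  rw [← List.append_nil t] at ht
  obtain ⟨C', D', r', w', -, -, -, hw⟩ := h ∅ ∅ [] r w (by simp) (Finset.Subset.refl _) ht
  omega

/-- The number of lines that contain the distinct words of an array is at least the number of words
divided by the length of a line. -/
theorem mul_le_card_dstLines {B : ℕ} (hB : 0 < B) {fs : List ℕ} {P : Prog} {Z : View} {n₁ n₂ : ℕ}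
    (hP : ∀ i < n₁, ∀ j < n₂, P.Writes (Z.at i j)) (hZ : Z.frame < fs.length)
    (hZi : Z.Inj n₁ n₂) : n₁ * n₂ ≤ B * (dstLines B (P.trace fs)).card := by
  set S := (Finset.range n₁ ×ˢ Finset.range n₂).image fun p => (Z.at p.1 p.2).addr fs with hS
  have hcard : S.card = n₁ * n₂ := by
    rw [hS, Finset.card_image_of_injOn, Finset.card_product, Finset.card_range, Finset.card_range]
    rintro ⟨i, j⟩ hp ⟨i', j'⟩ hp' h
    simp only [Finset.coe_product, Finset.coe_range, Set.mem_prod, Set.mem_Iio] at hp hp'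
    have : Z.at i j = Z.at i' j' := by
      simp only [Loc.addr, View.at, Nat.add_left_cancel_iff] at h
      simp only [View.at, h]
    obtain ⟨rfl, rfl⟩ := hZi _ hp.1 _ hp.2 _ hp'.1 _ hp'.2 this
    rfl
  have hsub : S.image (· / B) ⊆ dstLines B (P.trace fs) := by
    intro x hx
    simp only [hS, Finset.mem_image, Finset.mem_product, Finset.mem_range] at hx
    obtain ⟨_, ⟨⟨i, j⟩, ⟨hi, hj⟩, rfl⟩, rfl⟩ := hx
    obtain ⟨s, hs, e⟩ := Prog.exists_step_of_writes (hP i hi j hj) hZ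
    simp only at hi hj ⊢
    rw [← e]
    exact mem_dstLines hs
  have hfib : S.card ≤ B * (S.image (· / B)).card := by
    refine Finset.card_le_mul_card_image S B fun x _ => ?_
    refine (Finset.card_le_card (t := Finset.Ico (x * B) (x * B + B)) fun a ha => ?_).trans (by simp)
    obtain ⟨-, rfl⟩ := Finset.mem_filter.1 ha
    rw [Finset.mem_Ico]
    have := Nat.div_add_mod a B
    have := Nat.mod_lt a hB
    rw [mul_comm]
    omega
  rw [← hcard]
  exact hfib.trans (Nat.mul_le_mul_left B (Finset.card_le_card hsub))

/-- The recursion is followed while the third side exceeds `8 q s`. Until then both output sides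
stay at least `2 s`, and at the end a block has few cells in comparison with the output lines it
must write back. Additions of temporaries are counted as 0. -/
theorem grid_needsWrites {ω : ℝ} (hω : 1 ≤ ω) {M B : ℕ} (hB : 0 < B) (hM : 0 < M) {fr : ℕ}
    {X Y Z : View} {n₁ n₂ n₃ : ℕ} {fs : List ℕ} (h₁ : 2 * √(M : ℝ) ≤ n₁) (h₂ : 2 * √(M : ℝ) ≤ n₂)
    (h₃ : 0 < n₃) (hfs : fs.length = fr) (hZ : Z.frame < fr) (hZi : Z.Inj n₁ n₂) :
    ∃ k, NeedsWrites M B ((grid ω fr X Y Z n₁ n₂ n₃).trace fs) k ∧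
      (n₁ * n₂ * n₃ : ℝ) ≤ 16 * ω ^ (2 / 3 : ℝ) * √(M : ℝ) * B * k := by
  have hs1 : 1 ≤ √(M : ℝ) := Real.one_le_sqrt.2 (by exact_mod_cast hM)
  have hss : √(M : ℝ) * √(M : ℝ) = M := Real.mul_self_sqrt (by positivity)
  have hq : 1 ≤ ω ^ (2 / 3 : ℝ) := Real.one_le_rpow hω (by norm_num)
  have hn₁ : 0 < n₁ := by
    have : (0 : ℝ) < n₁ := by linarith
    exact_mod_cast this
  have hn₂ : 0 < n₂ := by
    have : (0 : ℝ) < n₂ := by linarith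
    exact_mod_cast this
  set s := √(M : ℝ)
  set q := ω ^ (2 / 3 : ℝ) with hqd
  -- The output has at least `4 * M` words, so the at most `M` words that remain in the cache are at
  -- most a quarter of it and `n₁ n₂ ≤ 2 B k`. Multiplied by the third side `8 q s` this is the
  -- constant 16.
  have base : ∀ {P : Prog} {fs : List ℕ} {Z : View} {n₁ n₂ n₃ : ℕ}, 2 * s ≤ n₁ → 2 * s ≤ n₂ →
      (∀ i < n₁, ∀ j < n₂, P.Writes (Z.at i j)) → Z.frame < fs.length → Z.Inj n₁ n₂ →
      (n₃ : ℝ) ≤ 8 * (q * s) → ∃ k, NeedsWrites M B (P.trace fs) k ∧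
        (n₁ * n₂ * n₃ : ℝ) ≤ 16 * q * s * B * k := by
    intro P fs Z n₁ n₂ n₃ h₁ h₂ hP hZ hZi h₃
    refine ⟨_, needsWrites_dstLines hB _, ?_⟩
    have h : (n₁ * n₂ : ℝ) ≤ B * (dstLines B (P.trace fs)).card := by
      exact_mod_cast mul_le_card_dstLines hB hP hZ hZi
    have hd : (B * (M / B : ℕ) : ℝ) ≤ M := by exact_mod_cast Nat.mul_div_le M B
    have hk : ((dstLines B (P.trace fs)).card : ℝ) ≤
        ((dstLines B (P.trace fs)).card - M / B : ℕ) + (M / B : ℕ) := by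
      exact_mod_cast show _ ≤ (dstLines B (P.trace fs)).card - M / B + M / B by omega
    set k := (dstLines B (P.trace fs)).card - M / B
    have h4 : 4 * (M : ℝ) ≤ n₁ * n₂ := by nlinarith
    have hBk : (n₁ * n₂ : ℝ) ≤ 2 * (B * k) := by
      have : (B : ℝ) * (dstLines B (P.trace fs)).card ≤ B * (k + (M / B : ℕ)) := by gcongr
      rw [mul_add] at this
      have : (0 : ℝ) ≤ M := by positivity
      linarith
    calc (n₁ * n₂ * n₃ : ℝ) ≤ 2 * (B * k) * (8 * (q * s)) := by gcongr
      _ = _ := by ring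
  -- An output side is halved only if `q` times it is at least the third side; it then exceeds `8
  -- s`, and both halves are still at least `2 s`.
  have half : ∀ {a b n₃ : ℕ}, b ≤ a + 1 → a ≤ b → (n₃ : ℝ) ≤ q * (a + b : ℕ) →
      ¬ (n₃ : ℝ) ≤ 8 * (q * s) → 2 * s ≤ a ∧ 2 * s ≤ b := by
    intro a b n₃ hba hab h h'
    have h1 : q * (8 * s) < q * (a + b : ℕ) := by linarith
    have h2 := lt_of_mul_lt_mul_left h1 (by linarith)
    push_cast at h2
    have : (b : ℝ) ≤ a + 1 := by exact_mod_cast hba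
    have : (a : ℝ) ≤ b := by exact_mod_cast hab
    constructor <;> linarith
  -- The trivial equation lets the motive remember which program `P` is, which is needed to stop
  -- early with `base`.
  suffices h : grid ω fr X Y Z n₁ n₂ n₃ = grid ω fr X Y Z n₁ n₂ n₃ → ∃ k,
      NeedsWrites M B ((grid ω fr X Y Z n₁ n₂ n₃).trace fs) k ∧
        (n₁ * n₂ * n₃ : ℝ) ≤ 16 * q * s * B * k from h rfl
  revert hfs hZ hZi
  revert h₁ h₂
  revert fs
  refine grid_rec hω (motive := fun fr X Y Z n₁ n₂ n₃ P => ∀ {fs : List ℕ}, 2 * s ≤ n₁ →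
    2 * s ≤ n₂ → fs.length = fr → Z.frame < fr → Z.Inj n₁ n₂ → P = grid ω fr X Y Z n₁ n₂ n₃ →
    ∃ k, NeedsWrites M B (P.trace fs) k ∧ (n₁ * n₂ * n₃ : ℝ) ≤ 16 * q * s * B * k)
    ?_ ?_ ?_ ?_ fr X Y Z n₁ n₂ n₃ hn₁ hn₂ h₃
  · intro fr X Y Z fs h₁
    push_cast at h₁
    linarith
  · rintro fr X Y Z n₁ n₂ a b P Q hn₁ hn₂ ha hab hba _ hPe hQe hP hQ fs h₁ h₂ rfl hZ hZi he
    by_cases h₃ : ((a + b : ℕ) : ℝ) ≤ 8 * (q * s)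
    · refine base h₁ h₂ (fun i hi j hj => ?_) hZ hZi h₃
      rw [he]
      exact grid_writes_output hω hn₁ hn₂ (by omega) hi hj
    · obtain ⟨k, hk, hk'⟩ := @hP (fs ++ [n₁ * n₂] ++ [n₁ * n₂]) h₁ h₂ (by simp) (by simp)
        (View.inj_of_rows rfl le_rfl) hPe
      obtain ⟨k', hl, hl'⟩ := @hQ (fs ++ [n₁ * n₂] ++ [n₁ * n₂]) h₁ h₂ (by simp) (by simp)
        (View.inj_of_rows rfl le_rfl) hQe
      refine ⟨k + k' + 0, (hk.append hl).append (needsWrites_zero _), ?_⟩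
      push_cast
      linarith
  · rintro fr X Y Z a b n₂ n₃ P Q ha hab hba hn₂ hn₃ _ hn hPe hQe hP hQ fs h₁ h₂ rfl hZ hZi he
    by_cases h₃ : (n₃ : ℝ) ≤ 8 * (q * s)
    · refine base h₁ h₂ (fun i hi j hj => ?_) hZ hZi h₃
      rw [he]
      exact grid_writes_output hω (by omega) hn₂ hn₃ hi hj
    · obtain ⟨ha', hb'⟩ := half hba hab hn h₃
      obtain ⟨k, hk, hk'⟩ := @hP fs ha' h₂ rfl hZ (hZi.mono (by omega) le_rfl) hPe
      obtain ⟨k', hl, hl'⟩ := @hQ fs hb' h₂ rfl hZ (hZi.sub le_rfl (by omega)) hQe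
      refine ⟨k + k', hk.append hl, ?_⟩
      push_cast
      linarith
  · rintro fr X Y Z n₁ a b n₃ P Q hn₁ ha hab hba hn₃ _ hn hPe hQe hP hQ fs h₁ h₂ rfl hZ hZi he
    by_cases h₃ : (n₃ : ℝ) ≤ 8 * (q * s)
    · refine base h₁ h₂ (fun i hi j hj => ?_) hZ hZi h₃
      rw [he]
      exact grid_writes_output hω hn₁ (by omega) hn₃ hi hj
    · obtain ⟨ha', hb'⟩ := half hba hab hn h₃
      obtain ⟨k, hk, hk'⟩ := @hP fs h₁ ha' rfl hZ (hZi.mono le_rfl (by omega)) hPe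
      obtain ⟨k', hl, hl'⟩ := @hQ fs h₁ hb' rfl hZ (hZi.sub (by omega) le_rfl) hQe
      refine ⟨k + k', hk.append hl, ?_⟩
      push_cast
      linarith

/-- The number of write transfers of Kleene's algorithm. -/
theorem kleene_writes {ω : ℝ} (hω : 1 ≤ ω) {M B n : ℕ} (hB : 0 < B) (hM : 0 < M) {r w : ℕ}
    (h : Transfers M B ∅ ∅ ((kleene ω n).trace [n * n]) r w) :
    (n : ℝ) ^ 3 ≤ 200 * ω ^ (2 / 3 : ℝ) * √(M : ℝ) * B * w := by
  have hs1 : 1 ≤ √(M : ℝ) := Real.one_le_sqrt.2 (by exact_mod_cast hM)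
  have hq : 1 ≤ ω ^ (2 / 3 : ℝ) := Real.one_le_rpow hω (by norm_num)
  have hinj : View.Inj ⟨0, 0, n, 1⟩ n n := View.inj_of_rows rfl le_rfl
  rcases Nat.eq_zero_or_pos n with rfl | hn
  · rw [Nat.cast_zero, zero_pow three_ne_zero]
    positivity
  -- For small `n` the size of the cache plays no role: all `n * n` words are written, every written
  -- line is written back at least once, and the third factor `n` is at most `8 √M`.
  by_cases hsmall : (n : ℝ) ≤ 8 * √(M : ℝ)
  · have h1 : (n * n : ℝ) ≤ B * w := by
      have := mul_le_card_dstLines hB (P := kleene ω n) (fs := [n * n]) (Z := ⟨0, 0, n, 1⟩)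
        (n₁ := n) (n₂ := n) (fun i hi j hj => kleeneRec_writes_output hi hj) (by simp) hinj
      exact_mod_cast this.trans (Nat.mul_le_mul_left B h.card_dstLines_le)
    calc (n : ℝ) ^ 3 = n * n * n := by ring
      _ ≤ (B * w) * (8 * √(M : ℝ)) := by gcongr
      _ = 8 * 1 * √(M : ℝ) * B * w := by ring
      _ ≤ 200 * ω ^ (2 / 3 : ℝ) * √(M : ℝ) * B * w := by gcongr; norm_num
  · suffices hk : ∀ fs : List ℕ, fs.length = 1 → ∃ k, NeedsWrites M B ((kleene ω n).trace fs) k ∧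
        (n : ℝ) ^ 3 ≤ 200 * ω ^ (2 / 3 : ℝ) * √(M : ℝ) * B * k by
      obtain ⟨k, hk, hk'⟩ := hk [n * n] rfl
      refine hk'.trans ?_
      gcongr
      exact hk.le h
    refine kleeneRec_rec (ω := ω) (motive := fun A n P => ¬ (n : ℝ) ≤ 8 * √(M : ℝ) → A.Inj n n →
      A.frame = 0 → ∀ fs : List ℕ, fs.length = 1 → ∃ k, NeedsWrites M B (P.trace fs) k ∧
      (n : ℝ) ^ 3 ≤ 200 * ω ^ (2 / 3 : ℝ) * √(M : ℝ) * B * k) ?_ ?_ ⟨0, 0, n, 1⟩ n hn hsmall hinj rfl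
    · intro A h
      refine absurd ?_ h
      push_cast
      linarith
    · intro A a b P Q ha hab hba _ _ _ _ hn hinj hA fs hfs
      have hab' : (a : ℝ) ≤ b := by exact_mod_cast hab
      have hba' : (b : ℝ) ≤ a + 1 := by exact_mod_cast hba
      have ha' : (1 : ℝ) ≤ a := by exact_mod_cast ha
      push_cast at hn ⊢
      have hb : 2 * √(M : ℝ) ≤ b := by linarith
      -- The product for the lower right quadrant at the top level has a constant fraction of the
      -- whole volume; everything else is counted as 0.
      obtain ⟨k, hk, hk'⟩ := grid_needsWrites hω (M := M) hB hM (fr := 3) (X := A.sub a 0)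
        (Y := ⟨1, 0, 1, a⟩) (Z := ⟨2, 0, b, 1⟩) (fs := fs ++ [a * b] ++ [b * b]) hb hb ha
        (by simp [hfs]) (by simp) (View.inj_of_rows rfl le_rfl)
      refine ⟨0 + (0 + ((0 + (k + 0)) + 0)), ?_, ?_⟩
      · exact (needsWrites_zero _).append ((needsWrites_zero _).append
          (((needsWrites_zero _).append (hk.append (needsWrites_zero _))).append
            (needsWrites_zero _)))
      · push_cast
        -- This needs `b ≤ a + 1`, and with the constant 16 it gives `12 * 16 ≤ 200`.
        have h3 : ((a : ℝ) + b) ^ 3 ≤ 12 * (b * b * a) := by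
          nlinarith [mul_nonneg (sub_nonneg.2 hab') (sub_nonneg.2 ha'), mul_nonneg (mul_nonneg (sub_nonneg.2 hab') (sub_nonneg.2 hab')) (sub_nonneg.2 ha')]
        calc ((a : ℝ) + b) ^ 3 ≤ 12 * (b * b * a) := h3
          _ ≤ 12 * (16 * ω ^ (2 / 3 : ℝ) * √(M : ℝ) * B * k) := by gcongr
          _ = 192 * (ω ^ (2 / 3 : ℝ) * √(M : ℝ) * B * k) := by ring
          _ ≤ 200 * (ω ^ (2 / 3 : ℝ) * √(M : ℝ) * B * k) := by gcongr; norm_num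
          _ = _ := by ring

/-! ### Serving accesses -/

/-- Clean lines left in the cache are dropped without a transfer; hence costs computed from an empty
cache can be concatenated. -/
theorem Transfers.of_empty {M B : ℕ} {t : List Step} {r w : ℕ} (h : Transfers M B ∅ ∅ t r w)
    (C : Finset ℕ) : Transfers M B C ∅ t r w := by
  induction C using Finset.induction_on with
  | empty => exact h
  | insert ℓ C hℓ ih =>
    refine .evictClean _ _ _ _ _ ℓ (Finset.mem_insert_self _ _) (Finset.notMem_empty _) ?_
    rwa [Finset.erase_insert hℓ]

theorem Transfers.append {M B : ℕ} {C D : Finset ℕ} {t₁ t₂ : List Step} {r₁ w₁ r₂ w₂ : ℕ}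
    (h₁ : Transfers M B C D t₁ r₁ w₁) (h₂ : Transfers M B ∅ ∅ t₂ r₂ w₂) :
    Transfers M B C D (t₁ ++ t₂) (r₁ + r₂) (w₁ + w₂) := by
  induction h₁ with
  | done C => simpa using h₂.of_empty C
  | load C D t r w ℓ hℓ hM h ih =>
    rw [add_right_comm]
    exact .load _ _ _ _ _ ℓ hℓ hM ih
  | evictClean C D t r w ℓ hℓ hℓD h ih => exact .evictClean _ _ _ _ _ ℓ hℓ hℓD ih
  | evictDirty C D t r w ℓ hℓ hℓD h ih =>
    rw [add_right_comm w]
    exact .evictDirty _ _ _ _ _ ℓ hℓ hℓD ih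
  | exec C D s t r w hsrc hdst h ih => exact .exec _ _ _ _ _ _ hsrc hdst ih

/-- A line that is in fact unmodified is evicted for free where a write-back was planned. -/
theorem Transfers.mono_dirty {M B : ℕ} {C D D' : Finset ℕ} {t : List Step} {r w : ℕ}
    (h : Transfers M B C D t r w) (hD : D' ⊆ D) : ∃ w' ≤ w, Transfers M B C D' t r w' := by
  induction h generalizing D' with
  | done C =>
    rw [Finset.subset_empty.1 hD]
    exact ⟨0, le_rfl, .done C⟩
  | load C D t r w ℓ hℓ hM h ih =>
    obtain ⟨w', hw, h'⟩ := ih hD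
    exact ⟨w', hw, .load _ _ _ _ _ ℓ hℓ hM h'⟩
  | evictClean C D t r w ℓ hℓ hℓD h ih =>
    obtain ⟨w', hw, h'⟩ := ih hD
    exact ⟨w', hw, .evictClean _ _ _ _ _ ℓ hℓ (fun h => hℓD (hD h)) h'⟩
  | evictDirty C D t r w ℓ hℓ hℓD h ih =>
    obtain ⟨w', hw, h'⟩ := ih (Finset.erase_subset_erase ℓ hD)
    by_cases hl : ℓ ∈ D'
    · exact ⟨w' + 1, by omega, .evictDirty _ _ _ _ _ ℓ hℓ hl h'⟩
    · rw [Finset.erase_eq_of_notMem hl] at h'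
      exact ⟨w', by omega, .evictClean _ _ _ _ _ ℓ hℓ hl h'⟩
  | exec C D s t r w hsrc hdst h ih =>
    obtain ⟨w', hw, h'⟩ := ih (Finset.insert_subset_insert _ hD)
    exact ⟨w', hw, .exec _ _ _ _ _ _ hsrc hdst h'⟩

theorem Transfers.loads {M B : ℕ} {C D F : Finset ℕ} {t : List Step} {r w : ℕ}
    (h : Transfers M B (F ∪ C) D t r w) (hF : Disjoint F C) (hM : (F ∪ C).card * B ≤ M) :
    Transfers M B C D t (r + F.card) w := by
  induction F using Finset.induction_on generalizing r with
  | empty => simpa using h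
  | insert ℓ F hℓ ih =>
    rw [Finset.disjoint_insert_left] at hF
    have hℓ' : ℓ ∉ F ∪ C := by simp [hℓ, hF.1]
    rw [Finset.insert_union] at h hM
    rw [Finset.card_insert_of_notMem hℓ'] at hM
    rw [Finset.card_insert_of_notMem hℓ, show r + (F.card + 1) = r + 1 + F.card by omega]
    refine ih (.load _ _ _ _ _ ℓ hℓ' hM h) hF.2 (le_trans ?_ hM)
    gcongr
    omega

theorem Transfers.evicts {M B : ℕ} {C D F : Finset ℕ} {t : List Step} {r w : ℕ}
    (h : Transfers M B C D t r w) (hF : Disjoint F C) (hFD : Disjoint F D) :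
    Transfers M B (F ∪ C) D t r w := by
  induction F using Finset.induction_on with
  | empty => simpa using h
  | insert ℓ F hℓ ih =>
    rw [Finset.disjoint_insert_left] at hF hFD
    have hℓ' : ℓ ∉ F ∪ C := by simp [hℓ, hF.1]
    rw [Finset.insert_union]
    refine .evictClean _ _ _ _ _ ℓ (Finset.mem_insert_self _ _) hFD.1 ?_
    rw [Finset.erase_insert hℓ']
    exact ih hF.2 hFD.2

theorem transfers_writeBack {M B : ℕ} (P : Finset ℕ) : Transfers M B P P [] 0 P.card := by
  induction P using Finset.induction_on with
  | empty => exact .done _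
  | insert ℓ P hℓ ih =>
    rw [Finset.card_insert_of_notMem hℓ]
    refine .evictDirty _ _ _ _ _ ℓ (Finset.mem_insert_self _ _) (Finset.mem_insert_self _ _) ?_
    rwa [Finset.erase_insert hℓ]

theorem Transfers.execs {M B : ℕ} {C D : Finset ℕ} {t t' : List Step} {r w : ℕ}
    (h : Transfers M B C D t' r w) (hD : D ⊆ C)
    (ht : ∀ s ∈ t, (∀ a ∈ s.srcs, a / B ∈ C) ∧ s.dst / B ∈ D) :
    Transfers M B C D (t ++ t') r w := by
  induction t with
  | nil => exact h
  | cons s t ih =>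
    have hs := ht s List.mem_cons_self
    refine .exec _ _ _ _ _ _ hs.1 (hD hs.2) ?_
    rw [Finset.insert_eq_of_mem hs.2]
    exact ih fun s hs => ht s (List.mem_cons_of_mem _ hs)

/-- While the lines in `P` stay in the cache, the accesses `t` can be served with at most `R` read
transfers and without write transfers. -/
def Pinned (M B : ℕ) (P : Finset ℕ) (t : List Step) (R : ℝ) : Prop :=
  ∀ t' r w, Transfers M B P P t' r w → ∃ r' : ℕ, (r' : ℝ) ≤ r + R ∧ Transfers M B P P (t ++ t') r' w

/-- Between parts the cache always consists of `P`, all of it counted as modified, so that parts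
compose without adjustment. -/
theorem Pinned.append {M B : ℕ} {P : Finset ℕ} {t₁ t₂ : List Step} {R₁ R₂ : ℝ}
    (h₁ : Pinned M B P t₁ R₁) (h₂ : Pinned M B P t₂ R₂) : Pinned M B P (t₁ ++ t₂) (R₁ + R₂) := by
  intro t' r w h
  obtain ⟨r', hr', h'⟩ := h₂ t' r w h
  obtain ⟨r'', hr'', h''⟩ := h₁ _ r' w h'
  refine ⟨r'', by linarith, ?_⟩
  rwa [List.append_assoc]

theorem Pinned.mono {M B : ℕ} {P : Finset ℕ} {t : List Step} {R R' : ℝ}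
    (h : Pinned M B P t R) (hR : R ≤ R') : Pinned M B P t R' := by
  intro t' r w ht
  obtain ⟨r', hr', h'⟩ := h t' r w ht
  exact ⟨r', by linarith, h'⟩

/-- The missing lines are loaded, all instructions executed, and the extra lines evicted: they are
clean, since only pinned lines are written. -/
theorem pinned_of_card_le {M B : ℕ} {P F : Finset ℕ} {t : List Step}
    (ht : ∀ s ∈ t, (∀ a ∈ s.srcs, a / B ∈ P ∪ F) ∧ s.dst / B ∈ P)
    (hM : (P.card + F.card) * B ≤ M) : Pinned M B P t F.card := by
  intro t' r w h
  refine ⟨r + (F \ P).card, ?_, ?_⟩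
  · push_cast
    gcongr
    exact Finset.sdiff_subset
  · have e : F \ P ∪ P = P ∪ F := by rw [Finset.sdiff_union_self_eq_union, Finset.union_comm]
    refine Transfers.loads ?_ Finset.sdiff_disjoint ?_
    · refine Transfers.execs (h.evicts Finset.sdiff_disjoint Finset.sdiff_disjoint)
        Finset.subset_union_right ?_
      rwa [e]
    · rw [e]
      exact (Nat.mul_le_mul_right B (Finset.card_union_le _ _)).trans hM

/-- The accesses `t` can be served, from an empty cache and with all modified lines written back,
at cost at most `c`. -/
def CostLE (ω : ℝ) (M B : ℕ) (t : List Step) (c : ℝ) : Prop :=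
  ∃ r w : ℕ, Transfers M B ∅ ∅ t r w ∧ r + ω * w ≤ c

theorem CostLE.append {ω : ℝ} {M B : ℕ} {t₁ t₂ : List Step} {c₁ c₂ : ℝ}
    (h₁ : CostLE ω M B t₁ c₁) (h₂ : CostLE ω M B t₂ c₂) : CostLE ω M B (t₁ ++ t₂) (c₁ + c₂) := by
  obtain ⟨r₁, w₁, h₁, h₁'⟩ := h₁
  obtain ⟨r₂, w₂, h₂, h₂'⟩ := h₂
  refine ⟨_, _, h₁.append h₂, ?_⟩
  push_cast
  linarith

theorem CostLE.mono {ω : ℝ} {M B : ℕ} {t : List Step} {c c' : ℝ} (h : CostLE ω M B t c)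
    (hc : c ≤ c') : CostLE ω M B t c' := by
  obtain ⟨r, w, h, h'⟩ := h
  exact ⟨r, w, h, h'.trans hc⟩

/-- Each pinned line is loaded once and written back at most once. The accesses start with no
modified lines, whence the passage through `mono_dirty`. -/
theorem Pinned.costLE {ω : ℝ} (hω : 1 ≤ ω) {M B : ℕ} {P : Finset ℕ} {t : List Step} {R : ℝ}
    (h : Pinned M B P t R) (hM : P.card * B ≤ M) : CostLE ω M B t ((1 + ω) * P.card + R) := by
  obtain ⟨r, hr, h'⟩ := h [] 0 _ (transfers_writeBack P)
  rw [List.append_nil] at h'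
  obtain ⟨w, hw, h''⟩ := h'.mono_dirty (Finset.empty_subset _)
  refine ⟨_, _, Transfers.loads (F := P) (C := ∅) (by simpa using h'') (by simp) (by simpa using hM), ?_⟩
  have hw' : (w : ℝ) ≤ P.card := by exact_mod_cast hw
  have : ω * w ≤ ω * P.card := by gcongr
  push_cast
  push_cast at hr
  linarith

theorem costLE_of_card_le {ω : ℝ} (hω : 1 ≤ ω) {M B : ℕ} {F : Finset ℕ} {t : List Step}
    (ht : ∀ s ∈ t, (∀ a ∈ s.srcs, a / B ∈ F) ∧ s.dst / B ∈ F) (hM : F.card * B ≤ M) :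
    CostLE ω M B t ((1 + ω) * F.card) := by
  have := (pinned_of_card_le (P := F) (F := ∅) (t := t) (by simpa using ht) (by simpa using hM)).costLE
    hω hM
  simpa using this

theorem costLE_nil (ω : ℝ) (M B : ℕ) : CostLE ω M B [] 0 :=
  ⟨0, 0, .done _, by simp⟩

/-- The crude strategy for caches of bounded size: an instruction touches at most three lines, which
are loaded for it and dropped again. -/
theorem costLE_length {ω : ℝ} (hω : 1 ≤ ω) {M B : ℕ} (hM : 3 * B ≤ M) {t : List Step}
    (ht : ∀ s ∈ t, s.srcs.length ≤ 2) : CostLE ω M B t ((1 + ω) * 3 * t.length) := by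
  induction t with
  | nil => simpa using costLE_nil ω M B
  | cons s t ih =>
    set F := (s.srcs.map (· / B)).toFinset ∪ {s.dst / B} with hF
    have hcard : F.card ≤ 3 := by
      refine (Finset.card_union_le _ _).trans ?_
      have := List.toFinset_card_le (s.srcs.map (· / B))
      rw [List.length_map] at this
      have := ht s List.mem_cons_self
      rw [Finset.card_singleton]
      omega
    have h1 : CostLE ω M B [s] ((1 + ω) * F.card) := by
      refine costLE_of_card_le hω ?_ ((Nat.mul_le_mul_right B hcard).trans hM)
      intro s' hs'
      obtain rfl : s' = s := by simpa using hs'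
      refine ⟨fun a ha => ?_, ?_⟩
      · exact Finset.mem_union_left _ (List.mem_toFinset.2 (List.mem_map.2 ⟨a, ha, rfl⟩))
      · exact Finset.mem_union_right _ (Finset.mem_singleton_self _)
    have h2 := h1.append (ih fun s hs => ht s (List.mem_cons_of_mem _ hs))
    refine h2.mono ?_
    have : (F.card : ℝ) ≤ 3 := by exact_mod_cast hcard
    push_cast [List.length_cons]
    nlinarith

theorem cacheCost_le {ω : ℝ} (hω : 1 ≤ ω) {M B : ℕ} {t : List Step} {c : ℝ}
    (h : CostLE ω M B t c) : cacheCost ω M B t ≤ ENNReal.ofReal c := by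
  obtain ⟨r, w, h, hc⟩ := h
  refine (iInf_le_of_le r (iInf_le_of_le w (iInf_le _ h))).trans ?_
  rw [← ENNReal.ofReal_natCast r, ← ENNReal.ofReal_natCast w, ← ENNReal.ofReal_mul (by linarith),
    ← ENNReal.ofReal_add (by positivity) (by positivity)]
  exact ENNReal.ofReal_le_ofReal hc

/-- Reads are discarded: the lower bound comes from write transfers alone, for `ω = 1` as well. -/
theorem le_cacheCost {ω : ℝ} (hω : 1 ≤ ω) {M B : ℕ} {t : List Step} {c : ℝ}
    (h : ∀ r w, Transfers M B ∅ ∅ t r w → c ≤ ω * w) : ENNReal.ofReal c ≤ cacheCost ω M B t := by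
  refine le_iInf fun r => le_iInf fun w => le_iInf fun ht => ?_
  rw [← ENNReal.ofReal_natCast r, ← ENNReal.ofReal_natCast w, ← ENNReal.ofReal_mul (by linarith),
    ← ENNReal.ofReal_add (by positivity) (by positivity)]
  refine ENNReal.ofReal_le_ofReal ?_
  have := h r w ht
  have : (0 : ℝ) ≤ r := by positivity
  linarith

/-! ### Counting lines -/

/-- The lines that contain the words at addresses `a`, …, `a + m`. -/
def intervalLines (B a m : ℕ) : Finset ℕ := Finset.Icc (a / B) ((a + m) / B)

theorem mem_intervalLines {B a m x : ℕ} (h : a ≤ x) (h' : x ≤ a + m) : x / B ∈ intervalLines B a m :=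
  Finset.mem_Icc.2 ⟨Nat.div_le_div_right h, Nat.div_le_div_right h'⟩

/-- The `2 * B` accounts for the partially used lines at the two ends. -/
theorem card_intervalLines {B : ℕ} (hB : 0 < B) (a m : ℕ) :
    (intervalLines B a m).card * B ≤ m + 2 * B := by
  rw [intervalLines, Nat.card_Icc, Nat.sub_mul, add_mul]
  have := Nat.div_mul_le_self (a + m) B
  have := Nat.div_add_mod a B
  have := Nat.mod_lt a hB
  rw [mul_comm (a / B)]
  omega

/-- Lines that contain the upper left `n₁ × n₂` part of an array stored by rows. -/
def viewLines (B : ℕ) (fs : List ℕ) (Z : View) (n₁ n₂ : ℕ) : Finset ℕ :=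
  (Finset.range n₁).biUnion fun i => intervalLines B ((Z.at i 0).addr fs) n₂

theorem mem_viewLines {B : ℕ} {fs : List ℕ} {Z : View} {n₁ n₂ i j : ℕ} (hZ : Z.colStride = 1)
    (hi : i < n₁) (hj : j < n₂) : (Z.at i j).addr fs / B ∈ viewLines B fs Z n₁ n₂ := by
  refine Finset.mem_biUnion.2 ⟨i, Finset.mem_range.2 hi, mem_intervalLines ?_ ?_⟩ <;>
  · simp only [Loc.addr, View.at, hZ]
    omega

theorem card_viewLines {B : ℕ} (hB : 0 < B) (fs : List ℕ) (Z : View) (n₁ n₂ : ℕ) :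
    (viewLines B fs Z n₁ n₂).card * B ≤ n₁ * (n₂ + 2 * B) := by
  have h : (viewLines B fs Z n₁ n₂).card ≤
      ∑ i ∈ Finset.range n₁, (intervalLines B ((Z.at i 0).addr fs) n₂).card :=
    Finset.card_biUnion_le
  refine (Nat.mul_le_mul_right B h).trans ?_
  rw [Finset.sum_mul]
  refine (Finset.sum_le_sum fun i _ => card_intervalLines hB _ _).trans ?_
  simp

/-- The transposed array. -/
def View.transpose (X : View) : View := ⟨X.frame, X.offset, X.colStride, X.rowStride⟩

theorem View.transpose_at (X : View) (i j : ℕ) : X.transpose.at i j = X.at j i := by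
  simp only [View.transpose, View.at, Loc.mk.injEq, true_and]
  ring

/-! ### Lengths of access sequences, stack space -/

theorem Prog.length_trace_le (P : Prog) (fs : List ℕ) : (P.trace fs).length ≤ P.work := by
  induction P generalizing fs with
  | skip => simp [Prog.trace]
  | op c => simp [Prog.trace, Prog.work]
  | seq P Q hP hQ =>
    have := hP fs
    have := hQ fs
    simp only [Prog.trace, Prog.work, List.length_append]
    omega
  | par P Q hP hQ =>
    have := hP fs
    have := hQ fs
    simp only [Prog.trace, Prog.work, List.length_append]
    omega
  | alloc m P hP =>
    have := hP (fs ++ [m])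
    simp only [Prog.trace, Prog.work]
    omega

theorem Prog.length_srcs_le {P : Prog} {fs : List ℕ} {s : Step} (hs : s ∈ P.trace fs) :
    s.srcs.length ≤ 2 := by
  induction P generalizing fs with
  | skip => simp [Prog.trace] at hs
  | op c =>
    simp only [Prog.trace, List.mem_singleton] at hs
    subst hs
    cases c <;> simp [Instr.srcs]
  | seq P Q hP hQ => exact (List.mem_append.1 hs).elim hP hQ
  | par P Q hP hQ => exact (List.mem_append.1 hs).elim hP hQ
  | alloc m P hP => exact hP hs

theorem parFor_depth (f : ℕ → ℕ → Instr) {i j m₁ m₂ : ℕ} (h₁ : 0 < m₁) (h₂ : 0 < m₂) :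
    (parFor f i j m₁ m₂).depth = 0 := by
  refine parFor_rec (f := f) (motive := fun i j m₁ m₂ P => P.depth = 0)
    ?_ ?_ ?_ i j m₁ m₂ h₁ h₂
  · intro i j
    rfl
  · intro i j a b m P Q _ _ _ _ _ _ _ hP hQ
    simp [Prog.depth, hP, hQ]
  · intro i j m a b P Q _ _ _ _ _ _ _ hP hQ
    simp [Prog.depth, hP, hQ]

/-- Along a branch the allocations form a geometric series. Unless the output is a single cell, the
third range is halved only if `q * n₂ < n₃`, so that `q` times the `2 * (n₁ * n₂)` words of a level
is at most `2 * (n₁ * n₃)`, which roughly halves with `n₃`. For a single output cell every halving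
takes two words; this is the logarithmic term. -/
theorem grid_depth {ω : ℝ} (hω : 1 ≤ ω) (fr : ℕ) (X Y Z : View) {n₁ n₂ n₃ : ℕ}
    (h₁ : 0 < n₁) (h₂ : 0 < n₂) (h₃ : 0 < n₃) :
    ω ^ (2 / 3 : ℝ) * ((grid ω fr X Y Z n₁ n₂ n₃).depth : ℝ) ≤
      8 * (n₁ * n₃) + 2 * ω ^ (2 / 3 : ℝ) * Nat.clog 2 n₃ := by
  have hq : 1 ≤ ω ^ (2 / 3 : ℝ) := Real.one_le_rpow hω (by norm_num)
  set q := ω ^ (2 / 3 : ℝ)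
  refine grid_rec hω (motive := fun fr X Y Z n₁ n₂ n₃ P =>
    q * (P.depth : ℝ) ≤ 8 * (n₁ * n₃) + 2 * q * Nat.clog 2 n₃)
    ?_ ?_ ?_ ?_ fr X Y Z n₁ n₂ n₃ h₁ h₂ h₃
  · intro fr X Y Z
    simp [Prog.depth]
  · intro fr X Y Z n₁ n₂ a b P Q h₁ h₂ ha hab hba hn _ _ hP hQ
    have hab' : (a : ℝ) ≤ b := by exact_mod_cast hab
    have hba' : (b : ℝ) ≤ a + 1 := by exact_mod_cast hba
    have ha' : (1 : ℝ) ≤ a := by exact_mod_cast ha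
    have hn₁ : (1 : ℝ) ≤ n₁ := by exact_mod_cast h₁
    have hc : (Nat.clog 2 a : ℝ) ≤ Nat.clog 2 b := by exact_mod_cast Nat.clog_mono_right 2 hab
    have hmax : q * ((max P.depth Q.depth : ℕ) : ℝ) ≤ 8 * (n₁ * b) + 2 * q * Nat.clog 2 b := by
      have hP' : q * (P.depth : ℝ) ≤ 8 * (n₁ * b) + 2 * q * Nat.clog 2 b := by
        refine hP.trans ?_
        gcongr
      rcases max_choice P.depth Q.depth with h | h <;> rw [h]
      · exact hP'
      · exact hQ
    have hd : (addTemps fr Z n₁ n₂).depth = 0 := parFor_depth _ h₁ h₂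
    simp only [Prog.depth, clog_halves ha hab hba, hd, Nat.max_zero]
    rw [Nat.cast_max] at hmax
    push_cast
    rcases hn with ⟨rfl, rfl⟩ | hn
    · push_cast at *
      nlinarith
    · have hn2 : q * n₂ ≤ a + b := by
        have h : (n₂ : ℝ) ≤ (max n₁ n₂ : ℕ) := by exact_mod_cast le_max_right _ _
        have : q * n₂ ≤ q * (max n₁ n₂ : ℕ) := by gcongr
        push_cast at this hn
        linarith
      have : n₁ * (q * n₂) ≤ n₁ * (3 * a : ℝ) :=
        mul_le_mul_of_nonneg_left (by linarith) (by positivity)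
      have h1 : (1 : ℝ) ≤ n₁ := hn₁
      have h2 : q * max (P.depth : ℝ) (Q.depth : ℝ) ≤ 8 * (n₁ * b) + 2 * q * Nat.clog 2 b := hmax
      have : (n₁ * 1 : ℝ) ≤ n₁ * a := by gcongr
      linarith
  · intro fr X Y Z a b n₂ n₃ P Q _ hab _ _ _ _ _ _ _ hP hQ
    have hab' : (a : ℝ) ≤ b := by exact_mod_cast hab
    have h1 : (a * n₃ : ℝ) ≤ (a + b : ℕ) * n₃ := by push_cast; gcongr; linarith [a.cast_nonneg (α := ℝ)]
    have h2 : (b * n₃ : ℝ) ≤ (a + b : ℕ) * n₃ := by push_cast; gcongr; linarith [a.cast_nonneg (α := ℝ)]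
    simp only [Prog.depth]
    rcases max_choice P.depth Q.depth with h | h <;> rw [h] <;> linarith
  · intro fr X Y Z n₁ a b n₃ P Q _ _ _ _ _ _ _ _ _ hP hQ
    simp only [Prog.depth]
    rcases max_choice P.depth Q.depth with h | h <;> rw [h] <;> assumption

/-- The logarithm is at most `b`, so the grid computation takes `8 + 2` times `b ^ 2`, and the copy
and the output array once each. -/
theorem mulAdd_depth {ω : ℝ} (hω : 1 ≤ ω) (fr : ℕ) (Z X Y : View) {m₁ m₂ m₃ b : ℕ}
    (h₁ : 0 < m₁) (h₂ : 0 < m₂) (h₃ : 0 < m₃) (hm₁ : m₁ ≤ b) (hm₂ : m₂ ≤ b) (hm₃ : m₃ ≤ b) :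
    (mulAdd ω fr Z X Y m₁ m₂ m₃).depth ≤ 12 * b ^ 2 := by
  have hq : 1 ≤ ω ^ (2 / 3 : ℝ) := Real.one_le_rpow hω (by norm_num)
  have hg := grid_depth hω (fr + 2) X ⟨fr, 0, 1, m₃⟩ ⟨fr + 1, 0, m₂, 1⟩ h₁ h₂ h₃
  have hc : (copyCols fr Y m₃ m₂).depth = 0 := parFor_depth _ h₃ h₂
  have ha : (addTo (fr + 1) Z m₁ m₂).depth = 0 := parFor_depth _ h₁ h₂
  have hl : Nat.clog 2 m₃ ≤ b := by
    refine (Nat.clog_le_of_le_pow ?_).trans hm₃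
    exact (Nat.lt_two_pow_self).le
  set d := (grid ω (fr + 2) X ⟨fr, 0, 1, m₃⟩ ⟨fr + 1, 0, m₂, 1⟩ m₁ m₂ m₃).depth
  have hd : (d : ℝ) ≤ 8 * (m₁ * m₃) + 2 * Nat.clog 2 m₃ := by
    have h8 : (8 * (m₁ * m₃) : ℝ) ≤ ω ^ (2 / 3 : ℝ) * (8 * (m₁ * m₃)) :=
      le_mul_of_one_le_left (by positivity) hq
    have : ω ^ (2 / 3 : ℝ) * (d : ℝ) ≤
        ω ^ (2 / 3 : ℝ) * (8 * (m₁ * m₃) + 2 * Nat.clog 2 m₃) := by linarith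
    exact le_of_mul_le_mul_left this (by linarith)
  have hd' : d ≤ 8 * (m₁ * m₃) + 2 * Nat.clog 2 m₃ := by exact_mod_cast hd
  have e1 := Nat.mul_le_mul hm₁ hm₃
  have e2 := Nat.mul_le_mul hm₃ hm₂
  have e3 := Nat.mul_le_mul hm₁ hm₂
  have e4 : b ≤ b * b := Nat.le_mul_of_pos_left _ (by omega)
  rw [mulAdd_eq]
  simp only [Prog.depth, hc, ha, Nat.max_zero, Nat.zero_max, pow_two]
  omega

theorem kleeneRec_depth {ω : ℝ} (hω : 1 ≤ ω) (A : View) {n : ℕ} (hn : 0 < n) :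
    (kleeneRec ω A n).depth ≤ 12 * n ^ 2 := by
  refine kleeneRec_rec (motive := fun A n P => P.depth ≤ 12 * n ^ 2) ?_ ?_ A n hn
  · intro A
    simp [Prog.depth]
  · intro A a b P Q ha hab hba _ _ hP hQ
    have hb : 0 < b := by omega
    have hb' : b ^ 2 ≤ (a + b) ^ 2 := Nat.pow_le_pow_left (by omega) 2
    have ha' : a ^ 2 ≤ (a + b) ^ 2 := Nat.pow_le_pow_left (by omega) 2
    have h1 := mulAdd_depth hω 1 (A.sub 0 a) (A.sub 0 0) (A.sub 0 a) ha hb ha hab le_rfl hab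
    have h2 := mulAdd_depth hω 1 (A.sub a 0) (A.sub a 0) (A.sub 0 0) hb ha ha le_rfl hab hab
    have h3 := mulAdd_depth hω 1 (A.sub a a) (A.sub a 0) (A.sub 0 a) hb hb ha le_rfl le_rfl hab
    have h4 := mulAdd_depth hω 1 (A.sub 0 a) (A.sub 0 a) (A.sub a a) ha hb hb hab le_rfl le_rfl
    have h5 := mulAdd_depth hω 1 (A.sub a 0) (A.sub a a) (A.sub a 0) hb ha hb le_rfl hab le_rfl
    have h6 := mulAdd_depth hω 1 (A.sub 0 0) (A.sub 0 a) (A.sub a 0) ha ha hb hab hab le_rfl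
    simp only [kleeneStep, Prog.depth, max_le_iff]
    refine ⟨?_, ⟨?_, ?_⟩, ?_, ?_, ⟨?_, ?_⟩, ?_⟩ <;> linarith

/-! ### Shapes of subproblems -/

/-- Invariant of the sizes of the subproblems in a grid computation, for `q = ω ^ (2 / 3)`. -/
structure GridShape (q : ℝ) (n₁ n₂ n₃ : ℕ) : Prop where
  pos₁ : 0 < n₁
  pos₂ : 0 < n₂
  pos₃ : 0 < n₃
  le₁₂ : n₁ ≤ 3 * n₂
  le₂₁ : n₂ ≤ 3 * n₁
  le₁₃ : n₁ ≤ 2 * n₃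
  le₂₃ : n₂ ≤ 2 * n₃
  le₃ : (n₃ : ℝ) ≤ 3 * q * n₁ ∨ (n₃ : ℝ) ≤ 3 * q * n₂

namespace GridShape

variable {q : ℝ} {n₁ n₂ n₃ a b : ℕ}

/-- Since `n₁` and `n₂` are comparable, either alternative of `le₃` bounds the third side by both of
them, with a loss of a factor 3. The recursion carries the disjunction because it is preserved
without loss. -/
theorem le₃₁ (h : GridShape q n₁ n₂ n₃) (hq : 0 ≤ q) : (n₃ : ℝ) ≤ 9 * q * n₁ := by
  have h2 : (n₂ : ℝ) ≤ 3 * n₁ := by exact_mod_cast h.le₂₁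
  rcases h.le₃ with h3 | h3
  · have : 0 ≤ q * n₁ := by positivity
    linarith
  · have : q * n₂ ≤ q * (3 * n₁) := by gcongr
    linarith

theorem le₃₂ (h : GridShape q n₁ n₂ n₃) (hq : 0 ≤ q) : (n₃ : ℝ) ≤ 9 * q * n₂ := by
  have h2 : (n₁ : ℝ) ≤ 3 * n₂ := by exact_mod_cast h.le₁₂
  rcases h.le₃ with h3 | h3
  · have : q * n₁ ≤ q * (3 * n₂) := by gcongr
    linarith
  · have : 0 ≤ q * n₂ := by positivity
    linarith

/-- The halved side dominates the other two after scaling, and each half is at least a third of it.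
-/
theorem row (h : GridShape q (a + b) n₂ n₃) (hq : 0 ≤ q) (ha : 0 < a) (hab : a ≤ b)
    (hba : b ≤ a + 1) (h₂ : n₂ ≤ a + b) (h₃ : (n₃ : ℝ) ≤ q * (a + b : ℕ)) :
    GridShape q a n₂ n₃ ∧ GridShape q b n₂ n₃ := by
  have h12 := h.le₁₂
  have h13 := h.le₁₃
  have ha3 : ((a + b : ℕ) : ℝ) ≤ 3 * a := by exact_mod_cast show a + b ≤ 3 * a by omega
  have hb3 : ((a + b : ℕ) : ℝ) ≤ 3 * b := by exact_mod_cast show a + b ≤ 3 * b by omega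
  refine ⟨⟨ha, h.pos₂, h.pos₃, by omega, by omega, by omega, h.le₂₃, .inl ?_⟩,
    ⟨by omega, h.pos₂, h.pos₃, by omega, by omega, by omega, h.le₂₃, .inl ?_⟩⟩
  · have : q * (a + b : ℕ) ≤ q * (3 * a) := by gcongr
    linarith
  · have : q * (a + b : ℕ) ≤ q * (3 * b) := by gcongr
    linarith

theorem col (h : GridShape q n₁ (a + b) n₃) (hq : 0 ≤ q) (ha : 0 < a) (hab : a ≤ b)
    (hba : b ≤ a + 1) (h₁ : n₁ ≤ a + b) (h₃ : (n₃ : ℝ) ≤ q * (a + b : ℕ)) :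
    GridShape q n₁ a n₃ ∧ GridShape q n₁ b n₃ := by
  have h21 := h.le₂₁
  have h23 := h.le₂₃
  have ha3 : ((a + b : ℕ) : ℝ) ≤ 3 * a := by exact_mod_cast show a + b ≤ 3 * a by omega
  have hb3 : ((a + b : ℕ) : ℝ) ≤ 3 * b := by exact_mod_cast show a + b ≤ 3 * b by omega
  refine ⟨⟨h.pos₁, ha, h.pos₃, by omega, by omega, h.le₁₃, by omega, .inr ?_⟩,
    ⟨h.pos₁, by omega, h.pos₃, by omega, by omega, h.le₁₃, by omega, .inr ?_⟩⟩
  · have : q * (a + b : ℕ) ≤ q * (3 * a) := by gcongr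
    linarith
  · have : q * (a + b : ℕ) ≤ q * (3 * b) := by gcongr
    linarith

/-- The third side is halved only if it exceeds both output sides, or if these are 1, so that a half
of it is still at least half of each. -/
theorem inner (h : GridShape q n₁ n₂ (a + b)) (hq : 1 ≤ q) (ha : 0 < a) (hab : a ≤ b)
    (hba : b ≤ a + 1)
    (hn : (n₁ = 1 ∧ n₂ = 1) ∨ q * (max n₁ n₂ : ℕ) < (a + b : ℕ)) :
    GridShape q n₁ n₂ a ∧ GridShape q n₁ n₂ b := by
  have h1 : n₁ ≤ 2 * a ∧ n₂ ≤ 2 * a := by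
    rcases hn with ⟨rfl, rfl⟩ | hn
    · omega
    · have : ((max n₁ n₂ : ℕ) : ℝ) ≤ q * (max n₁ n₂ : ℕ) := le_mul_of_one_le_left (by positivity) hq
      have : max n₁ n₂ < a + b := by exact_mod_cast this.trans_lt hn
      omega
  have h3 := h.le₃
  push_cast at h3
  have ha' : (0 : ℝ) ≤ a := by positivity
  have hb' : (0 : ℝ) ≤ b := by positivity
  exact ⟨⟨h.pos₁, h.pos₂, ha, h.le₁₂, h.le₂₁, h1.1, h1.2,
      h3.imp (fun h => by linarith) fun h => by linarith⟩,
    ⟨h.pos₁, h.pos₂, by omega, h.le₁₂, h.le₂₁, by omega, by omega,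
      h3.imp (fun h => by linarith) fun h => by linarith⟩⟩

end GridShape

/-- The arrays of a grid computation, started while the arrays of sizes `fs` are live: the left
factor and the output are stored by rows, the right factor by columns. -/
structure GridArrays (fs : List ℕ) (X Y Z : View) (n₁ n₂ n₃ : ℕ) : Prop where
  liveX : X.LiveIn fs n₁ n₃
  liveY : Y.LiveIn fs n₃ n₂
  liveZ : Z.LiveIn fs n₁ n₂
  frameX : X.frame ≠ Z.frame
  frameY : Y.frame ≠ Z.frame
  inj : Z.Inj n₁ n₂
  rowsX : X.colStride = 1
  colsY : Y.rowStride = 1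
  rowsZ : Z.colStride = 1

namespace GridArrays

variable {fs : List ℕ} {X Y Z : View} {n₁ n₂ n₃ a b : ℕ}

theorem row_left (h : GridArrays fs X Y Z (a + b) n₂ n₃) : GridArrays fs X Y Z a n₂ n₃ :=
  ⟨h.liveX.mono (by omega) le_rfl, h.liveY, h.liveZ.mono (by omega) le_rfl, h.frameX, h.frameY,
    h.inj.mono (by omega) le_rfl, h.rowsX, h.colsY, h.rowsZ⟩

theorem row_right (h : GridArrays fs X Y Z (a + b) n₂ n₃) :
    GridArrays fs (X.sub a 0) Y (Z.sub a 0) b n₂ n₃ :=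
  ⟨h.liveX.sub le_rfl (by omega), h.liveY, h.liveZ.sub le_rfl (by omega), h.frameX, h.frameY,
    h.inj.sub le_rfl (by omega), h.rowsX, h.colsY, h.rowsZ⟩

theorem col_left (h : GridArrays fs X Y Z n₁ (a + b) n₃) : GridArrays fs X Y Z n₁ a n₃ :=
  ⟨h.liveX, h.liveY.mono le_rfl (by omega), h.liveZ.mono le_rfl (by omega), h.frameX, h.frameY,
    h.inj.mono le_rfl (by omega), h.rowsX, h.colsY, h.rowsZ⟩

theorem col_right (h : GridArrays fs X Y Z n₁ (a + b) n₃) :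
    GridArrays fs X (Y.sub 0 a) (Z.sub 0 a) n₁ b n₃ :=
  ⟨h.liveX, h.liveY.sub (by omega) le_rfl, h.liveZ.sub (by omega) le_rfl, h.frameX, h.frameY,
    h.inj.sub (by omega) le_rfl, h.rowsX, h.colsY, h.rowsZ⟩

theorem inner_left (h : GridArrays fs X Y Z n₁ n₂ (a + b)) (hX : X.frame < fs.length)
    (hY : Y.frame < fs.length) : GridArrays (fs ++ [n₁ * n₂] ++ [n₁ * n₂]) X Y
      ⟨fs.length, 0, n₂, 1⟩ n₁ n₂ a :=
  ⟨((h.liveX.append _).append _).mono le_rfl (by omega),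
    ((h.liveY.append _).append _).mono (by omega) le_rfl, liveIn_rows (by simp), hX.ne, hY.ne,
    View.inj_of_rows rfl le_rfl, h.rowsX, h.colsY, rfl⟩

theorem inner_right (h : GridArrays fs X Y Z n₁ n₂ (a + b)) (hX : X.frame < fs.length)
    (hY : Y.frame < fs.length) : GridArrays (fs ++ [n₁ * n₂] ++ [n₁ * n₂]) (X.sub 0 a) (Y.sub a 0)
      ⟨fs.length + 1, 0, n₂, 1⟩ n₁ n₂ b :=
  ⟨((h.liveX.append _).append _).sub (by omega) le_rfl,
    ((h.liveY.append _).append _).sub le_rfl (by omega), liveIn_rows (by simp),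
    (hX.trans_le (by simp)).ne, (hY.trans_le (by simp)).ne,
    View.inj_of_rows rfl le_rfl, h.rowsX, h.colsY, rfl⟩

theorem raceFree {ω : ℝ} (hω : 1 ≤ ω) (h : GridArrays fs X Y Z n₁ n₂ n₃) (h₁ : 0 < n₁)
    (h₂ : 0 < n₂) (h₃ : 0 < n₃) : (grid ω fs.length X Y Z n₁ n₂ n₃).RaceFree fs :=
  grid_raceFree hω h₁ h₂ h₃ h.liveX h.liveY h.liveZ h.frameX h.frameY h.inj

end GridArrays

/-- The parameters of the cost analysis: `s` is the square root of the cache size, `g` is the cube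
root of the cost ratio, and blocks of at most `(e * s) ^ 2` words fit into the cache. -/
structure Regime (e g s : ℝ) (M B : ℕ) : Prop where
  hB : 0 < B
  he : 0 < e
  he1 : 2048 * e ^ 2 ≤ 1
  hg : 1 ≤ g
  hs : 1 ≤ s
  hM : (M : ℝ) = s ^ 2
  hBs : 2048 * (e * B) ^ 2 ≤ s ^ 2
  hgs : 2048 * (e * g) ^ 2 ≤ s ^ 2
  -- A single cell counts as a block that fits, so the recursions below always end in a base case.
  one_le : 1 ≤ (e * s) ^ 2
  hB1 : 64 * (B : ℝ) ≤ s ^ 2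
  -- The logarithmic part of the stack of a grid computation has to fit into the cache as well.
  hclog : ∀ n : ℕ, (n : ℝ) ≤ s ^ 6 → 64 * (Nat.clog 2 n : ℝ) ≤ s ^ 2

/-- A side of a block that fits into the cache meets few lines. -/
theorem Regime.side_le {e g s : ℝ} {M B : ℕ} (h : Regime e g s M B) {x : ℝ} (hx : 0 ≤ x)
    (hxe : x ^ 2 ≤ 6 * (e * s) ^ 2) : 16 * (x * B) ≤ s ^ 2 := by
  have h1 : (16 * (x * B)) ^ 2 ≤ (s ^ 2) ^ 2 := by
    have hs := h.hs
    calc (16 * (x * B)) ^ 2 = 256 * (B ^ 2 * x ^ 2) := by ring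
      _ ≤ 256 * (B ^ 2 * (6 * (e * s) ^ 2)) := by gcongr
      _ = 1536 * (e * B) ^ 2 * s ^ 2 := by ring
      _ ≤ 2048 * (e * B) ^ 2 * s ^ 2 := by gcongr; norm_num
      _ ≤ s ^ 2 * s ^ 2 := by gcongr; exact h.hBs
      _ = _ := by ring
  exact (pow_le_pow_iff_left₀ (by positivity) (by positivity) two_ne_zero).1 h1

/-! ### Cache cost of parallel loops -/

theorem parFor_trace {f : ℕ → ℕ → Instr} {i j m₁ m₂ : ℕ} {fs : List ℕ} (h₁ : 0 < m₁)
    (h₂ : 0 < m₂) {s : Step} (hs : s ∈ (parFor f i j m₁ m₂).trace fs) :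
    ∃ a < m₁, ∃ b < m₂, s = ⟨(f (i + a) (j + b)).srcs.map (Loc.addr fs),
      (f (i + a) (j + b)).dst.addr fs⟩ := by
  revert hs
  refine parFor_rec (motive := fun i j m₁ m₂ P => s ∈ P.trace fs → ∃ a < m₁, ∃ b < m₂,
    s = ⟨(f (i + a) (j + b)).srcs.map (Loc.addr fs), (f (i + a) (j + b)).dst.addr fs⟩)
    ?_ ?_ ?_ i j m₁ m₂ h₁ h₂
  · intro i j hs
    exact ⟨0, one_pos, 0, one_pos, by simpa [Prog.trace] using hs⟩
  · intro i j a b m P Q _ _ _ _ _ _ _ hP hQ hs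
    rw [exists_lt_add_iff]
    refine (List.mem_append.1 hs).imp hP fun h => ?_
    simpa only [add_assoc] using hQ h
  · intro i j m a b P Q _ _ _ _ _ _ _ hP hQ hs
    rw [exists_exists_lt_add_iff]
    refine (List.mem_append.1 hs).imp hP fun h => ?_
    simpa only [add_assoc] using hQ h

/-- Cache cost of a parallel loop, if the accesses of nearly square blocks of at most `(e * s) ^ 2`
iterations fit into the cache. -/
theorem parFor_cost {e g s ω : ℝ} {M B : ℕ} (hR : Regime e g s M B) (hω : ω = g ^ 3)
    {f : ℕ → ℕ → Instr} {i j m₁ m₂ : ℕ} {fs : List ℕ} (h₁ : 0 < m₁) (h₂ : 0 < m₂)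
    (hfit : ∀ i j m₁ m₂ : ℕ, (m₁ : ℝ) ^ 2 ≤ 3 * (e * s) ^ 2 → (m₂ : ℝ) ^ 2 ≤ 3 * (e * s) ^ 2 →
      (m₁ * m₂ : ℝ) ≤ (e * s) ^ 2 →
      ∃ F : Finset ℕ, F.card * B ≤ M ∧ ∀ a < m₁, ∀ b < m₂,
        (∀ l ∈ (f (i + a) (j + b)).srcs, l.addr fs / B ∈ F) ∧
          (f (i + a) (j + b)).dst.addr fs / B ∈ F)
    (h₁₂ : m₁ ≤ 3 * m₂) (h₂₁ : m₂ ≤ 3 * m₁) :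
    CostLE ω M B ((parFor f i j m₁ m₂).trace fs)
      ((6 / e ^ 2 * (g ^ 3 * (m₁ * m₂)) + 2 * (g ^ 3 * s ^ 2)) / B) := by
  have hB := hR.hB
  have hB' : (0 : ℝ) < B := by exact_mod_cast hB
  have he := hR.he
  have hg := hR.hg
  have hs := hR.hs
  have hω1 : 1 ≤ ω := by
    rw [hω]
    exact one_le_pow₀ hg
  -- A block that fits costs at most one filling of the cache and one write-back of it, `(1 + ω) s²
  -- / B`.
  have base : ∀ {i j m₁ m₂ : ℕ}, 0 < m₁ → 0 < m₂ → m₁ ≤ 3 * m₂ → m₂ ≤ 3 * m₁ →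
      (m₁ * m₂ : ℝ) ≤ (e * s) ^ 2 →
      CostLE ω M B ((parFor f i j m₁ m₂).trace fs) (2 * (g ^ 3 * s ^ 2) / B) := by
    intro i j m₁ m₂ h₁ h₂ h₁₂ h₂₁ h
    have h12 : (m₁ : ℝ) ≤ 3 * m₂ := by exact_mod_cast h₁₂
    have h21 : (m₂ : ℝ) ≤ 3 * m₁ := by exact_mod_cast h₂₁
    obtain ⟨F, hF, hF'⟩ := hfit i j m₁ m₂ (by nlinarith) (by nlinarith) h
    refine (costLE_of_card_le hω1 (F := F) (fun st hst => ?_) hF).mono ?_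
    · obtain ⟨a, ha, b, hb, rfl⟩ := parFor_trace h₁ h₂ hst
      refine ⟨fun x hx => ?_, (hF' a ha b hb).2⟩
      obtain ⟨l, hl, rfl⟩ := List.mem_map.1 hx
      exact (hF' a ha b hb).1 l hl
    · have hF2 : (F.card * B : ℝ) ≤ s ^ 2 := by
        rw [← hR.hM]
        exact_mod_cast hF
      rw [le_div_iff₀ hB', ← hω]
      calc (1 + ω) * F.card * B = (1 + ω) * (F.card * B) := by ring
        _ ≤ (1 + ω) * s ^ 2 := by gcongr
        _ ≤ (2 * ω) * s ^ 2 := by gcongr; linarith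
        _ = _ := by ring
  -- The recursion stops at the first block that fits. Its parent did not fit and halving keeps at
  -- least a third, so its area is at least `(e s)² / 3` and pays for the filling of the cache. The
  -- bound is then additive in the area.
  have heavy : 2 * (e * s) ^ 2 ≤ 6 * (m₁ * m₂ : ℝ) → CostLE ω M B ((parFor f i j m₁ m₂).trace fs)
      (6 / e ^ 2 * (g ^ 3 * (m₁ * m₂)) / B) := by
    suffices m₁ ≤ 3 * m₂ → m₂ ≤ 3 * m₁ → 2 * (e * s) ^ 2 ≤ 6 * (m₁ * m₂ : ℝ) →
        parFor f i j m₁ m₂ = parFor f i j m₁ m₂ → CostLE ω M B ((parFor f i j m₁ m₂).trace fs)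
      (6 / e ^ 2 * (g ^ 3 * (m₁ * m₂)) / B) from fun h => this h₁₂ h₂₁ h rfl
    have base' : ∀ {i j m₁ m₂ : ℕ} {P : Prog}, 0 < m₁ → 0 < m₂ → m₁ ≤ 3 * m₂ → m₂ ≤ 3 * m₁ →
        2 * (e * s) ^ 2 ≤ 6 * (m₁ * m₂ : ℝ) → P = parFor f i j m₁ m₂ →
        (m₁ * m₂ : ℝ) ≤ (e * s) ^ 2 →
        CostLE ω M B (P.trace fs) (6 / e ^ 2 * (g ^ 3 * (m₁ * m₂)) / B) := by
      rintro i j m₁ m₂ P h₁ h₂ h₁₂ h₂₁ h rfl h'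
      refine (base h₁ h₂ h₁₂ h₂₁ h').mono (div_le_div_of_nonneg_right ?_ hB'.le)
      rw [div_mul_eq_mul_div, le_div_iff₀ (by positivity)]
      calc 2 * (g ^ 3 * s ^ 2) * e ^ 2 = g ^ 3 * (2 * (e * s) ^ 2) := by ring
        _ ≤ g ^ 3 * (6 * (m₁ * m₂)) := by gcongr
        _ = _ := by ring
    refine parFor_rec (motive := fun i j m₁ m₂ P => m₁ ≤ 3 * m₂ → m₂ ≤ 3 * m₁ →
      2 * (e * s) ^ 2 ≤ 6 * (m₁ * m₂ : ℝ) → P = parFor f i j m₁ m₂ →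
      CostLE ω M B (P.trace fs) (6 / e ^ 2 * (g ^ 3 * (m₁ * m₂)) / B)) ?_ ?_ ?_ i j m₁ m₂ h₁ h₂
    · intro i j h₁ h₂ h he
      exact base' one_pos one_pos h₁ h₂ h he (by simpa using hR.one_le)
    · intro i j a b m P Q ha hab hba hm hmab hPe hQe hP hQ h₁ h₂ h he
      by_cases hf : ((a + b : ℕ) * m : ℝ) ≤ (e * s) ^ 2
      · exact base' (by omega) hm h₁ h₂ h he hf
      · have ha3 : ((a + b : ℕ) : ℝ) ≤ 3 * a := by exact_mod_cast show a + b ≤ 3 * a by omega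
        have hb3 : ((a + b : ℕ) : ℝ) ≤ 3 * b := by exact_mod_cast show a + b ≤ 3 * b by omega
        have hA : ((a + b : ℕ) : ℝ) * m ≤ 3 * a * m := by gcongr
        have hB : ((a + b : ℕ) : ℝ) * m ≤ 3 * b * m := by gcongr
        refine ((hP (by omega) (by omega) (by linarith) hPe).append
          (hQ (by omega) (by omega) (by linarith) hQe)).mono (le_of_eq ?_)
        push_cast
        ring
    · intro i j m a b P Q ha hab hba hm hmab hPe hQe hP hQ h₁ h₂ h he
      by_cases hf : (m * (a + b : ℕ) : ℝ) ≤ (e * s) ^ 2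
      · exact base' hm (by omega) h₁ h₂ h he hf
      · have ha3 : ((a + b : ℕ) : ℝ) ≤ 3 * a := by exact_mod_cast show a + b ≤ 3 * a by omega
        have hb3 : ((a + b : ℕ) : ℝ) ≤ 3 * b := by exact_mod_cast show a + b ≤ 3 * b by omega
        have hA : m * ((a + b : ℕ) : ℝ) ≤ m * (3 * a) := by gcongr
        have hB : m * ((a + b : ℕ) : ℝ) ≤ m * (3 * b) := by gcongr
        refine ((hP (by omega) (by omega) (by linarith) hPe).append
          (hQ (by omega) (by omega) (by linarith) hQe)).mono (le_of_eq ?_)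
        push_cast
        ring
  by_cases hf : (m₁ * m₂ : ℝ) ≤ (e * s) ^ 2
  · refine (base h₁ h₂ h₁₂ h₂₁ hf).mono ?_
    gcongr
    have : 0 ≤ 6 / e ^ 2 * (g ^ 3 * (m₁ * m₂ : ℝ)) := by positivity
    linarith
  · refine (heavy (by nlinarith)).mono ?_
    gcongr
    have : 0 ≤ g ^ 3 * s ^ 2 := by positivity
    linarith

/-! ### Cache cost of grid computations -/

/-- Induction along a grid computation whose subproblems keep `GridShape` and `GridArrays`. -/
theorem grid_shape_rec {ω q : ℝ} (hω : 1 ≤ ω) (hq : ω ^ (2 / 3 : ℝ) = q)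
    {motive : List ℕ → View → View → View → ℕ → ℕ → ℕ → Prop}
    (one : ∀ fs X Y Z, GridShape q 1 1 1 → GridArrays fs X Y Z 1 1 1 → motive fs X Y Z 1 1 1)
    (split₃ : ∀ fs fs' X Y Z n₁ n₂ a b, fs' = fs ++ [n₁ * n₂] ++ [n₁ * n₂] →
      GridShape q n₁ n₂ (a + b) → GridArrays fs X Y Z n₁ n₂ (a + b) → 0 < a → a ≤ b → b ≤ a + 1 →
      ((n₁ = 1 ∧ n₂ = 1) ∨ q * (max n₁ n₂ : ℕ) < (a + b : ℕ)) →
      grid ω fs.length X Y Z n₁ n₂ (a + b) = .alloc (n₁ * n₂) (.alloc (n₁ * n₂) (.seq (.par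
        (grid ω fs'.length X Y ⟨fs.length, 0, n₂, 1⟩ n₁ n₂ a)
        (grid ω fs'.length (X.sub 0 a) (Y.sub a 0) ⟨fs.length + 1, 0, n₂, 1⟩ n₁ n₂ b))
        (addTemps fs.length Z n₁ n₂))) →
      motive fs' X Y ⟨fs.length, 0, n₂, 1⟩ n₁ n₂ a →
      motive fs' (X.sub 0 a) (Y.sub a 0) ⟨fs.length + 1, 0, n₂, 1⟩ n₁ n₂ b →
      motive fs X Y Z n₁ n₂ (a + b))
    (split₁ : ∀ fs X Y Z a b n₂ n₃, GridShape q (a + b) n₂ n₃ → GridArrays fs X Y Z (a + b) n₂ n₃ →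
      0 < a → a ≤ b → b ≤ a + 1 →
      grid ω fs.length X Y Z (a + b) n₂ n₃ = .par (grid ω fs.length X Y Z a n₂ n₃)
        (grid ω fs.length (X.sub a 0) Y (Z.sub a 0) b n₂ n₃) →
      motive fs X Y Z a n₂ n₃ → motive fs (X.sub a 0) Y (Z.sub a 0) b n₂ n₃ →
      motive fs X Y Z (a + b) n₂ n₃)
    (split₂ : ∀ fs X Y Z n₁ a b n₃, GridShape q n₁ (a + b) n₃ → GridArrays fs X Y Z n₁ (a + b) n₃ →
      0 < a → a ≤ b → b ≤ a + 1 →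
      grid ω fs.length X Y Z n₁ (a + b) n₃ = .par (grid ω fs.length X Y Z n₁ a n₃)
        (grid ω fs.length X (Y.sub 0 a) (Z.sub 0 a) n₁ b n₃) →
      motive fs X Y Z n₁ a n₃ → motive fs X (Y.sub 0 a) (Z.sub 0 a) n₁ b n₃ →
      motive fs X Y Z n₁ (a + b) n₃)
    {fs : List ℕ} {X Y Z : View} {n₁ n₂ n₃ : ℕ} (hS : GridShape q n₁ n₂ n₃)
    (hA : GridArrays fs X Y Z n₁ n₂ n₃) : motive fs X Y Z n₁ n₂ n₃ := by
  have hq1 : 1 ≤ q := hq ▸ Real.one_le_rpow hω (by norm_num)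
  refine grid_rec hω (motive := fun fr X Y Z n₁ n₂ n₃ P => P = grid ω fr X Y Z n₁ n₂ n₃ →
    ∀ fs : List ℕ, fr = fs.length → GridShape q n₁ n₂ n₃ → GridArrays fs X Y Z n₁ n₂ n₃ →
    motive fs X Y Z n₁ n₂ n₃) ?_ ?_ ?_ ?_ fs.length X Y Z n₁ n₂ n₃ hS.pos₁ hS.pos₂ hS.pos₃
    rfl fs rfl hS hA
  · intro fr X Y Z _ fs _ hS hA
    exact one fs X Y Z hS hA
  · rintro fr X Y Z n₁ n₂ a b P Q h₁ h₂ ha hab hba hn hPe hQe hP hQ he fs rfl hS hA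
    rw [hq] at hn
    have hS' := hS.inner hq1 ha hab hba hn
    have hX := hA.liveX.frame_lt h₁ hS.pos₃
    have hY := hA.liveY.frame_lt hS.pos₃ h₂
    have hl : fs.length + 2 = (fs ++ [n₁ * n₂] ++ [n₁ * n₂]).length := by simp
    refine split₃ fs _ X Y Z n₁ n₂ a b rfl hS hA ha hab hba hn ?_
      (hP hPe _ hl hS'.1 (hA.inner_left hX hY)) (hQ hQe _ hl hS'.2 (hA.inner_right hX hY))
    rw [← he, hPe, hQe, hl]
  · rintro fr X Y Z a b n₂ n₃ P Q ha hab hba _ _ h₂ h₃ hPe hQe hP hQ he fs rfl hS hA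
    rw [hq] at h₃
    have hS' := hS.row (by linarith) ha hab hba h₂ h₃
    refine split₁ fs X Y Z a b n₂ n₃ hS hA ha hab hba ?_ (hP hPe _ rfl hS'.1 hA.row_left)
      (hQ hQe _ rfl hS'.2 hA.row_right)
    rw [← he, hPe, hQe]
  · rintro fr X Y Z n₁ a b n₃ P Q _ ha hab hba _ h₁ h₃ hPe hQe hP hQ he fs rfl hS hA
    rw [hq] at h₃
    have hS' := hS.col (by linarith) ha hab hba h₁ h₃
    refine split₂ fs X Y Z n₁ a b n₃ hS hA ha hab hba ?_ (hP hPe _ rfl hS'.1 hA.col_left)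
      (hQ hQe _ rfl hS'.2 hA.col_right)
    rw [← he, hPe, hQe]

/-- A grid computation whose factors fit into the cache besides the pinned lines, which hold the
output and the stack. -/
theorem grid_pinned_of_fit {e g s ω : ℝ} {M B : ℕ} (hR : Regime e g s M B) (hω : 1 ≤ ω)
    {q : ℝ} {fs : List ℕ} {X Y Z : View} {n₁ n₂ n₃ : ℕ} (hS : GridShape q n₁ n₂ n₃)
    (hA : GridArrays fs X Y Z n₁ n₂ n₃) {P : Finset ℕ} (hP : 2 * (P.card * B : ℝ) ≤ s ^ 2)
    (hZ : ∀ i < n₁, ∀ j < n₂, (Z.at i j).addr fs / B ∈ P)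
    (hstack : ∀ a, fs.sum ≤ a → a < fs.sum + (grid ω fs.length X Y Z n₁ n₂ n₃).depth → a / B ∈ P)
    (h₁₃ : (n₁ * n₃ : ℝ) ≤ (e * s) ^ 2) (h₂₃ : (n₂ * n₃ : ℝ) ≤ (e * s) ^ 2) :
    Pinned M B P ((grid ω fs.length X Y Z n₁ n₂ n₃).trace fs) (s ^ 2 / 2 / B) := by
  have hB' : (0 : ℝ) < B := by exact_mod_cast hR.hB
  set F := viewLines B fs X n₁ n₃ ∪ viewLines B fs Y.transpose n₂ n₃ with hF
  -- Both factors are stored along the third side. Because `n₁, n₂ ≤ 2 n₃`, they consist of few rows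
  -- or columns, and `side_le` keeps the partially used lines at the row ends small. Half of the
  -- cache is left for `P`.
  have hcard : (F.card * B : ℝ) ≤ s ^ 2 / 2 := by
    have h1 := card_viewLines hR.hB fs X n₁ n₃
    have h2 := card_viewLines hR.hB fs Y.transpose n₂ n₃
    have h3 : F.card * B ≤ n₁ * (n₃ + 2 * B) + n₂ * (n₃ + 2 * B) :=
      (Nat.mul_le_mul_right B (Finset.card_union_le _ _)).trans (by rw [add_mul]; omega)
    have h4 : (F.card * B : ℝ) ≤ n₁ * (n₃ + 2 * B) + n₂ * (n₃ + 2 * B) := by exact_mod_cast h3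
    have l1 : (n₁ : ℝ) ≤ 2 * n₃ := by exact_mod_cast hS.le₁₃
    have l2 : (n₂ : ℝ) ≤ 2 * n₃ := by exact_mod_cast hS.le₂₃
    have s1 := hR.side_le (x := n₁) (by positivity) (by nlinarith)
    have s2 := hR.side_le (x := n₂) (by positivity) (by nlinarith)
    have h5 : 2048 * (e * s) ^ 2 ≤ s ^ 2 := by
      have := hR.he1
      rw [mul_pow]
      nlinarith [sq_nonneg s]
    linarith [sq_nonneg s]
  have hPF : (P.card + F.card) * B ≤ M := by
    have : ((P.card + F.card) * B : ℝ) ≤ M := by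
      rw [hR.hM]
      linarith
    exact_mod_cast this
  have hrf := hA.raceFree hω hS.pos₁ hS.pos₂ hS.pos₃
  refine (pinned_of_card_le (F := F) (fun st hst => ⟨fun a ha => ?_, ?_⟩) hPF).mono ?_
  · rcases Prog.trace_touches hrf hst a (.inl ha) with ⟨l, hl, hlive, rfl⟩ | ⟨h, h'⟩
    · rcases grid_touches hω hS.pos₁ hS.pos₂ hS.pos₃ hl with
        ⟨i, hi, k, hk, rfl⟩ | ⟨k, hk, j, hj, rfl⟩ | ⟨i, hi, j, hj, rfl⟩ | h
      · exact Finset.mem_union_right _ (Finset.mem_union_left _ (mem_viewLines hA.rowsX hi hk))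
      · refine Finset.mem_union_right _ (Finset.mem_union_right _ ?_)
        rw [← View.transpose_at]
        exact mem_viewLines hA.colsY hj hk
      · exact Finset.mem_union_left _ (hZ i hi j hj)
      · exact absurd hlive.frame_lt (by omega)
    · exact Finset.mem_union_left _ (hstack a h h')
  · rcases Prog.trace_writes hrf hst with ⟨l, hl, hlive, he⟩ | ⟨h, h'⟩
    · rcases grid_writes hω hS.pos₁ hS.pos₂ hS.pos₃ hl with ⟨i, hi, j, hj, rfl⟩ | h
      · rw [he]
        exact hZ i hi j hj
      · exact absurd hlive.frame_lt (by omega)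
    · exact hstack _ h h'
  · rwa [le_div_iff₀ hB']

/-- The addition of the temporary outputs needs no transfers while their lines are pinned. -/
theorem addTemps_pinned {M B : ℕ} {fs : List ℕ} {Z : View} {n₁ n₂ : ℕ} (h₁ : 0 < n₁) (h₂ : 0 < n₂)
    (hZi : Z.Inj n₁ n₂) (hZl : Z.LiveIn fs n₁ n₂) {P : Finset ℕ} (hP : P.card * B ≤ M)
    (hZ : ∀ i < n₁, ∀ j < n₂, (Z.at i j).addr fs / B ∈ P)
    (hstack : ∀ a, fs.sum ≤ a → a < fs.sum + 2 * (n₁ * n₂) → a / B ∈ P) :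
    Pinned M B P ((addTemps fs.length Z n₁ n₂).trace (fs ++ [n₁ * n₂] ++ [n₁ * n₂])) 0 := by
  have hrf : (Prog.alloc (n₁ * n₂) (.alloc (n₁ * n₂) (addTemps fs.length Z n₁ n₂))).RaceFree fs :=
    addTemps_raceFree h₁ h₂ hZi hZl
  have hd : (addTemps fs.length Z n₁ n₂).depth = 0 := parFor_depth _ h₁ h₂
  have key : ∀ st ∈ (addTemps fs.length Z n₁ n₂).trace (fs ++ [n₁ * n₂] ++ [n₁ * n₂]),
      ∀ a, a ∈ st.srcs ∨ a = st.dst → a / B ∈ P := by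
    intro st hst a ha
    rcases Prog.trace_touches hrf hst a ha with ⟨l, hl, hlive, rfl⟩ | ⟨h, h'⟩
    · rcases addTemps_touches h₁ h₂ hl with ⟨i, hi, j, hj, rfl⟩ | h
      · exact hZ i hi j hj
      · exact absurd hlive.frame_lt (by omega)
    · refine hstack a h ?_
      simp only [Prog.depth, hd] at h'
      omega
  simpa using pinned_of_card_le (F := ∅) (P := P) (M := M) (B := B) (fun st hst =>
    ⟨fun a ha => by simpa using key st hst a (.inl ha), key st hst _ (.inr rfl)⟩) (by simpa using hP)

/-- A grid computation whose output and stack are pinned. -/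
theorem grid_pinned {e g s ω : ℝ} {M B : ℕ} (hR : Regime e g s M B) (hω : 1 ≤ ω)
    (hq : ω ^ (2 / 3 : ℝ) = g ^ 2) {fs : List ℕ} {X Y Z : View} {n₁ n₂ n₃ : ℕ}
    (hS : GridShape (g ^ 2) n₁ n₂ n₃) (hA : GridArrays fs X Y Z n₁ n₂ n₃) {P : Finset ℕ}
    (hP : 2 * (P.card * B : ℝ) ≤ s ^ 2)
    (hZ : ∀ i < n₁, ∀ j < n₂, (Z.at i j).addr fs / B ∈ P)
    (hstack : ∀ a, fs.sum ≤ a → a < fs.sum + (grid ω fs.length X Y Z n₁ n₂ n₃).depth → a / B ∈ P) :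
    Pinned M B P ((grid ω fs.length X Y Z n₁ n₂ n₃).trace fs)
      ((81 / e ^ 3 * (g * (n₁ * n₂ * n₃) / s) + s ^ 2 / 2) / B) := by
  have hB' : (0 : ℝ) < B := by exact_mod_cast hR.hB
  have he := hR.he
  have hg := hR.hg
  have hs := hR.hs
  have hPM : P.card * B ≤ M := by
    have : (P.card * B : ℝ) ≤ M := by
      rw [hR.hM]
      have : (0 : ℝ) ≤ P.card * B := by positivity
      linarith
    exact_mod_cast this
  -- With `n₃ ≤ 9 g² n₁` the lower bound on `n₁ n₃` gives `e s ≤ 9 g n₁`. Multiplied by the one on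
  -- `n₂ n₃` it gives `(e s)³ ≤ 81 g n₁ n₂ n₃`: the cells pay for reading the factors.
  have base : ∀ fs X Y Z (n₁ n₂ n₃ : ℕ), GridShape (g ^ 2) n₁ n₂ n₃ → GridArrays fs X Y Z n₁ n₂ n₃ →
      (∀ i < n₁, ∀ j < n₂, (Z.at i j).addr fs / B ∈ P) →
      (∀ a, fs.sum ≤ a → a < fs.sum + (grid ω fs.length X Y Z n₁ n₂ n₃).depth → a / B ∈ P) →
      (e * s) ^ 2 ≤ 9 * (n₁ * n₃ : ℝ) → (e * s) ^ 2 ≤ 9 * (n₂ * n₃ : ℝ) →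
      (n₁ * n₃ : ℝ) ≤ (e * s) ^ 2 → (n₂ * n₃ : ℝ) ≤ (e * s) ^ 2 →
      Pinned M B P ((grid ω fs.length X Y Z n₁ n₂ n₃).trace fs)
        (81 / e ^ 3 * (g * (n₁ * n₂ * n₃) / s) / B) := by
    intro fs X Y Z n₁ n₂ n₃ hS hA hZ hstack l1 l2 u1 u2
    refine (grid_pinned_of_fit hR hω hS hA hP hZ hstack u1 u2).mono
      (div_le_div_of_nonneg_right ?_ hB'.le)
    have h9 : e * s ≤ 9 * g * n₁ := by
      have h3 := hS.le₃₁ (by positivity)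
      refine (pow_le_pow_iff_left₀ (by positivity) (by positivity) two_ne_zero).1 (l1.trans ?_)
      have : (n₁ * n₃ : ℝ) ≤ n₁ * (9 * g ^ 2 * n₁) := by gcongr
      linarith
    have h10 : (e * s) * (e * s) ^ 2 ≤ (9 * g * n₁) * (9 * (n₂ * n₃ : ℝ)) := by gcongr
    rw [div_mul_div_comm, le_div_iff₀ (by positivity)]
    have : 0 ≤ e ^ 3 * s ^ 3 := by positivity
    linarith
  -- The volume term is additive over all three kinds of splits. The additions of temporaries take
  -- no transfers, as their arrays lie in the pinned stack.
  have heavy : (e * s) ^ 2 ≤ 9 * (n₁ * n₃ : ℝ) → (e * s) ^ 2 ≤ 9 * (n₂ * n₃ : ℝ) →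
      Pinned M B P ((grid ω fs.length X Y Z n₁ n₂ n₃).trace fs)
        (81 / e ^ 3 * (g * (n₁ * n₂ * n₃) / s) / B) := by
    revert hZ hstack
    refine grid_shape_rec hω hq (motive := fun fs X Y Z n₁ n₂ n₃ =>
      (∀ i < n₁, ∀ j < n₂, (Z.at i j).addr fs / B ∈ P) →
      (∀ a, fs.sum ≤ a → a < fs.sum + (grid ω fs.length X Y Z n₁ n₂ n₃).depth → a / B ∈ P) →
      (e * s) ^ 2 ≤ 9 * (n₁ * n₃ : ℝ) → (e * s) ^ 2 ≤ 9 * (n₂ * n₃ : ℝ) →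
      Pinned M B P ((grid ω fs.length X Y Z n₁ n₂ n₃).trace fs)
        (81 / e ^ 3 * (g * (n₁ * n₂ * n₃) / s) / B)) ?_ ?_ ?_ ?_ hS hA
    · intro fs X Y Z hS hA hZ hstack l1 l2
      exact base fs X Y Z 1 1 1 hS hA hZ hstack l1 l2 (by simpa using hR.one_le)
        (by simpa using hR.one_le)
    · rintro fs _ X Y Z n₁ n₂ a b rfl hS hA ha hab hba hn hE hP1 hP2 hZ hstack l1 l2
      by_cases hfit : (n₁ * (a + b : ℕ) : ℝ) ≤ (e * s) ^ 2 ∧ (n₂ * (a + b : ℕ) : ℝ) ≤ (e * s) ^ 2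
      · exact base _ _ _ _ _ _ _ hS hA hZ hstack l1 l2 hfit.1 hfit.2
      have ha3 : ((a + b : ℕ) : ℝ) ≤ 3 * a := by exact_mod_cast show a + b ≤ 3 * a by omega
      have hb3 : ((a + b : ℕ) : ℝ) ≤ 3 * b := by exact_mod_cast show a + b ≤ 3 * b by omega
      have h12 : (n₁ : ℝ) ≤ 3 * n₂ := by exact_mod_cast hS.le₁₂
      have h21 : (n₂ : ℝ) ≤ 3 * n₁ := by exact_mod_cast hS.le₂₁
      have p12 : (n₁ : ℝ) * (a + b : ℕ) ≤ 3 * n₂ * (a + b : ℕ) := by gcongr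
      have p21 : (n₂ : ℝ) * (a + b : ℕ) ≤ 3 * n₁ * (a + b : ℕ) := by gcongr
      -- If one factor is too large, the other has at least a third of its size; halving a side
      -- costs a second factor 3. Together they are the 9 of the invariant.
      have big : (e * s) ^ 2 ≤ 3 * (n₁ * (a + b : ℕ) : ℝ) ∧
          (e * s) ^ 2 ≤ 3 * (n₂ * (a + b : ℕ) : ℝ) := by
        have p1 : (0 : ℝ) ≤ n₁ * (a + b : ℕ) := by positivity
        have p2 : (0 : ℝ) ≤ n₂ * (a + b : ℕ) := by positivity
        rw [not_and_or, not_le, not_le] at hfit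
        rcases hfit with h | h <;> constructor <;> linarith
      have q1 : (n₁ : ℝ) * (a + b : ℕ) ≤ n₁ * (3 * a) := by gcongr
      have q2 : (n₁ : ℝ) * (a + b : ℕ) ≤ n₁ * (3 * b) := by gcongr
      have q3 : (n₂ : ℝ) * (a + b : ℕ) ≤ n₂ * (3 * a) := by gcongr
      have q4 : (n₂ : ℝ) * (a + b : ℕ) ≤ n₂ * (3 * b) := by gcongr
      rw [hE] at hstack ⊢
      have hd : (addTemps fs.length Z n₁ n₂).depth = 0 := parFor_depth _ hS.pos₁ hS.pos₂
      simp only [Prog.depth, hd, Nat.max_zero] at hstack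
      have hsum : (fs ++ [n₁ * n₂] ++ [n₁ * n₂]).sum = fs.sum + n₁ * n₂ + n₁ * n₂ := by
        simp [add_assoc]
      have hin : ∀ i < n₁, ∀ j < n₂, i * n₂ + j < n₁ * n₂ := fun i hi j hj => rowIndex_lt hi hj
      have htake : fs.take (fs.length + 1) = fs := List.take_of_length_le (by omega)
      have r1 := hP1 (fun i hi j hj => hstack _ (by simp [Loc.addr, View.at])
          (by simp [Loc.addr, View.at]; have := hin i hi j hj; omega))
        (fun x hx hx' => hstack x (by rw [hsum] at hx; omega) (by rw [hsum] at hx'; omega))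
        (by linarith) (by linarith)
      have r2 := hP2 (fun i hi j hj => hstack _
          (by simp [Loc.addr, View.at, List.take_append, htake]; omega)
          (by simp [Loc.addr, View.at, List.take_append, htake]; have := hin i hi j hj; omega))
        (fun x hx hx' => hstack x (by rw [hsum] at hx; omega) (by rw [hsum] at hx'; omega))
        (by linarith) (by linarith)
      have r3 := addTemps_pinned hS.pos₁ hS.pos₂ hA.inj hA.liveZ hPM hZ
        (fun x hx hx' => hstack x hx (by omega))
      refine ((r1.append r2).append r3).mono (le_of_eq ?_)
      push_cast
      ring
    · rintro fs X Y Z a b n₂ n₃ hS hA ha hab hba hE hP1 hP2 hZ hstack l1 l2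
      by_cases hfit : ((a + b : ℕ) * n₃ : ℝ) ≤ (e * s) ^ 2 ∧ (n₂ * n₃ : ℝ) ≤ (e * s) ^ 2
      · exact base _ _ _ _ _ _ _ hS hA hZ hstack l1 l2 hfit.1 hfit.2
      have ha3 : ((a + b : ℕ) : ℝ) ≤ 3 * a := by exact_mod_cast show a + b ≤ 3 * a by omega
      have hb3 : ((a + b : ℕ) : ℝ) ≤ 3 * b := by exact_mod_cast show a + b ≤ 3 * b by omega
      have h21 : (n₂ : ℝ) ≤ 3 * (a + b : ℕ) := by exact_mod_cast hS.le₂₁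
      have p21 : (n₂ : ℝ) * n₃ ≤ 3 * (a + b : ℕ) * n₃ := by gcongr
      have big : (e * s) ^ 2 ≤ 3 * ((a + b : ℕ) * n₃ : ℝ) := by
        have p1 : (0 : ℝ) ≤ (a + b : ℕ) * n₃ := by positivity
        rw [not_and_or, not_le, not_le] at hfit
        rcases hfit with h | h <;> linarith
      have q1 : ((a + b : ℕ) : ℝ) * n₃ ≤ 3 * a * n₃ := by gcongr
      have q2 : ((a + b : ℕ) : ℝ) * n₃ ≤ 3 * b * n₃ := by gcongr
      rw [hE] at hstack ⊢
      simp only [Prog.depth] at hstack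
      have r1 := hP1 (fun i hi j hj => hZ i (by omega) j hj)
        (fun x hx hx' => hstack x hx (by omega)) (by linarith) l2
      have r2 := hP2 (fun i hi j hj => by
          rw [View.sub_at]
          exact hZ (a + i) (by omega) (0 + j) (by omega))
        (fun x hx hx' => hstack x hx (by omega)) (by linarith) l2
      refine (r1.append r2).mono (le_of_eq ?_)
      push_cast
      ring
    · rintro fs X Y Z n₁ a b n₃ hS hA ha hab hba hE hP1 hP2 hZ hstack l1 l2
      by_cases hfit : (n₁ * n₃ : ℝ) ≤ (e * s) ^ 2 ∧ ((a + b : ℕ) * n₃ : ℝ) ≤ (e * s) ^ 2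
      · exact base _ _ _ _ _ _ _ hS hA hZ hstack l1 l2 hfit.1 hfit.2
      have ha3 : ((a + b : ℕ) : ℝ) ≤ 3 * a := by exact_mod_cast show a + b ≤ 3 * a by omega
      have hb3 : ((a + b : ℕ) : ℝ) ≤ 3 * b := by exact_mod_cast show a + b ≤ 3 * b by omega
      have h12 : (n₁ : ℝ) ≤ 3 * (a + b : ℕ) := by exact_mod_cast hS.le₁₂
      have p12 : (n₁ : ℝ) * n₃ ≤ 3 * (a + b : ℕ) * n₃ := by gcongr
      have big : (e * s) ^ 2 ≤ 3 * ((a + b : ℕ) * n₃ : ℝ) := by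
        have p1 : (0 : ℝ) ≤ (a + b : ℕ) * n₃ := by positivity
        rw [not_and_or, not_le, not_le] at hfit
        rcases hfit with h | h <;> linarith
      have q1 : ((a + b : ℕ) : ℝ) * n₃ ≤ 3 * a * n₃ := by gcongr
      have q2 : ((a + b : ℕ) : ℝ) * n₃ ≤ 3 * b * n₃ := by gcongr
      rw [hE] at hstack ⊢
      simp only [Prog.depth] at hstack
      have r1 := hP1 (fun i hi j hj => hZ i hi j (by omega))
        (fun x hx hx' => hstack x hx (by omega)) l1 (by linarith)
      have r2 := hP2 (fun i hi j hj => by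
          rw [View.sub_at]
          exact hZ (0 + i) (by omega) (a + j) (by omega))
        (fun x hx hx' => hstack x hx (by omega)) l1 (by linarith)
      refine (r1.append r2).mono (le_of_eq ?_)
      push_cast
      ring
  have h0 : 0 ≤ 81 / e ^ 3 * (g * (n₁ * n₂ * n₃) / s) := by positivity
  by_cases hfit : (n₁ * n₃ : ℝ) ≤ (e * s) ^ 2 ∧ (n₂ * n₃ : ℝ) ≤ (e * s) ^ 2
  · refine (grid_pinned_of_fit hR hω hS hA hP hZ hstack hfit.1 hfit.2).mono
      (div_le_div_of_nonneg_right ?_ hB'.le)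
    linarith
  · have h12 : (n₁ : ℝ) ≤ 3 * n₂ := by exact_mod_cast hS.le₁₂
    have h21 : (n₂ : ℝ) ≤ 3 * n₁ := by exact_mod_cast hS.le₂₁
    have p12 : (n₁ : ℝ) * n₃ ≤ 3 * n₂ * n₃ := by gcongr
    have p21 : (n₂ : ℝ) * n₃ ≤ 3 * n₁ * n₃ := by gcongr
    have p1 : (0 : ℝ) ≤ n₁ * n₃ := by positivity
    have p2 : (0 : ℝ) ≤ n₂ * n₃ := by positivity
    rw [not_and_or, not_le, not_le] at hfit
    refine (heavy ?_ ?_).mono (div_le_div_of_nonneg_right ?_ hB'.le)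
    · rcases hfit with h | h <;> linarith
    · rcases hfit with h | h <;> linarith
    · have : 0 ≤ s ^ 2 / 2 := by positivity
      linarith

/-- A grid computation whose output fits into the cache. -/
theorem grid_cost_of_fit {e g s ω : ℝ} {M B : ℕ} (hR : Regime e g s M B) (hω : ω = g ^ 3)
    (hq : ω ^ (2 / 3 : ℝ) = g ^ 2) {fs : List ℕ} {X Y Z : View} {n₁ n₂ n₃ : ℕ}
    (hS : GridShape (g ^ 2) n₁ n₂ n₃) (hA : GridArrays fs X Y Z n₁ n₂ n₃)
    (hfit : (n₁ * n₂ : ℝ) ≤ 2 * (e * s) ^ 2) :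
    CostLE ω M B ((grid ω fs.length X Y Z n₁ n₂ n₃).trace fs)
      ((81 / e ^ 3 * (g * (n₁ * n₂ * n₃) / s) + 2 * (g ^ 3 * s ^ 2)) / B) := by
  have hB' : (0 : ℝ) < B := by exact_mod_cast hR.hB
  have he := hR.he
  have hg := hR.hg
  have hs := hR.hs
  have hω1 : 1 ≤ ω := by
    rw [hω]
    exact one_le_pow₀ hg
  have hes : 2048 * (e * s) ^ 2 ≤ s ^ 2 := by
    have := hR.he1
    rw [mul_pow]
    nlinarith [sq_nonneg s]
  have h12 : (n₁ : ℝ) ≤ 3 * n₂ := by exact_mod_cast hS.le₁₂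
  have h21 : (n₂ : ℝ) ≤ 3 * n₁ := by exact_mod_cast hS.le₂₁
  have x1 : (n₁ : ℝ) ^ 2 ≤ 6 * (e * s) ^ 2 := by nlinarith
  have x2 : (n₂ : ℝ) ^ 2 ≤ 6 * (e * s) ^ 2 := by nlinarith
  have s1 := hR.side_le (x := n₁) (by positivity) x1
  have h3 := hS.le₃₂ (by positivity)
  set d := (grid ω fs.length X Y Z n₁ n₂ n₃).depth with hd
  -- A polynomial bound, needed only to make the logarithm of `n₃` small against `s²`.
  have hn₃ : (n₃ : ℝ) ≤ s ^ 6 := by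
    have i1 : 1 ≤ e * s := (one_le_sq_iff₀ (by positivity)).1 hR.one_le
    have i2 : (n₂ : ℝ) ≤ 3 * (e * s) := by
      refine (pow_le_pow_iff_left₀ (by positivity) (by positivity) two_ne_zero).1 (x2.trans ?_)
      nlinarith [sq_nonneg (e * s)]
    have i3 : 2048 * (e * g) ^ 2 ≤ s ^ 2 := hR.hgs
    calc (n₃ : ℝ) ≤ 9 * g ^ 2 * n₂ := h3
      _ ≤ 9 * g ^ 2 * (3 * (e * s)) * (e * s) := by
          refine (mul_le_mul_of_nonneg_left i2 (by positivity)).trans ?_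
          exact le_mul_of_one_le_right (by positivity) i1
      _ = 27 * (e * g) ^ 2 * s ^ 2 := by ring
      _ ≤ 2048 * (e * g) ^ 2 * s ^ 2 := by gcongr; norm_num
      _ ≤ s ^ 2 * s ^ 2 := by gcongr
      _ = s ^ 4 := by ring
      _ ≤ s ^ 6 := pow_le_pow_right₀ hs (by norm_num)
  -- The bound `n₃ ≤ 9 g² n₂` cancels the scaling in `grid_depth`: up to the logarithm, the stack is
  -- a constant times the output and can be pinned with it.
  have hdep : (d : ℝ) ≤ 72 * (n₁ * n₂) + 2 * Nat.clog 2 n₃ := by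
    have := grid_depth hω1 fs.length X Y Z hS.pos₁ hS.pos₂ hS.pos₃
    rw [hq, ← hd] at this
    have h' : (n₁ * n₃ : ℝ) ≤ n₁ * (9 * g ^ 2 * n₂) := by gcongr
    have hg2 : 0 < g ^ 2 := by positivity
    refine le_of_mul_le_mul_left ?_ hg2
    linarith
  have hclog := hR.hclog n₃ hn₃
  have hB1 := hR.hB1
  set P := viewLines B fs Z n₁ n₂ ∪ intervalLines B fs.sum d with hP
  have hcard : 2 * (P.card * B : ℝ) ≤ s ^ 2 := by
    have c1 := card_viewLines hR.hB fs Z n₁ n₂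
    have c2 := card_intervalLines hR.hB fs.sum d
    have c3 : P.card * B ≤ n₁ * (n₂ + 2 * B) + (d + 2 * B) :=
      (Nat.mul_le_mul_right B (Finset.card_union_le _ _)).trans (by rw [add_mul]; omega)
    have c4 : (P.card * B : ℝ) ≤ n₁ * (n₂ + 2 * B) + (d + 2 * B) := by exact_mod_cast c3
    linarith
  have hPM : P.card * B ≤ M := by
    have : (P.card * B : ℝ) ≤ M := by
      rw [hR.hM]
      have : (0 : ℝ) ≤ P.card * B := by positivity
      linarith
    exact_mod_cast this
  refine ((grid_pinned hR hω1 hq hS hA hcard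
    (fun i hi j hj => Finset.mem_union_left _ (mem_viewLines hA.rowsZ hi hj))
    (fun a h h' => Finset.mem_union_right _ (mem_intervalLines h h'.le))).costLE hω1 hPM).mono ?_
  rw [← hω]
  have k1 : (P.card : ℝ) ≤ s ^ 2 / 2 / B := by
    rw [le_div_iff₀ hB']
    linarith
  have k2 : (1 + ω) * P.card ≤ (ω + ω) * (s ^ 2 / 2 / B) := by gcongr
  have k3 : 1 * (s ^ 2 / 2 / B) ≤ ω * (s ^ 2 / 2 / B) := by gcongr
  have k4 : 0 ≤ ω * (s ^ 2 / 2 / B) := by positivity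
  calc _ ≤ (ω + ω) * (s ^ 2 / 2 / B) + (81 / e ^ 3 * (g * (n₁ * n₂ * n₃) / s) + s ^ 2 / 2) / B := by
        gcongr
    _ = 81 / e ^ 3 * (g * (n₁ * n₂ * n₃) / s) / B + 2 * (ω * (s ^ 2 / 2 / B)) +
        1 * (s ^ 2 / 2 / B) := by ring
    _ ≤ 81 / e ^ 3 * (g * (n₁ * n₂ * n₃) / s) / B + 4 * (ω * (s ^ 2 / 2 / B)) := by linarith
    _ = _ := by ring

theorem parFor_add_cost {e g s ω : ℝ} {M B : ℕ} (hR : Regime e g s M B) (hω : ω = g ^ 3)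
    {U V W : View} {n₁ n₂ : ℕ} (fs : List ℕ) (hU : U.colStride = 1) (hV : V.colStride = 1)
    (hW : W.colStride = 1) (h₁ : 0 < n₁) (h₂ : 0 < n₂) (h₁₂ : n₁ ≤ 3 * n₂) (h₂₁ : n₂ ≤ 3 * n₁) :
    CostLE ω M B ((parFor (fun i j => .add (U.at i j) (V.at i j) (W.at i j)) 0 0 n₁ n₂).trace fs)
      ((6 / e ^ 2 * (g ^ 3 * (n₁ * n₂)) + 2 * (g ^ 3 * s ^ 2)) / B) := by
  refine parFor_cost hR hω h₁ h₂ (fun i j m₁ m₂ hm₁ hm₂ hm => ?_) h₁₂ h₂₁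
  refine ⟨viewLines B fs (U.sub i j) m₁ m₂ ∪ (viewLines B fs (V.sub i j) m₁ m₂ ∪
    viewLines B fs (W.sub i j) m₁ m₂), ?_, fun a ha b hb => ?_⟩
  · have c1 := card_viewLines hR.hB fs (U.sub i j) m₁ m₂
    have c2 := card_viewLines hR.hB fs (V.sub i j) m₁ m₂
    have c3 := card_viewLines hR.hB fs (W.sub i j) m₁ m₂
    refine (Nat.mul_le_mul_right B ((Finset.card_union_le _ _).trans
      (Nat.add_le_add_left (Finset.card_union_le _ _) _))).trans ?_
    rw [add_mul, add_mul]
    suffices (3 * (m₁ * (m₂ + 2 * B)) : ℝ) ≤ M by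
      have : 3 * (m₁ * (m₂ + 2 * B)) ≤ M := by exact_mod_cast this
      omega
    have s1 := hR.side_le (x := m₁) (by positivity) (by nlinarith)
    have hes : 2048 * (e * s) ^ 2 ≤ s ^ 2 := by
      have := hR.he1
      rw [mul_pow]
      nlinarith [sq_nonneg s]
    rw [hR.hM]
    linarith [sq_nonneg s]
  · have u := mem_viewLines (B := B) (fs := fs) (Z := U.sub i j) hU ha hb
    have v := mem_viewLines (B := B) (fs := fs) (Z := V.sub i j) hV ha hb
    have w := mem_viewLines (B := B) (fs := fs) (Z := W.sub i j) hW ha hb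
    rw [View.sub_at] at u v w
    simp only [Instr.srcs, Instr.dst, List.mem_cons, List.not_mem_nil, or_false, forall_eq_or_imp,
      forall_eq, Finset.mem_union]
    exact ⟨⟨.inr (.inl v), .inr (.inr w)⟩, .inl u⟩

theorem parFor_copy_cost {e g s ω : ℝ} {M B : ℕ} (hR : Regime e g s M B) (hω : ω = g ^ 3)
    {U V : View} {n₁ n₂ : ℕ} (fs : List ℕ) (hU : U.rowStride = 1) (hV : V.colStride = 1)
    (h₁ : 0 < n₁) (h₂ : 0 < n₂) (h₁₂ : n₁ ≤ 3 * n₂) (h₂₁ : n₂ ≤ 3 * n₁) :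
    CostLE ω M B ((parFor (fun i j => .copy (U.at i j) (V.at i j)) 0 0 n₁ n₂).trace fs)
      ((6 / e ^ 2 * (g ^ 3 * (n₁ * n₂)) + 2 * (g ^ 3 * s ^ 2)) / B) := by
  refine parFor_cost hR hω h₁ h₂ (fun i j m₁ m₂ hm₁ hm₂ hm => ?_) h₁₂ h₂₁
  refine ⟨viewLines B fs (U.sub i j).transpose m₂ m₁ ∪ viewLines B fs (V.sub i j) m₁ m₂, ?_,
    fun a ha b hb => ?_⟩
  · have c1 := card_viewLines hR.hB fs (U.sub i j).transpose m₂ m₁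
    have c2 := card_viewLines hR.hB fs (V.sub i j) m₁ m₂
    refine (Nat.mul_le_mul_right B (Finset.card_union_le _ _)).trans ?_
    rw [add_mul]
    suffices (m₂ * (m₁ + 2 * B) + m₁ * (m₂ + 2 * B) : ℝ) ≤ M by
      have : m₂ * (m₁ + 2 * B) + m₁ * (m₂ + 2 * B) ≤ M := by exact_mod_cast this
      omega
    have s1 := hR.side_le (x := m₁) (by positivity) (by nlinarith)
    have s2 := hR.side_le (x := m₂) (by positivity) (by nlinarith)
    have hes : 2048 * (e * s) ^ 2 ≤ s ^ 2 := by
      have := hR.he1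
      rw [mul_pow]
      nlinarith [sq_nonneg s]
    rw [hR.hM]
    linarith [sq_nonneg s]
  · have u := mem_viewLines (B := B) (fs := fs) (Z := (U.sub i j).transpose) hU hb ha
    have v := mem_viewLines (B := B) (fs := fs) (Z := V.sub i j) hV ha hb
    rw [View.transpose_at] at u
    rw [View.sub_at] at u v
    simp only [Instr.srcs, Instr.dst, List.mem_cons, List.not_mem_nil, or_false, forall_eq,
      Finset.mem_union]
    exact ⟨.inr v, .inl u⟩

/-- A grid computation whose output does not fit into the cache. A long third side pays for the
addition of the temporary outputs. -/
theorem grid_cost_of_heavy {e g s ω : ℝ} {M B : ℕ} (hR : Regime e g s M B) (hω : ω = g ^ 3)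
    (hq : ω ^ (2 / 3 : ℝ) = g ^ 2) {fs : List ℕ} {X Y Z : View} {n₁ n₂ n₃ : ℕ}
    (hS : GridShape (g ^ 2) n₁ n₂ n₃) (hA : GridArrays fs X Y Z n₁ n₂ n₃)
    (hh : 2 * (e * s) ^ 2 ≤ 3 * (n₁ * n₂ : ℝ)) :
    (g ^ 2 * n₁ ≤ 3 * n₃ → g ^ 2 * n₂ ≤ 3 * n₃ →
      CostLE ω M B ((grid ω fs.length X Y Z n₁ n₂ n₃).trace fs)
        ((121 / e ^ 3 * (g * (n₁ * n₂ * n₃) / s) - 7 / e ^ 2 * (g ^ 3 * (n₁ * n₂))) / B)) ∧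
    CostLE ω M B ((grid ω fs.length X Y Z n₁ n₂ n₃).trace fs)
      ((121 / e ^ 3 * (g * (n₁ * n₂ * n₃) / s) + 3 / e ^ 2 * (g ^ 3 * (n₁ * n₂))) / B) := by
  have hB' : (0 : ℝ) < B := by exact_mod_cast hR.hB
  have he := hR.he
  have hg := hR.hg
  have hs := hR.hs
  have hω1 : 1 ≤ ω := by
    rw [hω]
    exact one_le_pow₀ hg
  -- Charges the transfer of a whole cache to the output area.
  have hsq : ∀ {x : ℝ}, 2 * (e * s) ^ 2 ≤ 3 * x →
      2 * (g ^ 3 * s ^ 2) ≤ 3 / e ^ 2 * (g ^ 3 * x) := by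
    intro x hx
    rw [div_mul_eq_mul_div, le_div_iff₀ (by positivity)]
    calc 2 * (g ^ 3 * s ^ 2) * e ^ 2 = g ^ 3 * (2 * (e * s) ^ 2) := by ring
      _ ≤ g ^ 3 * (3 * x) := by gcongr
      _ = _ := by ring
  have base : ∀ fs X Y Z (n₁ n₂ n₃ : ℕ), GridShape (g ^ 2) n₁ n₂ n₃ → GridArrays fs X Y Z n₁ n₂ n₃ →
      2 * (e * s) ^ 2 ≤ 3 * (n₁ * n₂ : ℝ) → (n₁ * n₂ : ℝ) ≤ 2 * (e * s) ^ 2 →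
      (g ^ 2 * n₁ ≤ 3 * n₃ → g ^ 2 * n₂ ≤ 3 * n₃ →
        CostLE ω M B ((grid ω fs.length X Y Z n₁ n₂ n₃).trace fs)
          ((121 / e ^ 3 * (g * (n₁ * n₂ * n₃) / s) - 7 / e ^ 2 * (g ^ 3 * (n₁ * n₂))) / B)) ∧
      CostLE ω M B ((grid ω fs.length X Y Z n₁ n₂ n₃).trace fs)
        ((121 / e ^ 3 * (g * (n₁ * n₂ * n₃) / s) + 3 / e ^ 2 * (g ^ 3 * (n₁ * n₂))) / B) := by
    intro fs X Y Z n₁ n₂ n₃ hS hA hh hfit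
    have hc := grid_cost_of_fit hR hω hq hS hA hfit
    have hs2 := hsq hh
    refine ⟨fun b₁ b₂ => hc.mono (div_le_div_of_nonneg_right ?_ hB'.le),
      hc.mono (div_le_div_of_nonneg_right ?_ hB'.le)⟩
    -- A long third side has `n₃ ≥ g² e s / 4`, so the area term is at most `4 / e` times the volume
    -- term. The pinned block takes 3 and the surplus 7 of the area term; this is `10 * 4 = 40` of
    -- the volume term, and `81 + 40 = 121`.
    · have h4 : g ^ 2 * (e * s) ≤ 4 * n₃ := by
        refine (pow_le_pow_iff_left₀ (by positivity) (by positivity) two_ne_zero).1 ?_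
        have h5 : (g ^ 2 * n₁) * (g ^ 2 * n₂) ≤ (3 * n₃) * (3 * n₃ : ℝ) := by gcongr
        have h6 : (g ^ 2) ^ 2 * (2 * (e * s) ^ 2) ≤ (g ^ 2) ^ 2 * (3 * (n₁ * n₂ : ℝ)) := by gcongr
        have h7 : (0 : ℝ) ≤ n₃ ^ 2 := by positivity
        linarith
      have h5 : g ^ 3 * (n₁ * n₂) ≤ 4 / e * (g * (n₁ * n₂ * n₃) / s) := by
        rw [div_mul_div_comm, le_div_iff₀ (by positivity)]
        calc g ^ 3 * (n₁ * n₂) * (e * s) = g * (n₁ * n₂) * (g ^ 2 * (e * s)) := by ring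
          _ ≤ g * (n₁ * n₂) * (4 * n₃) := by gcongr
          _ = _ := by ring
      have h6 : 10 / e ^ 2 * (g ^ 3 * (n₁ * n₂)) ≤
          10 / e ^ 2 * (4 / e * (g * (n₁ * n₂ * n₃) / s)) := by gcongr
      have h7 : 10 / e ^ 2 * (4 / e * (g * (n₁ * n₂ * n₃) / s)) =
          40 / e ^ 3 * (g * (n₁ * n₂ * n₃) / s) := by
        field_simp
        ring
      have h8 : 121 / e ^ 3 * (g * (n₁ * n₂ * n₃ : ℝ) / s) = 81 / e ^ 3 * (g * (n₁ * n₂ * n₃) / s) +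
          40 / e ^ 3 * (g * (n₁ * n₂ * n₃) / s) := by ring
      have h9 : 10 / e ^ 2 * (g ^ 3 * (n₁ * n₂ : ℝ)) = 3 / e ^ 2 * (g ^ 3 * (n₁ * n₂)) +
          7 / e ^ 2 * (g ^ 3 * (n₁ * n₂)) := by ring
      linarith
    · have h8 : 81 / e ^ 3 * (g * (n₁ * n₂ * n₃ : ℝ) / s) ≤ 121 / e ^ 3 * (g * (n₁ * n₂ * n₃) / s) := by
        gcongr
        norm_num
      linarith
  revert hh
  refine grid_shape_rec hω1 hq (motive := fun fs X Y Z n₁ n₂ n₃ =>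
    2 * (e * s) ^ 2 ≤ 3 * (n₁ * n₂ : ℝ) →
    (g ^ 2 * n₁ ≤ 3 * n₃ → g ^ 2 * n₂ ≤ 3 * n₃ →
      CostLE ω M B ((grid ω fs.length X Y Z n₁ n₂ n₃).trace fs)
        ((121 / e ^ 3 * (g * (n₁ * n₂ * n₃) / s) - 7 / e ^ 2 * (g ^ 3 * (n₁ * n₂))) / B)) ∧
    CostLE ω M B ((grid ω fs.length X Y Z n₁ n₂ n₃).trace fs)
      ((121 / e ^ 3 * (g * (n₁ * n₂ * n₃) / s) + 3 / e ^ 2 * (g ^ 3 * (n₁ * n₂))) / B))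
    ?_ ?_ ?_ ?_ hS hA
  · intro fs X Y Z hS hA hh
    have := hR.one_le
    exact base fs X Y Z 1 1 1 hS hA hh (by push_cast; linarith)
  · rintro fs fs' X Y Z n₁ n₂ a b hfs hS hA ha hab hba hn hE hP hQ hh
    by_cases hfit : (n₁ * n₂ : ℝ) ≤ 2 * (e * s) ^ 2
    · exact base _ _ _ _ _ _ _ hS hA hh hfit
    -- An output of a single cell fits, so the split was caused by a long third side.
    have hmax : g ^ 2 * (max n₁ n₂ : ℕ) < (a + b : ℕ) := by
      refine hn.resolve_left ?_
      rintro ⟨rfl, rfl⟩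
      have := hR.one_le
      push_cast at hfit
      linarith
    have ha3 : ((a + b : ℕ) : ℝ) ≤ 3 * a := by exact_mod_cast show a + b ≤ 3 * a by omega
    have hb3 : ((a + b : ℕ) : ℝ) ≤ 3 * b := by exact_mod_cast show a + b ≤ 3 * b by omega
    have m₁ : g ^ 2 * n₁ ≤ g ^ 2 * (max n₁ n₂ : ℕ) := by
      gcongr
      exact le_max_left _ _
    have m₂ : g ^ 2 * n₂ ≤ g ^ 2 * (max n₁ n₂ : ℕ) := by
      gcongr
      exact le_max_right _ _
    -- Both halves still have a long third side and leave a surplus of 7 area units each. One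
    -- surplus is passed on, the other pays for the addition loop: 6 for its area and 1 for the
    -- transfer of a whole cache, as the area now exceeds `2 (e s)²`.
    have hc : CostLE ω M B ((grid ω fs.length X Y Z n₁ n₂ (a + b)).trace fs)
        ((121 / e ^ 3 * (g * (n₁ * n₂ * (a + b : ℕ)) / s) - 7 / e ^ 2 * (g ^ 3 * (n₁ * n₂))) / B) := by
      rw [hE]
      have hT := parFor_add_cost hR hω (U := Z) (V := ⟨fs.length, 0, n₂, 1⟩)
        (W := ⟨fs.length + 1, 0, n₂, 1⟩) (fs ++ [n₁ * n₂] ++ [n₁ * n₂]) hA.rowsZ rfl rfl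
        hS.pos₁ hS.pos₂ hS.le₁₂ hS.le₂₁
      have h1 := (hP hh).1 (by linarith) (by linarith)
      have h2 := (hQ hh).1 (by linarith) (by linarith)
      have hlt : 2 * (e * s) ^ 2 ≤ n₁ * n₂ := (not_le.1 hfit).le
      have hs3 : 2 * (g ^ 3 * s ^ 2) ≤ 1 / e ^ 2 * (g ^ 3 * (n₁ * n₂)) := by
        rw [div_mul_eq_mul_div, le_div_iff₀ (by positivity)]
        calc 2 * (g ^ 3 * s ^ 2) * e ^ 2 = g ^ 3 * (2 * (e * s) ^ 2) := by ring
          _ ≤ g ^ 3 * (n₁ * n₂) := by gcongr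
          _ = _ := by ring
      subst hfs
      refine ((h1.append h2).append hT).mono ?_
      rw [← add_div, ← add_div]
      refine div_le_div_of_nonneg_right ?_ hB'.le
      have h9 : 121 / e ^ 3 * (g * (n₁ * n₂ * (a + b : ℕ) : ℝ) / s) =
          121 / e ^ 3 * (g * (n₁ * n₂ * a) / s) + 121 / e ^ 3 * (g * (n₁ * n₂ * b) / s) := by
        push_cast
        ring
      have h10 : 7 / e ^ 2 * (g ^ 3 * (n₁ * n₂ : ℝ)) = 6 / e ^ 2 * (g ^ 3 * (n₁ * n₂)) +
          1 / e ^ 2 * (g ^ 3 * (n₁ * n₂)) := by ring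
      linarith
    refine ⟨fun _ _ => hc, hc.mono (div_le_div_of_nonneg_right ?_ hB'.le)⟩
    have p1 : 0 ≤ 7 / e ^ 2 * (g ^ 3 * (n₁ * n₂ : ℝ)) := by positivity
    have p2 : 0 ≤ 3 / e ^ 2 * (g ^ 3 * (n₁ * n₂ : ℝ)) := by positivity
    linarith
  · rintro fs X Y Z a b n₂ n₃ hS hA ha hab hba hE hP hQ hh
    by_cases hfit : ((a + b : ℕ) * n₂ : ℝ) ≤ 2 * (e * s) ^ 2
    · exact base _ _ _ _ _ _ _ hS hA hh hfit
    have ha3 : ((a + b : ℕ) : ℝ) ≤ 3 * a := by exact_mod_cast show a + b ≤ 3 * a by omega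
    have hb3 : ((a + b : ℕ) : ℝ) ≤ 3 * b := by exact_mod_cast show a + b ≤ 3 * b by omega
    have q1 : ((a + b : ℕ) : ℝ) * n₂ ≤ 3 * a * n₂ := by gcongr
    have q2 : ((a + b : ℕ) : ℝ) * n₂ ≤ 3 * b * n₂ := by gcongr
    have hP := hP (by linarith)
    have hQ := hQ (by linarith)
    rw [hE]
    refine ⟨fun b₁ b₂ => ?_, (hP.2.append hQ.2).mono (le_of_eq (by push_cast; ring))⟩
    have r1 : g ^ 2 * a ≤ g ^ 2 * (a + b : ℕ) := by
      gcongr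
      omega
    have r2 : g ^ 2 * b ≤ g ^ 2 * (a + b : ℕ) := by
      gcongr
      omega
    exact ((hP.1 (by linarith) b₂).append (hQ.1 (by linarith) b₂)).mono
      (le_of_eq (by push_cast; ring))
  · rintro fs X Y Z n₁ a b n₃ hS hA ha hab hba hE hP hQ hh
    by_cases hfit : (n₁ * (a + b : ℕ) : ℝ) ≤ 2 * (e * s) ^ 2
    · exact base _ _ _ _ _ _ _ hS hA hh hfit
    have ha3 : ((a + b : ℕ) : ℝ) ≤ 3 * a := by exact_mod_cast show a + b ≤ 3 * a by omega
    have hb3 : ((a + b : ℕ) : ℝ) ≤ 3 * b := by exact_mod_cast show a + b ≤ 3 * b by omega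
    have q1 : n₁ * ((a + b : ℕ) : ℝ) ≤ n₁ * (3 * a) := by gcongr
    have q2 : n₁ * ((a + b : ℕ) : ℝ) ≤ n₁ * (3 * b) := by gcongr
    have hP := hP (by linarith)
    have hQ := hQ (by linarith)
    rw [hE]
    refine ⟨fun b₁ b₂ => ?_, (hP.2.append hQ.2).mono (le_of_eq (by push_cast; ring))⟩
    have r1 : g ^ 2 * a ≤ g ^ 2 * (a + b : ℕ) := by
      gcongr
      omega
    have r2 : g ^ 2 * b ≤ g ^ 2 * (a + b : ℕ) := by
      gcongr
      omega
    exact ((hP.1 b₁ (by linarith)).append (hQ.1 b₁ (by linarith))).mono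
      (le_of_eq (by push_cast; ring))

theorem grid_cost {e g s ω : ℝ} {M B : ℕ} (hR : Regime e g s M B) (hω : ω = g ^ 3)
    (hq : ω ^ (2 / 3 : ℝ) = g ^ 2) {fs : List ℕ} {X Y Z : View} {n₁ n₂ n₃ : ℕ}
    (hS : GridShape (g ^ 2) n₁ n₂ n₃) (hA : GridArrays fs X Y Z n₁ n₂ n₃) :
    CostLE ω M B ((grid ω fs.length X Y Z n₁ n₂ n₃).trace fs)
      ((121 / e ^ 3 * (g * (n₁ * n₂ * n₃) / s) + 3 / e ^ 2 * (g ^ 3 * (n₁ * n₂)) +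
        2 * (g ^ 3 * s ^ 2)) / B) := by
  have hB' : (0 : ℝ) < B := by exact_mod_cast hR.hB
  have he := hR.he
  have hg := hR.hg
  have hs := hR.hs
  by_cases hfit : (n₁ * n₂ : ℝ) ≤ 2 * (e * s) ^ 2
  · refine (grid_cost_of_fit hR hω hq hS hA hfit).mono (div_le_div_of_nonneg_right ?_ hB'.le)
    have h8 : 81 / e ^ 3 * (g * (n₁ * n₂ * n₃ : ℝ) / s) ≤ 121 / e ^ 3 * (g * (n₁ * n₂ * n₃) / s) := by
      gcongr
      norm_num
    have p2 : 0 ≤ 3 / e ^ 2 * (g ^ 3 * (n₁ * n₂ : ℝ)) := by positivity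
    linarith
  · have p : (0 : ℝ) ≤ n₁ * n₂ := by positivity
    refine (grid_cost_of_heavy hR hω hq hS hA (by linarith)).2.mono
      (div_le_div_of_nonneg_right ?_ hB'.le)
    have : 0 ≤ g ^ 3 * s ^ 2 := by positivity
    linarith

/-! ### Cache cost of Kleene's algorithm -/

/-- The nearly equal sides satisfy `GridShape` at the start. Copying loop, grid computation and
addition contribute `6 + 3 + 6` to the area term and `2 + 2 + 2` to the cache term. -/
theorem mulAdd_cost {e g s ω : ℝ} {M B : ℕ} (hR : Regime e g s M B) (hω : ω = g ^ 3)
    (hq : ω ^ (2 / 3 : ℝ) = g ^ 2) {fs : List ℕ} {Z X Y : View} {a b m₁ m₂ m₃ : ℕ} (ha : 0 < a)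
    (hba : b ≤ a + 1) (h₁ : m₁ ∈ Set.Icc a b) (h₂ : m₂ ∈ Set.Icc a b) (h₃ : m₃ ∈ Set.Icc a b)
    (hXl : X.LiveIn fs m₁ m₃) (hX : X.colStride = 1) (hY : Y.colStride = 1) (hZ : Z.colStride = 1) :
    CostLE ω M B ((mulAdd ω fs.length Z X Y m₁ m₂ m₃).trace fs)
      ((121 / e ^ 3 * (g * (m₁ * m₂ * m₃) / s) + 15 / e ^ 2 * (g ^ 3 * b ^ 2) +
        6 * (g ^ 3 * s ^ 2)) / B) := by
  have hB' : (0 : ℝ) < B := by exact_mod_cast hR.hB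
  have he := hR.he
  have hg := hR.hg
  have hs := hR.hs
  obtain ⟨l₁, u₁⟩ := h₁
  obtain ⟨l₂, u₂⟩ := h₂
  obtain ⟨l₃, u₃⟩ := h₃
  have hXf := hXl.frame_lt (by omega) (by omega)
  have hS : GridShape (g ^ 2) m₁ m₂ m₃ := by
    refine ⟨by omega, by omega, by omega, by omega, by omega, by omega, by omega, .inl ?_⟩
    have h3 : (m₃ : ℝ) ≤ 1 * (3 * m₁) := by
      rw [one_mul]
      exact_mod_cast show m₃ ≤ 3 * m₁ by omega
    refine h3.trans ?_
    have : 1 * (3 * m₁ : ℝ) ≤ g ^ 2 * (3 * m₁) := by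
      gcongr
      exact one_le_pow₀ hg
    linarith
  have hA : GridArrays (fs ++ [m₃ * m₂] ++ [m₁ * m₂]) X ⟨fs.length, 0, 1, m₃⟩
      ⟨fs.length + 1, 0, m₂, 1⟩ m₁ m₂ m₃ :=
    ⟨(hXl.append _).append _, liveIn_cols (by simp), liveIn_rows (by simp),
      by simp only; omega, by simp, View.inj_of_rows rfl le_rfl, hX, rfl, rfl⟩
  have c₁ := parFor_copy_cost hR hω (U := ⟨fs.length, 0, 1, m₃⟩) (V := Y) (n₁ := m₃) (n₂ := m₂)
    (fs ++ [m₃ * m₂] ++ [m₁ * m₂]) rfl hY (by omega) (by omega) (by omega) (by omega)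
  have c₂ := grid_cost hR hω hq hS hA
  have c₃ := parFor_add_cost hR hω (U := Z) (V := Z) (W := ⟨fs.length + 1, 0, m₂, 1⟩) (n₁ := m₁)
    (n₂ := m₂) (fs ++ [m₃ * m₂] ++ [m₁ * m₂]) hZ hZ rfl (by omega) (by omega) (by omega) (by omega)
  rw [show (fs ++ [m₃ * m₂] ++ [m₁ * m₂]).length = fs.length + 2 by simp] at c₂
  refine (c₁.append (c₂.append c₃)).mono ?_
  rw [← add_div, ← add_div]
  refine div_le_div_of_nonneg_right ?_ hB'.le
  have v₁ : (m₁ : ℝ) ≤ b := by exact_mod_cast u₁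
  have v₂ : (m₂ : ℝ) ≤ b := by exact_mod_cast u₂
  have v₃ : (m₃ : ℝ) ≤ b := by exact_mod_cast u₃
  have w₁ : 1 / e ^ 2 * (g ^ 3 * (m₃ * m₂ : ℝ)) ≤ 1 / e ^ 2 * (g ^ 3 * (b * b)) := by gcongr
  have w₂ : 1 / e ^ 2 * (g ^ 3 * (m₁ * m₂ : ℝ)) ≤ 1 / e ^ 2 * (g ^ 3 * (b * b)) := by gcongr
  calc _ = 121 / e ^ 3 * (g * (m₁ * m₂ * m₃) / s) + 6 * (1 / e ^ 2 * (g ^ 3 * (m₃ * m₂))) +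
        9 * (1 / e ^ 2 * (g ^ 3 * (m₁ * m₂))) + 6 * (g ^ 3 * s ^ 2) := by ring
    _ ≤ 121 / e ^ 3 * (g * (m₁ * m₂ * m₃) / s) + 6 * (1 / e ^ 2 * (g ^ 3 * (b * b))) +
        9 * (1 / e ^ 2 * (g ^ 3 * (b * b))) + 6 * (g ^ 3 * s ^ 2) := by gcongr
    _ = _ := by ring

theorem kleeneRec_touches {ω : ℝ} (hω : 1 ≤ ω) {A : View} {n : ℕ} (hn : 0 < n) {l : Loc}
    (h : (kleeneRec ω A n).Touches l) : (∃ i < n, ∃ j < n, l = A.at i j) ∨ 1 ≤ l.frame := by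
  revert h
  refine kleeneRec_rec (motive := fun A n P => P.Touches l →
    (∃ i < n, ∃ j < n, l = A.at i j) ∨ 1 ≤ l.frame) ?_ ?_ A n hn
  · intro A h
    simp only [Prog.Touches, Instr.srcs, Instr.dst, List.mem_singleton, or_self] at h
    exact .inl ⟨0, one_pos, 0, one_pos, h⟩
  · intro A a b P Q ha hab hba _ _ hP hQ h
    have key : ∀ {p q p' q' p'' q'' m₁ m₂ m₃}, 0 < m₁ → 0 < m₂ → 0 < m₃ →
        p + m₁ ≤ a + b → q + m₂ ≤ a + b → p' + m₁ ≤ a + b → q' + m₃ ≤ a + b →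
        p'' + m₃ ≤ a + b → q'' + m₂ ≤ a + b →
        (mulAdd ω 1 (A.sub p q) (A.sub p' q') (A.sub p'' q'') m₁ m₂ m₃).Touches l →
          (∃ i < a + b, ∃ j < a + b, l = A.at i j) ∨ 1 ≤ l.frame := by
      intro p q p' q' p'' q'' m₁ m₂ m₃ h₁ h₂ h₃ _ _ _ _ _ _ h
      rcases mulAdd_touches hω h₁ h₂ h₃ h with
        ⟨i, hi, j, hj, e⟩ | ⟨i, hi, j, hj, e⟩ | ⟨i, hi, j, hj, e⟩ | h
      · exact .inl ⟨p' + i, by omega, q' + j, by omega, by rw [e, View.sub_at]⟩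
      · exact .inl ⟨p'' + i, by omega, q'' + j, by omega, by rw [e, View.sub_at]⟩
      · exact .inl ⟨p + i, by omega, q + j, by omega, by rw [e, View.sub_at]⟩
      · exact .inr h
    rcases h with h | (h | h) | h | h | (h | h) | h
    · exact (hP h).imp_left fun ⟨i, hi, j, hj, e⟩ => ⟨i, by omega, j, by omega, e⟩
    iterate 3
      exact key (by omega) (by omega) (by omega) (by omega) (by omega) (by omega) (by omega)
        (by omega) (by omega) h
    · exact (hQ h).imp_left fun ⟨i, hi, j, hj, e⟩ =>
        ⟨a + i, by omega, a + j, by omega, by rw [e, View.sub_at]⟩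
    iterate 3
      exact key (by omega) (by omega) (by omega) (by omega) (by omega) (by omega) (by omega)
        (by omega) (by omega) h

/-- The matrix and the at most `12 n²` words of stack are in the cache at the same time, so every
line is transferred at most once in each direction. -/
theorem kleeneRec_cost_of_fit {e g s ω : ℝ} {M B : ℕ} (hR : Regime e g s M B) (hω : ω = g ^ 3)
    {A : View} {n m : ℕ} (hn : 0 < n) (hAl : A.LiveIn [m] n n) (hAi : A.Inj n n)
    (hA : A.colStride = 1) (hfit : (n : ℝ) ^ 2 ≤ (e * s) ^ 2) :
    CostLE ω M B ((kleeneRec ω A n).trace [m]) (2 * (g ^ 3 * s ^ 2) / B) := by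
  have hB' : (0 : ℝ) < B := by exact_mod_cast hR.hB
  have hg := hR.hg
  have hs := hR.hs
  have hω1 : 1 ≤ ω := by
    rw [hω]
    exact one_le_pow₀ hg
  have hes : 2048 * (e * s) ^ 2 ≤ s ^ 2 := by
    have := hR.he1
    rw [mul_pow]
    nlinarith [sq_nonneg s]
  have hB1 := hR.hB1
  have s1 := hR.side_le (x := n) (by positivity) (by linarith [sq_nonneg (e * s)])
  have hd := kleeneRec_depth hω1 A hn
  have hrf := kleeneRec_raceFree hω1 hn hAl hAi
  have hA0 := (hAl.frame_lt hn hn)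
  set F := viewLines B [m] A n n ∪ intervalLines B [m].sum (kleeneRec ω A n).depth with hF
  have hcard : (F.card * B : ℝ) ≤ s ^ 2 := by
    have c1 := card_viewLines hR.hB [m] A n n
    have c2 := card_intervalLines hR.hB [m].sum (kleeneRec ω A n).depth
    have c3 : F.card * B ≤ n * (n + 2 * B) + (12 * n ^ 2 + 2 * B) :=
      (Nat.mul_le_mul_right B (Finset.card_union_le _ _)).trans (by rw [add_mul]; omega)
    have c4 : (F.card * B : ℝ) ≤ n * (n + 2 * B) + (12 * n ^ 2 + 2 * B) := by exact_mod_cast c3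
    linarith [sq_nonneg s]
  have hFM : F.card * B ≤ M := by
    have : (F.card * B : ℝ) ≤ M := by rwa [hR.hM]
    exact_mod_cast this
  have key : ∀ st ∈ (kleeneRec ω A n).trace [m], ∀ x, x ∈ st.srcs ∨ x = st.dst → x / B ∈ F := by
    intro st hst x hx
    rcases Prog.trace_touches hrf hst x hx with ⟨l, hl, hlive, rfl⟩ | ⟨h, h'⟩
    · rcases kleeneRec_touches hω1 hn hl with ⟨i, hi, j, hj, rfl⟩ | h
      · exact Finset.mem_union_left _ (mem_viewLines hA hi hj)
      · have := hlive.frame_lt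
        simp only [List.length_singleton] at this
        omega
    · exact Finset.mem_union_right _ (mem_intervalLines h h'.le)
  refine (costLE_of_card_le hω1 (F := F) (fun st hst =>
    ⟨fun x hx => key st hst x (.inl hx), key st hst _ (.inr rfl)⟩) hFM).mono ?_
  rw [le_div_iff₀ hB', ← hω]
  calc (1 + ω) * F.card * B = (1 + ω) * (F.card * B) := by ring
    _ ≤ (1 + ω) * s ^ 2 := by gcongr
    _ ≤ (2 * ω) * s ^ 2 := by gcongr; linarith
    _ = _ := by ring

/-- The volume terms of the six products and of the two recursive calls add up to the cube exactly.
The quadratic terms decrease geometrically, as there are only two recursive calls of half the side.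
The recursion stops where the matrix fits; its side is then still at least `e s / 3`, so its area
pays for the cache term. -/
theorem kleeneRec_cost_of_heavy {e g s ω : ℝ} {M B : ℕ} (hR : Regime e g s M B) (hω : ω = g ^ 3)
    (hq : ω ^ (2 / 3 : ℝ) = g ^ 2) {A : View} {n m : ℕ} (hn : 0 < n) (hAl : A.LiveIn [m] n n)
    (hAi : A.Inj n n) (hA : A.colStride = 1) (hh : (e * s) ^ 2 ≤ 9 * (n : ℝ) ^ 2) :
    CostLE ω M B ((kleeneRec ω A n).trace [m])
      ((121 / e ^ 3 * (g * n ^ 3 / s) + 200 / e ^ 2 * (g ^ 3 * n ^ 2)) / B) := by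
  have hB' : (0 : ℝ) < B := by exact_mod_cast hR.hB
  have he := hR.he
  have hg := hR.hg
  have hs := hR.hs
  have base : ∀ (A : View) (n : ℕ), 0 < n → A.LiveIn [m] n n → A.Inj n n → A.colStride = 1 →
      (e * s) ^ 2 ≤ 9 * (n : ℝ) ^ 2 → (n : ℝ) ^ 2 ≤ (e * s) ^ 2 →
      CostLE ω M B ((kleeneRec ω A n).trace [m])
        ((121 / e ^ 3 * (g * n ^ 3 / s) + 200 / e ^ 2 * (g ^ 3 * n ^ 2)) / B) := by
    intro A n hn hAl hAi hA hh hfit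
    refine (kleeneRec_cost_of_fit hR hω hn hAl hAi hA hfit).mono
      (div_le_div_of_nonneg_right ?_ hB'.le)
    have h0 : 0 ≤ 121 / e ^ 3 * (g * n ^ 3 / s) := by positivity
    have h1 : 2 * (g ^ 3 * s ^ 2) ≤ 200 / e ^ 2 * (g ^ 3 * n ^ 2) := by
      rw [div_mul_eq_mul_div, le_div_iff₀ (by positivity)]
      calc 2 * (g ^ 3 * s ^ 2) * e ^ 2 = 2 * (g ^ 3 * (e * s) ^ 2) := by ring
        _ ≤ 2 * (g ^ 3 * (9 * n ^ 2)) := by gcongr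
        _ = 18 * (g ^ 3 * n ^ 2) := by ring
        _ ≤ 200 * (g ^ 3 * n ^ 2) := by gcongr; norm_num
    linarith
  revert hAl hAi hA hh
  suffices kleeneRec ω A n = kleeneRec ω A n → A.LiveIn [m] n n → A.Inj n n → A.colStride = 1 →
      (e * s) ^ 2 ≤ 9 * (n : ℝ) ^ 2 → CostLE ω M B ((kleeneRec ω A n).trace [m])
        ((121 / e ^ 3 * (g * n ^ 3 / s) + 200 / e ^ 2 * (g ^ 3 * n ^ 2)) / B) from this rfl
  refine kleeneRec_rec (motive := fun A n P => P = kleeneRec ω A n → A.LiveIn [m] n n →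
    A.Inj n n → A.colStride = 1 → (e * s) ^ 2 ≤ 9 * (n : ℝ) ^ 2 → CostLE ω M B (P.trace [m])
      ((121 / e ^ 3 * (g * n ^ 3 / s) + 200 / e ^ 2 * (g ^ 3 * n ^ 2)) / B)) ?_ ?_ A n hn
  · intro A hE hAl hAi hA hh
    rw [hE]
    exact base A 1 one_pos hAl hAi hA hh (by simpa using hR.one_le)
  · intro A a b P Q ha hab hba hPe hQe hP hQ hE hAl hAi hA hh
    by_cases hfit : ((a + b : ℕ) : ℝ) ^ 2 ≤ (e * s) ^ 2
    · rw [hE]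
      exact base A (a + b) (by omega) hAl hAi hA hh hfit
    have ha3 : ((a + b : ℕ) : ℝ) ≤ 3 * a := by exact_mod_cast show a + b ≤ 3 * a by omega
    have hb2 : ((a + b : ℕ) : ℝ) ≤ 2 * b := by exact_mod_cast show a + b ≤ 2 * b by omega
    have hab' : (a : ℝ) ≤ b := by exact_mod_cast hab
    have a2 : ((a + b : ℕ) : ℝ) ^ 2 ≤ (3 * a) ^ 2 := by gcongr
    have b2 : ((a + b : ℕ) : ℝ) ^ 2 ≤ (2 * b) ^ 2 := by gcongr
    have hm : ∀ {p q p' q' p'' q'' m₁ m₂ m₃}, m₁ ∈ Set.Icc a b → m₂ ∈ Set.Icc a b →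
        m₃ ∈ Set.Icc a b → p' + m₁ ≤ a + b → q' + m₃ ≤ a + b → CostLE ω M B
          ((mulAdd ω 1 (A.sub p q) (A.sub p' q') (A.sub p'' q'') m₁ m₂ m₃).trace [m])
          ((121 / e ^ 3 * (g * (m₁ * m₂ * m₃) / s) + 15 / e ^ 2 * (g ^ 3 * b ^ 2) +
            6 * (g ^ 3 * s ^ 2)) / B) :=
      fun h₁ h₂ h₃ h h' => mulAdd_cost (fs := [m]) hR hω hq ha hba h₁ h₂ h₃ (hAl.sub h h') hA hA hA
    have hma : a ∈ Set.Icc a b := ⟨le_rfl, hab⟩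
    have hmb : b ∈ Set.Icc a b := ⟨hab, le_rfl⟩
    have c₁ := hP hPe (hAl.mono (by omega) (by omega)) (hAi.mono (by omega) (by omega)) hA
      (by linarith)
    have c₂ := hQ hQe (hAl.sub le_rfl le_rfl) (hAi.sub le_rfl le_rfl) hA
      (by nlinarith [sq_nonneg (b : ℝ)])
    have d₁ := hm (p := 0) (q := a) (p' := 0) (q' := 0) (p'' := 0) (q'' := a) hma hmb hma
      (by omega) (by omega)
    have d₂ := hm (p := a) (q := 0) (p' := a) (q' := 0) (p'' := 0) (q'' := 0) hmb hma hma
      (by omega) (by omega)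
    have d₃ := hm (p := a) (q := a) (p' := a) (q' := 0) (p'' := 0) (q'' := a) hmb hmb hma
      (by omega) (by omega)
    have d₄ := hm (p := 0) (q := a) (p' := 0) (q' := a) (p'' := a) (q'' := a) hma hmb hmb
      (by omega) (by omega)
    have d₅ := hm (p := a) (q := 0) (p' := a) (q' := a) (p'' := a) (q'' := 0) hmb hma hmb
      (by omega) (by omega)
    have d₆ := hm (p := 0) (q := 0) (p' := 0) (q' := a) (p'' := a) (q'' := 0) hma hma hmb
      (by omega) (by omega)
    refine (c₁.append ((d₁.append d₂).append (d₃.append (c₂.append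
      ((d₄.append d₅).append d₆))))).mono ?_
    simp only [← add_div]
    refine div_le_div_of_nonneg_right ?_ hB'.le
    -- The matrix does not fit, so its area also covers the cache terms of the products.
    have hs2 : g ^ 3 * s ^ 2 ≤ 1 / e ^ 2 * (g ^ 3 * (a + b) ^ 2) := by
      rw [not_le] at hfit
      push_cast at hfit
      rw [div_mul_eq_mul_div, le_div_iff₀ (by positivity)]
      calc g ^ 3 * s ^ 2 * e ^ 2 = g ^ 3 * (e * s) ^ 2 := by ring
        _ ≤ g ^ 3 * (a + b) ^ 2 := by gcongr
        _ = _ := by ring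
    -- Six products contribute `6 * 15` and `6 * 6`. The slack is the mixed term `400 a b`, which
    -- suffices because `b ≤ 2 a`.
    have hquad : 90 * (b : ℝ) ^ 2 + 36 * (a + b) ^ 2 + 200 * a ^ 2 + 200 * b ^ 2 ≤
        200 * (a + b) ^ 2 := by
      have : (b : ℝ) ≤ 2 * a := by exact_mod_cast show b ≤ 2 * a by omega
      nlinarith
    have hquad' : 1 / e ^ 2 * (g ^ 3 * (90 * (b : ℝ) ^ 2 + 36 * (a + b) ^ 2 + 200 * a ^ 2 +
        200 * b ^ 2)) ≤ 1 / e ^ 2 * (g ^ 3 * (200 * (a + b) ^ 2)) := by gcongr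
    push_cast
    calc _ = 121 / e ^ 3 * (g * (a + b) ^ 3 / s) + 1 / e ^ 2 * (g ^ 3 * (90 * (b : ℝ) ^ 2 +
          36 * (a + b) ^ 2 + 200 * a ^ 2 + 200 * b ^ 2)) +
          36 * (g ^ 3 * s ^ 2 - 1 / e ^ 2 * (g ^ 3 * (a + b) ^ 2)) := by ring
      _ ≤ 121 / e ^ 3 * (g * (a + b) ^ 3 / s) + 1 / e ^ 2 * (g ^ 3 * (200 * (a + b) ^ 2)) := by
          linarith
      _ = _ := by ring

theorem kleene_cost {e g s ω : ℝ} {M B : ℕ} (hR : Regime e g s M B) (hω : ω = g ^ 3)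
    (hq : ω ^ (2 / 3 : ℝ) = g ^ 2) {n : ℕ} (hn : 0 < n) :
    CostLE ω M B ((kleene ω n).trace [n * n])
      ((121 / e ^ 3 * (g * n ^ 3 / s) + 200 / e ^ 2 * (g ^ 3 * n ^ 2) +
        2 * (g ^ 3 * s ^ 2)) / B) := by
  have hB' : (0 : ℝ) < B := by exact_mod_cast hR.hB
  have he := hR.he
  have hg := hR.hg
  have hs := hR.hs
  have hl : View.LiveIn ⟨0, 0, n, 1⟩ [n * n] n n := liveIn_rows (by simp)
  have hi : View.Inj ⟨0, 0, n, 1⟩ n n := View.inj_of_rows rfl le_rfl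
  by_cases hfit : (n : ℝ) ^ 2 ≤ (e * s) ^ 2
  · refine (kleeneRec_cost_of_fit hR hω hn hl hi rfl hfit).mono
      (div_le_div_of_nonneg_right ?_ hB'.le)
    have : 0 ≤ 121 / e ^ 3 * (g * n ^ 3 / s) + 200 / e ^ 2 * (g ^ 3 * n ^ 2) := by positivity
    linarith
  · refine (kleeneRec_cost_of_heavy hR hω hq hn hl hi rfl (by nlinarith [sq_nonneg (n : ℝ)])).mono
      (div_le_div_of_nonneg_right ?_ hB'.le)
    have : 0 ≤ g ^ 3 * s ^ 2 := by positivity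
    linarith

/-! ### Choice of the parameters and the final cache bounds -/

theorem clog_le_div {M n : ℕ} (hM : 384 ^ 2 ≤ M) (hn : n ≤ M ^ 3) : Nat.clog 2 n ≤ M / 64 := by
  -- Here `384 = 6 * 64`: a square and a cube of `2 ^ (M / 384)` raise the exponent to `6 * (M /
  -- 384) ≤ M / 64`. The size of `M` makes `384` at most `M / 384 + 1`.
  have h1 : M < 384 * (M / 384 + 1) := Nat.lt_mul_div_succ M (by norm_num)
  have h2 : 384 ≤ M / 384 + 1 := by omega
  have h3 : M / 384 + 1 ≤ 2 ^ (M / 384) := Nat.lt_two_pow_self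
  have h4 : M ≤ 2 ^ (2 * (M / 384)) :=
    calc M ≤ (M / 384 + 1) * (M / 384 + 1) := h1.le.trans (Nat.mul_le_mul_right _ h2)
      _ ≤ 2 ^ (M / 384) * 2 ^ (M / 384) := Nat.mul_le_mul h3 h3
      _ = _ := by rw [two_mul, pow_add]
  refine Nat.clog_le_of_le_pow ?_
  calc n ≤ M ^ 3 := hn
    _ ≤ (2 ^ (2 * (M / 384))) ^ 3 := Nat.pow_le_pow_left h4 3
    _ = 2 ^ (2 * (M / 384) * 3) := (pow_mul _ _ _).symm
    _ ≤ 2 ^ (M / 64) := Nat.pow_le_pow_right (by norm_num) (by omega)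

/-- The lower bound needs none of the growth hypotheses on `M` and `n`; they matter for the upper
bound only. -/
theorem le_cacheCost_kleene {ω : ℝ} (hω : 1 ≤ ω) {n M B : ℕ} (hB : 1 ≤ B) (hM : 3 * B ≤ M) :
    ENNReal.ofReal (1 / 200 * (ω ^ (1 / 3 : ℝ) * (n : ℝ) ^ 3 / ((B : ℝ) * √(M : ℝ)))) ≤
      cacheCost ω M B ((kleene ω n).trace [n * n]) := by
  have hB' : (0 : ℝ) < B := by exact_mod_cast hB
  have hs : 0 < √(M : ℝ) := Real.sqrt_pos.2 (by exact_mod_cast show 0 < M by omega)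
  refine le_cacheCost hω fun r w h => ?_
  have hw := kleene_writes hω (by omega) (by omega) h
  rw [mul_div_assoc', div_le_iff₀ (by positivity)]
  have e1 : ω ^ (1 / 3 : ℝ) * ω ^ (2 / 3 : ℝ) = ω := by
    rw [← Real.rpow_add (by linarith)]
    norm_num
  calc 1 / 200 * (ω ^ (1 / 3 : ℝ) * (n : ℝ) ^ 3)
      ≤ 1 / 200 * (ω ^ (1 / 3 : ℝ) * (200 * ω ^ (2 / 3 : ℝ) * √(M : ℝ) * B * w)) := by gcongr
    _ = (ω ^ (1 / 3 : ℝ) * ω ^ (2 / 3 : ℝ)) * w * (B * √(M : ℝ)) := by ring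
    _ = _ := by rw [e1]

theorem cacheCost_kleene_le_of_large {κ ω : ℝ} (hκ : 0 < κ) (hκ1 : κ ≤ 1) (hω : 1 ≤ ω)
    {n M B : ℕ} (hB : 1 ≤ B) (hBM : κ * (B : ℝ) ^ 2 ≤ M) (hωM : κ * ω ^ (2 / 3 : ℝ) ≤ M)
    (hn : κ * (ω ^ (2 / 3 : ℝ) * √(M : ℝ)) ≤ n) (hM : 384 ^ 2 ≤ M) (hM' : 4096 / κ ≤ M) :
    cacheCost ω M B ((kleene ω n).trace [n * n]) ≤ ENNReal.ofReal
      ((121 / √(κ / 2048) ^ 3 + 200 / √(κ / 2048) ^ 2 / κ + 2 / κ ^ 3) *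
        (ω ^ (1 / 3 : ℝ) * (n : ℝ) ^ 3 / ((B : ℝ) * √(M : ℝ)))) := by
  have hMpos : (0 : ℝ) < M := by exact_mod_cast show 0 < M by omega
  have hB' : (1 : ℝ) ≤ B := by exact_mod_cast hB
  set g := ω ^ (1 / 3 : ℝ) with hg
  set s := √(M : ℝ) with hs
  set e := √(κ / 2048) with he
  have hg1 : 1 ≤ g := Real.one_le_rpow hω (by norm_num)
  have hω3 : ω = g ^ 3 := by
    rw [hg, ← Real.rpow_natCast, ← Real.rpow_mul (by linarith)]
    norm_num
  have hq : ω ^ (2 / 3 : ℝ) = g ^ 2 := by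
    rw [hg, ← Real.rpow_natCast, ← Real.rpow_mul (by linarith)]
    norm_num
  have hs2 : (M : ℝ) = s ^ 2 := (Real.sq_sqrt hMpos.le).symm
  have hs1 : 1 ≤ s := Real.one_le_sqrt.2 (by exact_mod_cast show 1 ≤ M by omega)
  have he2 : e ^ 2 = κ / 2048 := Real.sq_sqrt (by positivity)
  have hepos : 0 < e := Real.sqrt_pos.2 (by positivity)
  rw [div_le_iff₀ hκ] at hM'
  rw [hq] at hωM hn
  -- With `e² = κ / 2048` the conditions on `B` and `ω` become the growth hypotheses themselves; `M
  -- ≥ 4096 / κ` gives a block of at least one cell and, with `κ B² ≤ M`, the bound on `B`.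
  have hR : Regime e g s M B := by
    refine ⟨hB, hepos, by linarith, hg1, hs1, hs2, ?_, ?_, ?_, ?_, fun k hk => ?_⟩
    · rw [mul_pow, he2, ← hs2]
      linarith
    · rw [mul_pow, he2, ← hs2]
      linarith
    · rw [mul_pow, he2, ← hs2]
      linarith
    · rw [← hs2]
      have h1 : (4096 : ℝ) * (κ * B ^ 2) ≤ (M * κ) * M := by gcongr
      have h2 : κ * (64 * B : ℝ) ^ 2 ≤ κ * M ^ 2 := by linarith
      exact (pow_le_pow_iff_left₀ (by positivity) hMpos.le two_ne_zero).1 (le_of_mul_le_mul_left h2 hκ)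
    · have h1 : k ≤ M ^ 3 := by
        have : (k : ℝ) ≤ (M : ℝ) ^ 3 := by
          rw [hs2]
          linarith
        exact_mod_cast this
      have h2 : 64 * Nat.clog 2 k ≤ M := by
        have := clog_le_div hM h1
        omega
      rw [← hs2]
      exact_mod_cast h2
  have hn0 : 0 < n := by
    have : (0 : ℝ) < n := lt_of_lt_of_le (by positivity) hn
    exact_mod_cast this
  refine (cacheCost_le hω (kleene_cost hR hω3 hq hn0)).trans (ENNReal.ofReal_le_ofReal ?_)
  -- Because of this bound the area term and the cache term are at most constant multiples of the
  -- volume term.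
  have hn' : g ^ 2 * s ≤ n / κ := by
    rw [le_div_iff₀ hκ]
    linarith
  have hsn : s ≤ n / κ := (le_mul_of_one_le_left (by positivity) (one_le_pow₀ hg1)).trans hn'
  have t1 : g ^ 3 * (n : ℝ) ^ 2 ≤ g * n ^ 3 / s / κ := by
    rw [div_div, le_div_iff₀ (by positivity)]
    calc g ^ 3 * (n : ℝ) ^ 2 * (s * κ) = g * n ^ 2 * (κ * (g ^ 2 * s)) := by ring
      _ ≤ g * n ^ 2 * n := by gcongr
      _ = _ := by ring
  have t2 : g ^ 3 * s ^ 2 ≤ g * n ^ 3 / s / κ ^ 3 := by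
    rw [div_div, le_div_iff₀ (by positivity)]
    calc g ^ 3 * s ^ 2 * (s * κ ^ 3) = g * κ ^ 3 * ((g ^ 2 * s) * s * s) := by ring
      _ ≤ g * κ ^ 3 * ((n / κ) * (n / κ) * (n / κ)) := by gcongr
      _ = _ := by field_simp
  calc (121 / e ^ 3 * (g * n ^ 3 / s) + 200 / e ^ 2 * (g ^ 3 * n ^ 2) + 2 * (g ^ 3 * s ^ 2)) / B
      ≤ (121 / e ^ 3 * (g * n ^ 3 / s) + 200 / e ^ 2 * (g * n ^ 3 / s / κ) +
        2 * (g * n ^ 3 / s / κ ^ 3)) / B := by gcongr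
    _ = (121 / e ^ 3 + 200 / e ^ 2 / κ + 2 / κ ^ 3) * (g * n ^ 3 / s / B) := by ring
    _ = _ := by rw [div_div (g * (n : ℝ) ^ 3) s, mul_comm s]

/-- If `M` is bounded, then so are `B` and, by `κ ω^(2/3) ≤ M`, the cost ratio; charging every
instruction for its own transfers loses only a constant. -/
theorem cacheCost_kleene_le_of_small {κ ω M₀ : ℝ} (hκ : 0 < κ) (hω : 1 ≤ ω)
    {n M B : ℕ} (hB : 1 ≤ B) (hM : 3 * B ≤ M) (hωM : κ * ω ^ (2 / 3 : ℝ) ≤ M) (hM₀ : M ≤ M₀)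
    (hn : 0 < n) :
    cacheCost ω M B ((kleene ω n).trace [n * n]) ≤ ENNReal.ofReal
      (48 * (M₀ ^ 3 / κ) * (ω ^ (1 / 3 : ℝ) * (n : ℝ) ^ 3 / ((B : ℝ) * √(M : ℝ)))) := by
  have hM1 : (1 : ℝ) ≤ M := by exact_mod_cast show 1 ≤ M by omega
  have hB' : (0 : ℝ) < B := by exact_mod_cast hB
  have hs : 0 < √(M : ℝ) := Real.sqrt_pos.2 (by linarith)
  refine (cacheCost_le hω (costLE_length hω hM fun s hs => Prog.length_srcs_le hs)).trans
    (ENNReal.ofReal_le_ofReal ?_)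
  have hlen : ((kleene ω n).trace [n * n]).length ≤ 8 * n ^ 3 :=
    (Prog.length_trace_le _ _).trans (kleeneRec_work hω _ hn).2
  have hlen' : (((kleene ω n).trace [n * n]).length : ℝ) ≤ 8 * (n : ℝ) ^ 3 := by exact_mod_cast hlen
  have hBs : (B : ℝ) * √(M : ℝ) ≤ M₀ * M₀ := by
    have h1 : (B : ℝ) ≤ M₀ := le_trans (by exact_mod_cast show B ≤ M by omega) hM₀
    have h2 : √(M : ℝ) ≤ M₀ := by
      refine le_trans (Real.sqrt_le_iff.2 ⟨by linarith, ?_⟩) hM₀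
      nlinarith
    gcongr
    linarith
  have hq : ω ^ (2 / 3 : ℝ) ≤ M₀ / κ := by
    rw [le_div_iff₀ hκ]
    linarith
  have e1 : ω = ω ^ (1 / 3 : ℝ) * ω ^ (2 / 3 : ℝ) := by
    rw [← Real.rpow_add (by linarith)]
    norm_num
  have hM₀' : 0 ≤ M₀ := by linarith
  calc (1 + ω) * 3 * (((kleene ω n).trace [n * n]).length : ℝ)
      ≤ (ω + ω) * 3 * (8 * (n : ℝ) ^ 3) := by gcongr
    _ = 48 * ((ω ^ (1 / 3 : ℝ) * ω ^ (2 / 3 : ℝ)) * (n : ℝ) ^ 3) := by rw [← e1]; ring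
    _ ≤ 48 * ((ω ^ (1 / 3 : ℝ) * (M₀ / κ)) * (n : ℝ) ^ 3) := by gcongr
    _ = 48 * (M₀ / κ) * (ω ^ (1 / 3 : ℝ) * (n : ℝ) ^ 3 / ((B : ℝ) * √(M : ℝ))) *
        (B * √(M : ℝ)) := by field_simp
    _ ≤ 48 * (M₀ / κ) * (ω ^ (1 / 3 : ℝ) * (n : ℝ) ^ 3 / ((B : ℝ) * √(M : ℝ))) *
        (M₀ * M₀) := by gcongr
    _ = _ := by ring

theorem kleene_cacheCost {κ : ℝ} (hκ : 0 < κ) : ∃ c C : ℝ, 0 < c ∧ ∀ (ω : ℝ) (n M B : ℕ), 1 ≤ ω →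
    1 ≤ B → 3 * B ≤ M → κ * (B : ℝ) ^ 2 ≤ (M : ℝ) → κ * ω ^ (2 / 3 : ℝ) ≤ (M : ℝ) →
    κ * (ω ^ (2 / 3 : ℝ) * √(M : ℝ)) ≤ (n : ℝ) →
    ENNReal.ofReal (c * (ω ^ (1 / 3 : ℝ) * (n : ℝ) ^ 3 / ((B : ℝ) * √(M : ℝ)))) ≤
      cacheCost ω M B ((kleene ω n).trace [n * n]) ∧
    cacheCost ω M B ((kleene ω n).trace [n * n]) ≤
      ENNReal.ofReal (C * (ω ^ (1 / 3 : ℝ) * (n : ℝ) ^ 3 / ((B : ℝ) * √(M : ℝ)))) := by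
  -- `Regime` requires `κ ≤ 1`; a smaller constant only weakens the growth hypotheses.
  set k := min κ 1 with hk
  have hk0 : 0 < k := lt_min hκ one_pos
  have hkκ : k ≤ κ := min_le_left _ _
  -- The threshold between the two upper bounds: above it the logarithm and the single-cell blocks
  -- fit into the cache.
  set M₀ : ℝ := max (384 ^ 2) (4096 / k) with hM₀
  refine ⟨1 / 200, max (121 / √(k / 2048) ^ 3 + 200 / √(k / 2048) ^ 2 / k + 2 / k ^ 3)
    (48 * (M₀ ^ 3 / k)), by norm_num, fun ω n M B hω hB hM hBM hωM hn =>
    ⟨le_cacheCost_kleene hω hB hM, ?_⟩⟩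
  have hMpos : (0 : ℝ) < M := by exact_mod_cast show 0 < M by omega
  have hq : 0 < ω ^ (2 / 3 : ℝ) := by positivity
  have hBM' : k * (B : ℝ) ^ 2 ≤ M := le_trans (by gcongr) hBM
  have hωM' : k * ω ^ (2 / 3 : ℝ) ≤ M := le_trans (by gcongr) hωM
  have hn' : k * (ω ^ (2 / 3 : ℝ) * √(M : ℝ)) ≤ n := le_trans (by gcongr) hn
  rcases le_total M₀ M with h | h
  · have h1 : 384 ^ 2 ≤ M := by
      have := (le_max_left _ _).trans h
      exact_mod_cast this
    refine (cacheCost_kleene_le_of_large hk0 (min_le_right _ _) hω hB hBM' hωM' hn' h1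
      ((le_max_right _ _).trans h)).trans (ENNReal.ofReal_le_ofReal ?_)
    gcongr
    exact le_max_left _ _
  · have hn0 : 0 < n := by
      have : (0 : ℝ) < n := lt_of_lt_of_le (by positivity) hn
      exact_mod_cast this
    refine (cacheCost_kleene_le_of_small hk0 hω hB hM hωM' h hn0).trans (ENNReal.ofReal_le_ofReal ?_)
    gcongr
    exact le_max_right _ _

/-- For equal costs of reads and writes, the hypothesis on the cost ratio is void. -/
theorem kleene_cacheCost_symmetric {κ : ℝ} (hκ : 0 < κ) : ∃ c C : ℝ, 0 < c ∧ ∀ n M B : ℕ, 1 ≤ B →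
    3 * B ≤ M → κ * (B : ℝ) ^ 2 ≤ (M : ℝ) → κ * √(M : ℝ) ≤ (n : ℝ) →
    ENNReal.ofReal (c * ((n : ℝ) ^ 3 / ((B : ℝ) * √(M : ℝ)))) ≤
      cacheCost 1 M B ((kleene 1 n).trace [n * n]) ∧
    cacheCost 1 M B ((kleene 1 n).trace [n * n]) ≤
      ENNReal.ofReal (C * ((n : ℝ) ^ 3 / ((B : ℝ) * √(M : ℝ)))) := by
  obtain ⟨c, C, hc, h⟩ := kleene_cacheCost (κ := min κ 1) (lt_min hκ one_pos)
  refine ⟨c, C, hc, fun n M B hB hM hBM hn => ?_⟩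
  have hM1 : (1 : ℝ) ≤ M := by exact_mod_cast show 1 ≤ M by omega
  have hk := min_le_left κ 1
  have := h 1 n M B le_rfl hB hM (le_trans (by gcongr) hBM)
    (by simpa using (min_le_right κ 1).trans hM1)
    (by
      rw [Real.one_rpow, one_mul]
      exact le_trans (by gcongr) hn)
  simpa only [Real.one_rpow, one_mul] using this

end KleeneAPSP

theorem mainTheorem10 :
    -- correctness and race freedom
    (∀ (ω : ℝ) (n : ℕ), 1 ≤ ω →
      KleeneAPSP.ComputesAPSP n (KleeneAPSP.kleene ω n) ∧
      (KleeneAPSP.kleene ω n).RaceFree [n * n]) ∧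
    -- work
    (∃ c C : ℝ, 0 < c ∧ ∀ (ω : ℝ) (n : ℕ), 1 ≤ ω → 1 ≤ n →
      c * (n : ℝ) ^ 3 ≤ ((KleeneAPSP.kleene ω n).work : ℝ) ∧
      ((KleeneAPSP.kleene ω n).work : ℝ) ≤ C * (n : ℝ) ^ 3) ∧
    -- span
    (∃ C : ℝ, ∀ (ω : ℝ) (n : ℕ), 1 ≤ ω → 1 ≤ n →
      ((KleeneAPSP.kleene ω n).span : ℝ) ≤ C * (n : ℝ)) ∧
    -- symmetric cache complexity
    (∀ κ : ℝ, 0 < κ → ∃ c C : ℝ, 0 < c ∧ ∀ n M B : ℕ, 1 ≤ B → 3 * B ≤ M →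
      κ * (B : ℝ) ^ 2 ≤ (M : ℝ) → κ * √(M : ℝ) ≤ (n : ℝ) →
      ENNReal.ofReal (c * ((n : ℝ) ^ 3 / ((B : ℝ) * √(M : ℝ)))) ≤
        KleeneAPSP.cacheCost 1 M B ((KleeneAPSP.kleene 1 n).trace [n * n]) ∧
      KleeneAPSP.cacheCost 1 M B ((KleeneAPSP.kleene 1 n).trace [n * n]) ≤
        ENNReal.ofReal (C * ((n : ℝ) ^ 3 / ((B : ℝ) * √(M : ℝ))))) ∧
    -- asymmetric cache complexity
    (∀ κ : ℝ, 0 < κ → ∃ c C : ℝ, 0 < c ∧ ∀ (ω : ℝ) (n M B : ℕ), 1 ≤ ω → 1 ≤ B → 3 * B ≤ M →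
      κ * (B : ℝ) ^ 2 ≤ (M : ℝ) → κ * ω ^ (2 / 3 : ℝ) ≤ (M : ℝ) →
      κ * (ω ^ (2 / 3 : ℝ) * √(M : ℝ)) ≤ (n : ℝ) →
      ENNReal.ofReal (c * (ω ^ (1 / 3 : ℝ) * (n : ℝ) ^ 3 / ((B : ℝ) * √(M : ℝ)))) ≤
        KleeneAPSP.cacheCost ω M B ((KleeneAPSP.kleene ω n).trace [n * n]) ∧
      KleeneAPSP.cacheCost ω M B ((KleeneAPSP.kleene ω n).trace [n * n]) ≤
        ENNReal.ofReal (C * (ω ^ (1 / 3 : ℝ) * (n : ℝ) ^ 3 / ((B : ℝ) * √(M : ℝ))))) := by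
  refine ⟨fun ω n hω => ⟨KleeneAPSP.kleene_computesAPSP hω n, KleeneAPSP.kleene_raceFree hω n⟩,
    ⟨1, 8, one_pos, fun ω n hω hn => ?_⟩, ⟨367, fun ω n hω hn => ?_⟩,
    fun κ hκ => KleeneAPSP.kleene_cacheCost_symmetric hκ, fun κ hκ => KleeneAPSP.kleene_cacheCost hκ⟩
  · have h := KleeneAPSP.kleeneRec_work hω ⟨0, 0, n, 1⟩ hn
    rw [one_mul]
    exact ⟨by exact_mod_cast h.1, by exact_mod_cast h.2⟩
  · exact_mod_cast KleeneAPSP.kleeneRec_span hω ⟨0, 0, n, 1⟩ hn
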